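/- Let $\pi\colon E\to\mathbb R$ be a smooth fibre bundle with $\dim E=n+1$, let $k\ge 1$, and let $t$ be the canonical coordinate of $\mathbb R$. Let $J^r\pi$ be the manifold of $r$-jets of local sections of $\pi$, and put $$\mathcal W=J^{2k-1}\pi\times_{J^{k-1}\pi}T^*(J^{k-1}\pi),\qquad \mathcal W_r=J^{2k-1}\pi\times_{J^{k-1}\pi}\bigl(T^*(J^{k-1}\pi)/\langle dt\rangle\bigr),$$ with projections $\rho\colon\mathcal W_r\to\mathbb R$, $\rho_1\colon\mathcal W_r\to J^{2k-1}\pi$ and the quotient map $\mu\colon\mathcal W\to\mathcal W_r$. Let $L\in C^\infty(J^k\pi)$ be a Lagrangian function (with density $L\,dt$). For $w=(j^{2k-1}_t\phi,\alpha)\in\mathcal W$ put $\hat C(w)=\langle\alpha,(j^{k-1}\phi)'(t)\rangle$ and $\hat L(w)=L(j^k_t\phi)$. Over each point of $\mathcal W_r$ there is exactly one point of $\mathcal W$ with $\hat C=\hat L$; this defines a section $\hat h$ of $\mu$. Let $\Theta_r=\hat h^*\Theta\in\Omega^1(\mathcal W_r)$, where $\Theta$ is the pullback to $\mathcal W$ of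 the canonical $1$-form of $T^*(J^{k-1}\pi)$, and $\Omega_r=-d\Theta_r$. In natural coordinates $$\Theta_r=p^i_A\,dq^A_i+(\hat L-p^i_Aq^A_{i+1})\,dt .$$ A curve $\gamma$ in $\mathcal W_r$, defined on an open set of times and with $\rho\circ\gamma=\mathrm{id}$, is called holonomic if $\rho_1\circ\gamma=j^{2k-1}\phi$, where $\phi$ is the projection of $\gamma$ to $E$. A smooth vector field $X$ on $\mathcal W_r$ is $\rho$-transverse if $dt(X)\neq0$ everywhere, and is a semispray of type $1$ if every integral curve $\gamma$ of $X$ on an open set of times with $\rho\circ\gamma=\mathrm{id}$ is holonomic. Let $\mathcal W_1\subseteq\mathcal W_r$ be the set of the points $w$ at which the equation $i(u)\Omega_r=0$ has a solution $u\in T_w\mathcal W_r$ with $dt(u)\ne0$. Let $\psi\colon\mathbb R\to\mathcal W_r$ be a smooth section of $\rho$. Then the following assertions are equivalent. (2) $\psi$ is holonomic and $\psi^*i(Y)\Omega_r=0$ for every smooth vector field $Y$ on $\mathcal W_r$. (3) $\psi$ is holonomic and $i(\psi')(\Omega_r\circ\psi)=0$. (4) $\psi$ is an integral curve of a smooth $\rho$-transverse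 semispray $X$ of type $1$ on $\mathcal W_r$ that satisfies $i(X)\Omega_r=0$ at the points of the image of $\psi$. (4′) $\psi$ takes its values in $\mathcal W_1$ and is an integral curve of a smooth semispray $X$ of type $1$ on $\mathcal W_r$ with $dt(X)=1$ that satisfies $i(X)\Omega_r=0$ at all points of $\mathcal W_1$. If moreover the integral $\mathbf{LH}(\psi)=\int_{\mathbb R}\psi^*\Theta_r$ converges absolutely, then they are also equivalent to the following. (1) $\psi$ is holonomic, and for every smooth compactly supported $\rho$-vertical vector field $Z$ on $\mathcal W_r$ with local one-parameter group $\{\sigma_s\}$ one has $$\frac{d}{ds}\Big|_{s=0}\int_{\mathbb R}(\sigma_s\circ\psi)^*\Theta_r=0 .$$ -/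

import Mathlib

open Set Filter Topology Manifold MeasureTheory
open scoped ContDiff

universe u v

noncomputable section

namespace SkinnerRusk

section Analysis

variable {X Y : Type*} [NormedAddCommGroup X] [NormedSpace ℝ X]
  [NormedAddCommGroup Y] [NormedSpace ℝ Y]

theorem iteratedDeriv_comp_congr {κ : X → Y} {f g : ℝ → X} {t : ℝ} {k : ℕ}
    (hκ : ContDiffAt ℝ ∞ κ (f t)) (hf : ContDiffAt ℝ ∞ f t) (hg : ContDiffAt ℝ ∞ g t)
    (h : ∀ i ≤ k, iteratedDeriv i f t = iteratedDeriv i g t) :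
    ∀ i ≤ k, iteratedDeriv i (κ ∘ f) t = iteratedDeriv i (κ ∘ g) t := by
  have h0 : f t = g t := by simpa using h 0 (Nat.zero_le _)
  intro i hi
  have hi' : (i : ℕ∞ω) ≤ ∞ := by exact_mod_cast le_top
  rw [iteratedDeriv_vcomp_eq_sum_orderedFinpartition hκ hf hi',
    iteratedDeriv_vcomp_eq_sum_orderedFinpartition (h0 ▸ hκ) hg hi', h0]
  refine Finset.sum_congr rfl fun c _ => ?_
  congr 1
  funext j
  exact h _ ((c.partSize_le j).trans hi)

theorem contDiffOn_iteratedDeriv_param {P : Type*} [NormedAddCommGroup P] [NormedSpace ℝ P]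
    {G : P → ℝ → Y} {U : Set (P × ℝ)} (hU : IsOpen U)
    (hG : ContDiffOn ℝ ∞ (fun z : P × ℝ => G z.1 z.2) U) (i : ℕ) :
    ContDiffOn ℝ ∞ (fun z : P × ℝ => iteratedDeriv i (G z.1) z.2) U := by
  induction i with
  | zero => simpa using hG
  | succ i ih =>
    have h1 : ContDiffOn ℝ ∞
        (fun z : P × ℝ => fderiv ℝ (fun z : P × ℝ => iteratedDeriv i (G z.1) z.2) z (0, 1)) U :=
      (ih.fderiv_of_isOpen hU (by simp)).clm_apply contDiffOn_const
    refine h1.congr fun z hz => ?_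
    have hd : HasFDerivAt (fun z : P × ℝ => iteratedDeriv i (G z.1) z.2)
        (fderiv ℝ (fun z : P × ℝ => iteratedDeriv i (G z.1) z.2) z) (z.1, z.2) :=
      ((ih.differentiableOn (by simp)).differentiableAt (hU.mem_nhds hz)).hasFDerivAt
    have hp : HasDerivAt (fun s : ℝ => ((z.1, s) : P × ℝ)) (0, 1) z.2 :=
      (hasDerivAt_const _ _).prodMk (hasDerivAt_id _)
    rw [iteratedDeriv_succ]
    exact (hd.comp_hasDerivAt z.2 hp).deriv

theorem contDiffOn_iteratedDeriv_diag {P : Type*} [NormedAddCommGroup P] [NormedSpace ℝ P]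
    {G : P → ℝ → Y} {U : Set (P × ℝ)} (hU : IsOpen U)
    (hG : ContDiffOn ℝ ∞ (fun z : P × ℝ => G z.1 z.2) U) {τ : P → ℝ} (hτ : ContDiff ℝ ∞ τ)
    {S : Set P} (hS : ∀ x ∈ S, (x, τ x) ∈ U) (i : ℕ) :
    ContDiffOn ℝ ∞ (fun x => iteratedDeriv i (G x) (τ x)) S := by
  have hd : ContDiff ℝ ∞ fun x : P => (x, τ x) := contDiff_id.prodMk hτ
  exact (contDiffOn_iteratedDeriv_param hU hG i).comp hd.contDiffOn hS

/-- The Taylor polynomial curve with `i`-th derivative `x.2 i` at the time `x.1`. -/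
def taylorCurve {k : ℕ} (x : ℝ × (Fin (k + 1) → Y)) (s : ℝ) : Y :=
  ∑ j : Fin (k + 1), ((s - x.1) ^ (j : ℕ) / (j : ℕ).factorial) • x.2 j

theorem contDiff_taylorCurve {k : ℕ} :
    ContDiff ℝ ∞ fun z : (ℝ × (Fin (k + 1) → Y)) × ℝ => taylorCurve z.1 z.2 := by
  unfold taylorCurve
  fun_prop

theorem iteratedDeriv_taylorCurve {k : ℕ} (x : ℝ × (Fin (k + 1) → Y)) (i : Fin (k + 1)) :
    iteratedDeriv (i : ℕ) (taylorCurve x) x.1 = x.2 i := by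
  have h1 : ∀ j : Fin (k + 1), iteratedDeriv (i : ℕ)
      (fun s : ℝ => (s - x.1) ^ (j : ℕ) / ((j : ℕ).factorial : ℝ)) x.1
        = if i = j then 1 else 0 := by
    intro j
    rw [iteratedDeriv_div_const, iteratedDeriv_comp_sub_const (i : ℕ) (fun s : ℝ => s ^ (j : ℕ))]
    simp only [sub_self, iteratedDeriv_fun_pow_zero, Fin.val_inj]
    split_ifs with hij
    · exact div_self (by exact_mod_cast (j : ℕ).factorial_ne_zero)
    · simp
  have h2 : iteratedDeriv (i : ℕ) (taylorCurve x) x.1 = ∑ j : Fin (k + 1),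
      iteratedDeriv (i : ℕ)
        (fun s : ℝ => ((s - x.1) ^ (j : ℕ) / ((j : ℕ).factorial : ℝ)) • x.2 j) x.1 := by
    unfold taylorCurve
    exact iteratedDeriv_fun_sum fun j _ => by fun_prop
  rw [h2, Finset.sum_eq_single i]
  · rw [iteratedDeriv_smul_const (by fun_prop), h1]; simp
  · intro j _ hj
    rw [iteratedDeriv_smul_const (by fun_prop), h1, if_neg (Ne.symm hj), zero_smul]
  · simp

theorem iteratedDeriv_clm_comp (A : X →L[ℝ] Y) {f : ℝ → X} {t : ℝ}
    (hf : ContDiffAt ℝ ∞ f t) (i : ℕ) :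
    iteratedDeriv i (fun s => A (f s)) t = A (iteratedDeriv i f t) := by
  have := A.iteratedFDeriv_comp_left (i := i) hf (by exact_mod_cast le_top)
  simp only [iteratedDeriv]
  change (iteratedFDeriv ℝ i (A ∘ f) t) _ = _
  rw [this]
  rfl

end Analysis

/-- A smooth fibre bundle `π : E → ℝ` with `dim E = n + 1`: `E` is a (Hausdorff, second countable)
smooth manifold and `π` is smoothly locally trivial with typical fibre a smooth manifold `F`. -/
structure ConfigurationBundle (n : ℕ) where
  E : Type u
  F : Type v
  π : E → ℝ
  [topE : TopologicalSpace E]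
  [t2E : T2Space E]
  [secondCountableE : SecondCountableTopology E]
  [chartedE : ChartedSpace (EuclideanSpace ℝ (Fin (n + 1))) E]
  [manifoldE : IsManifold (𝓡 (n + 1)) ∞ E]
  [topF : TopologicalSpace F]
  [chartedF : ChartedSpace (EuclideanSpace ℝ (Fin n)) F]
  [manifoldF : IsManifold (𝓡 n) ∞ F]
  contMDiff_π : ContMDiff (𝓡 (n + 1)) 𝓘(ℝ, ℝ) ∞ π
  locallyTrivial : ∀ t : ℝ, ∃ e : Bundle.Trivialization F π, t ∈ e.baseSet ∧
    ContMDiffOn (𝓡 (n + 1)) (𝓘(ℝ, ℝ).prod (𝓡 n)) ∞ e e.source ∧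
    ContMDiffOn (𝓘(ℝ, ℝ).prod (𝓡 n)) (𝓡 (n + 1)) ∞ e.toOpenPartialHomeomorph.symm e.target

attribute [instance] ConfigurationBundle.topE ConfigurationBundle.t2E
  ConfigurationBundle.secondCountableE ConfigurationBundle.chartedE ConfigurationBundle.manifoldE
  ConfigurationBundle.topF ConfigurationBundle.chartedF ConfigurationBundle.manifoldF

variable {n : ℕ} (B : ConfigurationBundle.{u, v} n)

/-- Smooth charts `(t, q₀)` of `E` adapted to the bundle: their first coordinate is `π`. -/
structure AdaptedChart where
  chart : OpenPartialHomeomorph B.E (ℝ × EuclideanSpace ℝ (Fin n))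
  smooth : ContMDiffOn (𝓡 (n + 1)) 𝓘(ℝ, ℝ × EuclideanSpace ℝ (Fin n)) ∞ chart chart.source
  smooth_symm :
    ContMDiffOn 𝓘(ℝ, ℝ × EuclideanSpace ℝ (Fin n)) (𝓡 (n + 1)) ∞ chart.symm chart.target
  fst_eq : ∀ p ∈ chart.source, (chart p).1 = B.π p

variable {B}

theorem exists_adaptedChart (p : B.E) : ∃ c : AdaptedChart B, p ∈ c.chart.source := by
  obtain ⟨e, het, he, hes⟩ := B.locallyTrivial (B.π p)
  have hp : p ∈ e.source := by rw [e.source_eq]; exact het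
  let f := chartAt (EuclideanSpace ℝ (Fin n)) (e p).2
  let d : OpenPartialHomeomorph (ℝ × B.F) (ℝ × EuclideanSpace ℝ (Fin n)) :=
    (OpenPartialHomeomorph.refl ℝ).prod f
  refine ⟨⟨e.toOpenPartialHomeomorph.trans d, ?_, ?_, ?_⟩, ?_⟩
  · have hd : ContMDiffOn (𝓘(ℝ, ℝ).prod (𝓡 n)) 𝓘(ℝ, ℝ × EuclideanSpace ℝ (Fin n)) ∞
        d d.source := by
      have h1 : ContMDiffOn (𝓘(ℝ, ℝ).prod (𝓡 n)) (𝓡 n) ∞ (fun x : ℝ × B.F => f x.2) d.source :=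
        (contMDiffOn_chart (I := 𝓡 n) (n := ∞) (x := (e p).2)).comp contMDiffOn_snd
          (fun x hx => by simpa [d] using hx)
      have h2 : ContMDiffOn (𝓘(ℝ, ℝ).prod (𝓡 n)) 𝓘(ℝ, ℝ) ∞ (fun x : ℝ × B.F => x.1) d.source :=
        contMDiffOn_fst
      exact h2.prodMk_space h1
    exact hd.comp (he.mono (fun x hx => hx.1)) (fun x hx => hx.2)
  · have hd : ContMDiffOn 𝓘(ℝ, ℝ × EuclideanSpace ℝ (Fin n)) (𝓘(ℝ, ℝ).prod (𝓡 n)) ∞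
        d.symm d.target := by
      have h1 : ContMDiffOn 𝓘(ℝ, ℝ × EuclideanSpace ℝ (Fin n)) (𝓡 n) ∞
          (fun x : ℝ × EuclideanSpace ℝ (Fin n) => f.symm x.2) d.target :=
        (contMDiffOn_chart_symm (I := 𝓡 n) (n := ∞) (x := (e p).2)).comp
          (contDiff_snd.contMDiff.contMDiffOn) (fun x hx => by simpa [d] using hx)
      have h2 : ContMDiffOn 𝓘(ℝ, ℝ × EuclideanSpace ℝ (Fin n)) 𝓘(ℝ, ℝ) ∞
          (fun x : ℝ × EuclideanSpace ℝ (Fin n) => x.1) d.target :=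
        contDiff_fst.contMDiff.contMDiffOn
      exact h2.prodMk h1
    exact hes.comp (hd.mono (fun x hx => hx.1)) (fun x hx => hx.2)
  · intro q hq
    exact e.proj_toFun q hq.1
  · exact ⟨hp, by simp [d, f]⟩

/-- A preferred adapted chart around a point of `E`. -/
def adaptedChartAt (p : B.E) : AdaptedChart B := (exists_adaptedChart p).choose

theorem mem_adaptedChartAt_source (p : B.E) : p ∈ (adaptedChartAt p).chart.source :=
  (exists_adaptedChart p).choose_spec

variable (B) in
/-- `φ` is a smooth section of `π` near the time `t`. -/
def IsSectionNear (φ : ℝ → B.E) (t : ℝ) : Prop :=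
  ∀ᶠ s in 𝓝 t, ContMDiffAt 𝓘(ℝ, ℝ) (𝓡 (n + 1)) ∞ φ s ∧ B.π (φ s) = s

variable (B) in
/-- A time together with a smooth local section of `π` around it. -/
structure LocalSection where
  time : ℝ
  toFun : ℝ → B.E
  isSection : IsSectionNear B toFun time

/-- The point of `E` at which a local section sits. -/
abbrev LocalSection.base (σ : LocalSection B) : B.E := σ.toFun σ.time

variable (B) in
/-- Two local sections have the same `k`-jet when they sit at the same point and, in adapted
coordinates, their derivatives of order at most `k` there agree. -/
def jetSetoid (k : ℕ) : Setoid (LocalSection B) where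
  r σ τ := σ.time = τ.time ∧ σ.base = τ.base ∧
    ∀ c : AdaptedChart B, σ.base ∈ c.chart.source → ∀ i ≤ k,
      iteratedDeriv i (c.chart ∘ σ.toFun) σ.time = iteratedDeriv i (c.chart ∘ τ.toFun) τ.time
  iseqv :=
    { refl := fun _ => ⟨rfl, rfl, fun _ _ _ _ => rfl⟩
      symm := fun h => ⟨h.1.symm, h.2.1.symm, fun c hc i hi => (h.2.2 c (h.2.1 ▸ hc) i hi).symm⟩
      trans := fun h h' => ⟨h.1.trans h'.1, h.2.1.trans h'.2.1, fun c hc i hi =>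
        (h.2.2 c hc i hi).trans (h'.2.2 c (h.2.1 ▸ hc) i hi)⟩ }

variable (B) in
/-- The jet bundle `J^k π`. -/
def Jet (k : ℕ) : Type u := Quotient (jetSetoid B k)

namespace Jet

variable {k r : ℕ}

/-- The `k`-jet at `t` of a section `φ` defined near `t`. -/
def mk (k : ℕ) (φ : ℝ → B.E) (t : ℝ) (h : IsSectionNear B φ t) : Jet B k :=
  Quotient.mk (jetSetoid B k) ⟨t, φ, h⟩

/-- The projection `J^k π → ℝ`. -/
def time (y : Jet B k) : ℝ := Quotient.lift (s := jetSetoid B k) LocalSection.time (fun _ _ h => h.1) y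

/-- The projection `J^k π → E`. -/
def base (y : Jet B k) : B.E := Quotient.lift (s := jetSetoid B k) LocalSection.base (fun _ _ h => h.2.1) y

/-- The projection `J^k π → J^r π` for `r ≤ k`. -/
def proj (h : r ≤ k) (y : Jet B k) : Jet B r :=
  Quotient.map' (s₁ := jetSetoid B k) (s₂ := jetSetoid B r) id
    (fun _ _ h' => ⟨h'.1, h'.2.1, fun c hc i hi => h'.2.2 c hc i (hi.trans h)⟩) y


/-- The local section with polynomial coordinates determined by `x` in the adapted chart `c`. -/
def taylorSection (c : AdaptedChart B) (x : ℝ × (Fin (k + 1) → EuclideanSpace ℝ (Fin n)))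
    (s : ℝ) : B.E :=
  c.chart.symm (s, taylorCurve x s)

theorem eventually_mem_source {φ : ℝ → B.E} {t : ℝ} (h : IsSectionNear B φ t)
    (c : AdaptedChart B) (hc : φ t ∈ c.chart.source) : ∀ᶠ s in 𝓝 t, φ s ∈ c.chart.source :=
  h.self_of_nhds.1.continuousAt.eventually (c.chart.open_source.mem_nhds hc)

theorem contDiffAt_chart_comp {φ : ℝ → B.E} {t : ℝ} (h : IsSectionNear B φ t)
    (c : AdaptedChart B) (hc : φ t ∈ c.chart.source) : ContDiffAt ℝ ∞ (c.chart ∘ φ) t :=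
  contMDiffAt_iff_contDiffAt.1 (((c.smooth _ hc).contMDiffAt
    (c.chart.open_source.mem_nhds hc)).comp t h.self_of_nhds.1)

theorem fst_chart_comp {φ : ℝ → B.E} {t : ℝ} (h : IsSectionNear B φ t)
    (c : AdaptedChart B) (hc : φ t ∈ c.chart.source) :
    ∀ᶠ s in 𝓝 t, (c.chart (φ s)).1 = s := by
  filter_upwards [h, eventually_mem_source h c hc] with s hs hs'
  rw [c.fst_eq _ hs', hs.2]

theorem taylorCurve_self {Y : Type*} [NormedAddCommGroup Y] [NormedSpace ℝ Y]
    (x : ℝ × (Fin (k + 1) → Y)) : taylorCurve x x.1 = x.2 0 := by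
  simpa using iteratedDeriv_taylorCurve x 0

theorem fst_symm (c : AdaptedChart B) {z : ℝ × EuclideanSpace ℝ (Fin n)}
    (hz : z ∈ c.chart.target) : B.π (c.chart.symm z) = z.1 := by
  rw [← c.fst_eq _ (c.chart.map_target hz), c.chart.right_inv hz]

theorem isSectionNear_taylorSection (c : AdaptedChart B)
    (x : ℝ × (Fin (k + 1) → EuclideanSpace ℝ (Fin n))) (hx : (x.1, x.2 0) ∈ c.chart.target) :
    IsSectionNear B (taylorSection c x) x.1 := by
  have hsm : ContDiff ℝ ∞ fun s : ℝ => (s, taylorCurve x s) :=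
    contDiff_id.prodMk (contDiff_taylorCurve.comp (contDiff_const.prodMk contDiff_id))
  have h0 : (x.1, taylorCurve x x.1) ∈ c.chart.target := by rwa [taylorCurve_self]
  filter_upwards [hsm.continuous.continuousAt.eventually (c.chart.open_target.mem_nhds h0)]
    with s hs
  refine ⟨?_, fst_symm c hs⟩
  exact ((c.smooth_symm _ hs).contMDiffAt (c.chart.open_target.mem_nhds hs)).comp s
    hsm.contMDiff.contMDiffAt

/-- Natural coordinates `(t, q₀, …, q_k)` of a jet in an adapted chart around its base point. -/
def coord (c : AdaptedChart B) (y : Jet B k) : ℝ × (Fin (k + 1) → EuclideanSpace ℝ (Fin n)) :=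
  (y.time, fun i => (iteratedDeriv (i : ℕ) (c.chart ∘ (Quotient.out (s := jetSetoid B k) y).toFun) y.time).2)

theorem coord_mk (c : AdaptedChart B) {φ : ℝ → B.E} {t : ℝ} (h : IsSectionNear B φ t)
    (hc : φ t ∈ c.chart.source) :
    coord c (mk k φ t h) =
      (t, fun i : Fin (k + 1) => (iteratedDeriv (i : ℕ) (c.chart ∘ φ) t).2) := by
  have h1 := Quotient.mk_out (s := jetSetoid B k) ⟨t, φ, h⟩
  obtain ⟨h2, h3, h4⟩ := h1
  refine Prod.ext rfl (funext fun i => ?_)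
  have := h4 c (by rw [h3]; exact hc) i (Nat.lt_succ_iff.1 i.2)
  rw [show (Quotient.out (s := jetSetoid B k) (Quotient.mk _ ⟨t, φ, h⟩)).time = t from h2] at this
  exact congrArg Prod.snd this

theorem exists_rep (y : Jet B k) : ∃ φ t h, y = mk k φ t h := by
  induction y using Quotient.ind with
  | _ σ => exact ⟨σ.toFun, σ.time, σ.isSection, rfl⟩

/-- The jet with prescribed natural coordinates. -/
def ofCoord (y₀ : Jet B k) (c : AdaptedChart B)
    (x : ℝ × (Fin (k + 1) → EuclideanSpace ℝ (Fin n))) : Jet B k :=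
  open Classical in
  if hx : (x.1, x.2 0) ∈ c.chart.target then
    mk k (taylorSection c x) x.1 (isSectionNear_taylorSection c x hx)
  else y₀

theorem iteratedDeriv_fst_congr {f g : ℝ → ℝ × EuclideanSpace ℝ (Fin n)} {t : ℝ}
    (hf : ContDiffAt ℝ ∞ f t) (hg : ContDiffAt ℝ ∞ g t)
    (hf1 : ∀ᶠ s in 𝓝 t, (f s).1 = s) (hg1 : ∀ᶠ s in 𝓝 t, (g s).1 = s) (i : ℕ) :
    (iteratedDeriv i f t).1 = (iteratedDeriv i g t).1 := by
  have h1 := iteratedDeriv_clm_comp (ContinuousLinearMap.fst ℝ ℝ (EuclideanSpace ℝ (Fin n))) hf i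
  have h2 := iteratedDeriv_clm_comp (ContinuousLinearMap.fst ℝ ℝ (EuclideanSpace ℝ (Fin n))) hg i
  simp only [ContinuousLinearMap.coe_fst'] at h1 h2
  rw [← h1, ← h2]
  apply Filter.EventuallyEq.iteratedDeriv_eq
  filter_upwards [hf1, hg1] with s a b
  rw [a, b]

theorem chart_comp_taylorSection (c : AdaptedChart B)
    (x : ℝ × (Fin (k + 1) → EuclideanSpace ℝ (Fin n))) (hx : (x.1, x.2 0) ∈ c.chart.target) :
    c.chart ∘ taylorSection c x =ᶠ[𝓝 x.1] fun s => (s, taylorCurve x s) := by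
  have hsm : ContDiff ℝ ∞ fun s : ℝ => (s, taylorCurve x s) :=
    contDiff_id.prodMk (contDiff_taylorCurve.comp (contDiff_const.prodMk contDiff_id))
  have h0 : (x.1, taylorCurve x x.1) ∈ c.chart.target := by rwa [taylorCurve_self]
  filter_upwards [hsm.continuous.continuousAt.eventually (c.chart.open_target.mem_nhds h0)]
    with s hs
  exact c.chart.right_inv hs

theorem base_ofCoord (y₀ : Jet B k) (c : AdaptedChart B)
    {x : ℝ × (Fin (k + 1) → EuclideanSpace ℝ (Fin n))} (hx : (x.1, x.2 0) ∈ c.chart.target) :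
    (ofCoord y₀ c x).base = c.chart.symm (x.1, x.2 0) := by
  rw [ofCoord, dif_pos hx]
  change taylorSection c x x.1 = _
  rw [taylorSection, taylorCurve_self]

theorem coord_ofCoord (y₀ : Jet B k) (c : AdaptedChart B)
    {x : ℝ × (Fin (k + 1) → EuclideanSpace ℝ (Fin n))} (hx : (x.1, x.2 0) ∈ c.chart.target) :
    coord c (ofCoord y₀ c x) = x := by
  have hb : taylorSection c x x.1 ∈ c.chart.source := by
    rw [taylorSection, taylorCurve_self]; exact c.chart.map_target hx
  rw [ofCoord, dif_pos hx, coord_mk c _ hb]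
  refine Prod.ext rfl (funext fun i => ?_)
  have hsm : ContDiff ℝ ∞ fun s : ℝ => (s, taylorCurve x s) :=
    contDiff_id.prodMk (contDiff_taylorCurve.comp (contDiff_const.prodMk contDiff_id))
  have h1 := iteratedDeriv_clm_comp (ContinuousLinearMap.snd ℝ ℝ (EuclideanSpace ℝ (Fin n)))
    (hsm.contDiffAt (x := x.1)) i
  simp only [ContinuousLinearMap.coe_snd'] at h1
  change (iteratedDeriv (i : ℕ) (c.chart ∘ taylorSection c x) x.1).2 = _
  rw [(chart_comp_taylorSection c x hx).iteratedDeriv_eq]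
  rw [← h1]
  exact iteratedDeriv_taylorCurve x i

theorem coord_fst_snd_zero (c : AdaptedChart B) {y : Jet B k} (hy : y.base ∈ c.chart.source) :
    ((coord c y).1, (coord c y).2 0) = c.chart y.base := by
  obtain ⟨φ, t, h, rfl⟩ := exists_rep y
  have hc : φ t ∈ c.chart.source := hy
  rw [coord_mk c h hc]
  refine Prod.ext ?_ ?_
  · exact (fst_chart_comp h c hc).self_of_nhds.symm
  · simp [base, mk]

theorem chart_comp_eventuallyEq {φ : ℝ → B.E} {t : ℝ} (h : IsSectionNear B φ t)
    (c c' : AdaptedChart B) (hc : φ t ∈ c.chart.source) :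
    c'.chart ∘ φ =ᶠ[𝓝 t] (c'.chart ∘ c.chart.symm) ∘ (c.chart ∘ φ) := by
  filter_upwards [eventually_mem_source h c hc] with s hs
  simp [c.chart.left_inv hs]

theorem contDiffAt_transition (c c' : AdaptedChart B) {z : ℝ × EuclideanSpace ℝ (Fin n)}
    (hz : z ∈ c.chart.target) (hz' : c.chart.symm z ∈ c'.chart.source) :
    ContDiffAt ℝ ∞ (c'.chart ∘ c.chart.symm) z :=
  contMDiffAt_iff_contDiffAt.1 (((c'.smooth _ hz').contMDiffAt
    (c'.chart.open_source.mem_nhds hz')).comp z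
    ((c.smooth_symm _ hz).contMDiffAt (c.chart.open_target.mem_nhds hz)))

theorem coord_mem_target (c : AdaptedChart B) {y : Jet B k} (hy : y.base ∈ c.chart.source) :
    ((coord c y).1, (coord c y).2 0) ∈ c.chart.target := by
  rw [coord_fst_snd_zero c hy]; exact c.chart.map_source hy

theorem ofCoord_coord (y₀ : Jet B k) (c : AdaptedChart B) {y : Jet B k}
    (hy : y.base ∈ c.chart.source) : ofCoord y₀ c (coord c y) = y := by
  have hx := coord_mem_target c hy
  obtain ⟨φ, t, h, rfl⟩ := exists_rep y
  have hc : φ t ∈ c.chart.source := hy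
  have hb0 := coord_fst_snd_zero c hy
  rw [ofCoord, dif_pos hx]
  set x := coord c (mk k φ t h) with hxdef
  have hx1 : x.1 = t := rfl
  have hb : taylorSection c x x.1 = φ t := by
    rw [taylorSection, taylorCurve_self, hb0]
    exact c.chart.left_inv hc
  have hbs : taylorSection c x x.1 ∈ c.chart.source := by rw [hb]; exact hc
  have hT := isSectionNear_taylorSection c x hx
  have hd : ∀ i ≤ k, iteratedDeriv i (c.chart ∘ taylorSection c x) t =
      iteratedDeriv i (c.chart ∘ φ) t := by
    intro i hi
    refine Prod.ext ?_ ?_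
    · exact iteratedDeriv_fst_congr (contDiffAt_chart_comp hT c hbs)
        (contDiffAt_chart_comp h c hc) (fst_chart_comp hT c hbs) (fst_chart_comp h c hc) i
    · have h1 := coord_ofCoord (mk k φ t h) c hx
      rw [ofCoord, dif_pos hx, coord_mk c _ hbs] at h1
      have h2 := congrFun (congrArg Prod.snd h1) ⟨i, Nat.lt_succ_of_le hi⟩
      have h3 := congrFun (congrArg Prod.snd (coord_mk (k := k) c h hc)) ⟨i, Nat.lt_succ_of_le hi⟩
      exact h2.trans h3
  refine Quotient.sound (s := jetSetoid B k) ⟨rfl, hb, fun c' hc' i hi => ?_⟩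
  change taylorSection c x x.1 ∈ c'.chart.source at hc'
  change iteratedDeriv i (c'.chart ∘ taylorSection c x) t = iteratedDeriv i (c'.chart ∘ φ) t
  have hE : c'.chart ∘ taylorSection c x =ᶠ[𝓝 t] _ := chart_comp_eventuallyEq hT c c' hbs
  rw [hE.iteratedDeriv_eq i, (chart_comp_eventuallyEq h c c' hc).iteratedDeriv_eq i]
  refine iteratedDeriv_comp_congr ?_ (contDiffAt_chart_comp hT c hbs)
    (contDiffAt_chart_comp h c hc) hd i hi
  refine contDiffAt_transition c c' (c.chart.map_source hbs) ?_
  change c.chart.symm (c.chart (taylorSection c x x.1)) ∈ _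
  rw [c.chart.left_inv hbs]
  exact hc'

/-- The chart of `J^k π` induced by an adapted chart of `E`. -/
def chartEquiv (y₀ : Jet B k) (c : AdaptedChart B) :
    PartialEquiv (Jet B k) (ℝ × (Fin (k + 1) → EuclideanSpace ℝ (Fin n))) where
  toFun := coord c
  invFun := ofCoord y₀ c
  source := {y | y.base ∈ c.chart.source}
  target := {x | (x.1, x.2 0) ∈ c.chart.target}
  map_source' _ hy := coord_mem_target c hy
  map_target' x hx := by
    change (ofCoord y₀ c x).base ∈ c.chart.source
    rw [base_ofCoord y₀ c hx]; exact c.chart.map_target hx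
  left_inv' _ hy := ofCoord_coord y₀ c hy
  right_inv' _ hx := coord_ofCoord y₀ c hx

end Jet

/-- The model space of `J^k π`: coordinates `(t, q₀, …, q_k)`. -/
abbrev JetModel (n k : ℕ) : Type := ℝ × (Fin (k + 1) → EuclideanSpace ℝ (Fin n))

namespace Jet

variable {k r : ℕ}

/-- The change of natural coordinates in `J^k π` between two adapted charts. -/
def transition (c c' : AdaptedChart B) (x : JetModel n k) : JetModel n k :=
  (x.1, fun i => (iteratedDeriv (i : ℕ) (c'.chart ∘ taylorSection c x) x.1).2)

/-- The natural coordinates in which the change of coordinates between `c` and `c'` is defined. -/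
def overlap (k : ℕ) (c c' : AdaptedChart B) : Set (JetModel n k) :=
  {x | (x.1, x.2 0) ∈ c.chart.target ∧ c.chart.symm (x.1, x.2 0) ∈ c'.chart.source}

theorem isOpen_overlap (c c' : AdaptedChart B) : IsOpen (overlap k c c') := by
  have h : Continuous fun x : JetModel n k => (x.1, x.2 0) := by fun_prop
  exact (c.chart.symm.trans c'.chart).open_source.preimage h

theorem coord_ofCoord_eq_transition (y₀ : Jet B k) {c c' : AdaptedChart B} {x : JetModel n k}
    (hx : x ∈ overlap k c c') : coord c' (ofCoord y₀ c x) = transition c c' x := by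
  have hb : taylorSection c x x.1 ∈ c'.chart.source := by
    rw [taylorSection, taylorCurve_self]; exact hx.2
  rw [ofCoord, dif_pos hx.1, coord_mk c' _ hb]
  rfl

theorem contDiffOn_transition (c c' : AdaptedChart B) :
    ContDiffOn ℝ ∞ (transition (k := k) c c') (overlap k c c') := by
  let p : JetModel n k × ℝ → ℝ × EuclideanSpace ℝ (Fin n) := fun z => (z.2, taylorCurve z.1 z.2)
  have hp : ContDiff ℝ ∞ p := contDiff_snd.prodMk contDiff_taylorCurve
  let U : Set (JetModel n k × ℝ) := p ⁻¹' (c.chart.symm.trans c'.chart).source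
  have hU : IsOpen U := (c.chart.symm.trans c'.chart).open_source.preimage hp.continuous
  have hG : ContDiffOn ℝ ∞
      (fun z : JetModel n k × ℝ => (c'.chart ∘ taylorSection c z.1) z.2) U := by
    intro z hz
    exact ((contDiffAt_transition c c' hz.1 hz.2).comp z hp.contDiffAt).contDiffWithinAt
  have hS : ∀ x ∈ overlap k c c', (x, x.1) ∈ U := by
    intro x hx
    change (x.1, taylorCurve x x.1) ∈ (c.chart.symm.trans c'.chart).source
    rw [taylorCurve_self]
    exact hx
  have h3 : ContDiffOn ℝ ∞ (fun x : JetModel n k => fun i : Fin (k + 1) =>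
      (iteratedDeriv (i : ℕ) (c'.chart ∘ taylorSection c x) x.1).2) (overlap k c c') :=
    contDiffOn_pi.2 fun i => (contDiffOn_iteratedDeriv_diag hU hG contDiff_fst hS i).snd
  exact contDiffOn_fst.prodMk h3

theorem coord_mem_overlap {c c' : AdaptedChart B} {y : Jet B k} (hc : y.base ∈ c.chart.source)
    (hc' : y.base ∈ c'.chart.source) : coord c y ∈ overlap k c c' := by
  refine ⟨coord_mem_target c hc, ?_⟩
  rw [coord_fst_snd_zero c hc, c.chart.left_inv hc]
  exact hc'

theorem transition_coord {c c' : AdaptedChart B} {y : Jet B k} (hc : y.base ∈ c.chart.source)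
    (hc' : y.base ∈ c'.chart.source) : transition c c' (coord c y) = coord c' y := by
  rw [← coord_ofCoord_eq_transition y (coord_mem_overlap hc hc'), ofCoord_coord y c hc]

theorem chartEquiv_trans_source (y₀ y₁ : Jet B k) (c c' : AdaptedChart B) :
    ((chartEquiv y₀ c).symm.trans (chartEquiv y₁ c')).source = overlap k c c' := by
  ext x
  change (x.1, x.2 0) ∈ c.chart.target ∧ (ofCoord y₀ c x).base ∈ c'.chart.source ↔ _
  refine and_congr_right fun hx => ?_
  rw [base_ofCoord y₀ c hx]

variable (B k) in
/-- The atlas of natural coordinates on `J^k π`. -/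
def core : ChartedSpaceCore (JetModel n k) (Jet B k) where
  atlas := {e | ∃ y₀ c, e = chartEquiv y₀ c}
  chartAt y := chartEquiv y (adaptedChartAt y.base)
  mem_chart_source y := mem_adaptedChartAt_source y.base
  chart_mem_atlas y := ⟨_, _, rfl⟩
  open_source := by
    rintro _ _ ⟨y₀, c, rfl⟩ ⟨y₁, c', rfl⟩
    rw [chartEquiv_trans_source]
    exact isOpen_overlap c c'
  continuousOn_toFun := by
    rintro _ _ ⟨y₀, c, rfl⟩ ⟨y₁, c', rfl⟩
    rw [chartEquiv_trans_source]
    exact (contDiffOn_transition c c').continuousOn.congr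
      fun x hx => coord_ofCoord_eq_transition y₀ hx

instance : TopologicalSpace (Jet B k) := (core B k).toTopologicalSpace

instance : ChartedSpace (JetModel n k) (Jet B k) := (core B k).toChartedSpace

instance : IsManifold 𝓘(ℝ, JetModel n k) ∞ (Jet B k) := by
  refine isManifold_of_contDiffOn _ _ _ fun e e' he he' => ?_
  obtain ⟨_, ⟨d, rfl⟩, hd⟩ := he
  obtain ⟨_, ⟨d', rfl⟩, hd'⟩ := he'
  obtain ⟨⟨y₀, c, rfl⟩, rfl⟩ := by simpa using hd
  obtain ⟨⟨y₁, c', rfl⟩, rfl⟩ := by simpa using hd'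
  have hs : 𝓘(ℝ, JetModel n k).symm ⁻¹' ((chartEquiv y₀ c).symm.trans (chartEquiv y₁ c')).source
      ∩ range 𝓘(ℝ, JetModel n k) = overlap k c c' := by
    rw [chartEquiv_trans_source]; simp
  refine ((contDiffOn_transition c c').congr fun x hx => ?_).mono hs.subset
  exact coord_ofCoord_eq_transition y₀ hx

end Jet

namespace Jet

variable {k r : ℕ}

theorem proj_base (h : r ≤ k) (y : Jet B k) : (proj h y).base = y.base := by
  induction y using Quotient.ind with
  | _ σ => rfl

/-- The coordinate expression of the projection `J^k π → J^r π`. -/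
def restrictModel (h : r ≤ k) (x : JetModel n k) : JetModel n r :=
  (x.1, fun i => x.2 (Fin.castLE (Nat.succ_le_succ h) i))

theorem coord_proj (h : r ≤ k) (c : AdaptedChart B) {y : Jet B k}
    (hc : y.base ∈ c.chart.source) : coord c (proj h y) = restrictModel h (coord c y) := by
  obtain ⟨φ, t, hφ, rfl⟩ := exists_rep y
  have hc' : φ t ∈ c.chart.source := hc
  rw [coord_mk c hφ hc']
  exact coord_mk c hφ hc'

/-- The Jacobian at the jet `q` of the change of natural coordinates from `c` to `c'`. -/
def jacobian (c c' : AdaptedChart B) (q : Jet B k) : JetModel n k →L[ℝ] JetModel n k :=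
  fderiv ℝ (transition c c') (coord c q)

theorem differentiableAt_transition {c c' : AdaptedChart B} {q : Jet B k}
    (hc : q.base ∈ c.chart.source) (hc' : q.base ∈ c'.chart.source) :
    DifferentiableAt ℝ (transition c c') (coord c q) :=
  ((contDiffOn_transition c c').differentiableOn (by simp)).differentiableAt
    ((isOpen_overlap c c').mem_nhds (coord_mem_overlap hc hc'))

theorem jacobian_comp {c c' c'' : AdaptedChart B} {q : Jet B k}
    (hc : q.base ∈ c.chart.source) (hc' : q.base ∈ c'.chart.source)
    (hc'' : q.base ∈ c''.chart.source) :
    (jacobian c' c'' q).comp (jacobian c c' q) = jacobian c c'' q := by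
  have h1 := (differentiableAt_transition hc hc').hasFDerivAt
  have h2 := (differentiableAt_transition hc' hc'').hasFDerivAt
  rw [← transition_coord hc hc'] at h2
  have h3 := h2.comp _ h1
  have h4 : transition c' c'' ∘ transition c c' =ᶠ[𝓝 (coord c q)] transition c c'' := by
    filter_upwards [(isOpen_overlap c c').mem_nhds (coord_mem_overlap hc hc'),
      (isOpen_overlap c c'').mem_nhds (coord_mem_overlap hc hc'')] with x hx hx'
    have hy := base_ofCoord q c hx.1
    have e0 : coord c (ofCoord q c x) = x := coord_ofCoord q c hx.1
    have b0 : (ofCoord q c x).base ∈ c.chart.source := by rw [hy]; exact c.chart.map_target hx.1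
    have b1 : (ofCoord q c x).base ∈ c'.chart.source := by rw [hy]; exact hx.2
    have b2 : (ofCoord q c x).base ∈ c''.chart.source := by rw [hy]; exact hx'.2
    have e1 := transition_coord b0 b1
    have e2 := transition_coord b0 b2
    have e3 := transition_coord b1 b2
    rw [e0] at e1 e2
    simp [e1, e2, e3]
  rw [jacobian, jacobian, jacobian, ← h4.fderiv_eq, h3.fderiv, transition_coord hc hc']

theorem jacobian_self {c : AdaptedChart B} {q : Jet B k} (hc : q.base ∈ c.chart.source) :
    jacobian c c q = ContinuousLinearMap.id ℝ _ := by
  have h4 : transition c c =ᶠ[𝓝 (coord c q)] id := by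
    filter_upwards [(isOpen_overlap c c).mem_nhds (coord_mem_overlap hc hc)] with x hx
    rw [← coord_ofCoord_eq_transition q hx, coord_ofCoord q c hx.1]
    rfl
  rw [jacobian, h4.fderiv_eq, fderiv_id]

theorem fst_jacobian {c c' : AdaptedChart B} {q : Jet B k}
    (hc : q.base ∈ c.chart.source) (hc' : q.base ∈ c'.chart.source) (v : JetModel n k) :
    (jacobian c c' q v).1 = v.1 := by
  have h1 := (differentiableAt_transition hc hc').hasFDerivAt.fst
  have h2 : HasFDerivAt (fun x : JetModel n k => (transition c c' x).1)
    (ContinuousLinearMap.fst ℝ ℝ _) (coord c q) := hasFDerivAt_fst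
  exact congrArg (fun A : JetModel n k →L[ℝ] ℝ => A v) (h1.unique h2)

theorem contMDiff_time : ContMDiff 𝓘(ℝ, JetModel n k) 𝓘(ℝ, ℝ) ∞ (time : Jet B k → ℝ) := by
  intro q
  have h1 : ContMDiffAt 𝓘(ℝ, JetModel n k) 𝓘(ℝ, JetModel n k) ∞ (chartAt (JetModel n k) q) q :=
    contMDiffAt_of_mem_maximalAtlas (IsManifold.chart_mem_maximalAtlas q) (mem_chart_source _ q)
  exact (contDiff_fst.contMDiff.contMDiffAt (x := chartAt (JetModel n k) q q)).comp q h1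

/-- The covector `dt` at a jet. -/
def dt (q : Jet B k) : TangentSpace 𝓘(ℝ, JetModel n k) q →L[ℝ] ℝ :=
  mfderiv 𝓘(ℝ, JetModel n k) 𝓘(ℝ, ℝ) time q

theorem dt_apply (q : Jet B k) (v : TangentSpace 𝓘(ℝ, JetModel n k) q) :
    dt q v = Prod.fst (α := ℝ) (β := Fin (k + 1) → EuclideanSpace ℝ (Fin n)) v := by
  have h1 : MDifferentiableAt 𝓘(ℝ, JetModel n k) 𝓘(ℝ, ℝ) (time : Jet B k → ℝ) q :=
    (contMDiff_time q).mdifferentiableAt (by simp)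
  have h2 : HasFDerivAt (writtenInExtChartAt 𝓘(ℝ, JetModel n k) 𝓘(ℝ, ℝ) q time)
      (ContinuousLinearMap.fst ℝ ℝ (Fin (k + 1) → EuclideanSpace ℝ (Fin n)))
      (extChartAt 𝓘(ℝ, JetModel n k) q q) := by
    refine HasFDerivAt.congr_of_eventuallyEq (f := Prod.fst) hasFDerivAt_fst ?_
    filter_upwards [(isOpen_extChartAt_target q).mem_nhds (mem_extChartAt_target q)] with x hx
    have := (extChartAt 𝓘(ℝ, JetModel n k) q).right_inv hx
    exact congrArg Prod.fst this
  have h3 : HasMFDerivAt 𝓘(ℝ, JetModel n k) 𝓘(ℝ, ℝ) (time : Jet B k → ℝ) q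
      (ContinuousLinearMap.fst ℝ ℝ (Fin (k + 1) → EuclideanSpace ℝ (Fin n))) :=
    ⟨h1.continuousAt, h2.hasFDerivWithinAt⟩
  rw [dt, h3.mfderiv]
  rfl

end Jet

/-- The cotangent space of `J^m π` at `q`. -/
abbrev Covector {m : ℕ} (q : Jet B m) : Type := TangentSpace 𝓘(ℝ, JetModel n m) q →L[ℝ] ℝ

/-- The fibre `T*_q (J^m π) / ⟨dt⟩` of the restricted momentum bundle `J^m π^*`. -/
abbrev RestrictedCovector {m : ℕ} (q : Jet B m) : Type :=
  Covector q ⧸ Submodule.span ℝ {Jet.dt q}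

variable (B) in
/-- For a system of order `k = m + 1`, the extended jet-momentum bundle
`W = J^{2k-1} π ×_{J^{k-1} π} T*(J^{k-1} π)`. -/
structure ExtendedBundle (m : ℕ) where
  jet : Jet B (2 * m + 1)
  covector : Covector (Jet.proj (by omega : m ≤ 2 * m + 1) jet)

variable (B) in
/-- For a system of order `k = m + 1`, the restricted jet-momentum bundle
`W_r = J^{2k-1} π ×_{J^{k-1} π} (J^{k-1} π)^*`. -/
structure RestrictedBundle (m : ℕ) where
  jet : Jet B (2 * m + 1)
  momentum : RestrictedCovector (Jet.proj (by omega : m ≤ 2 * m + 1) jet)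

/-- The quotient map `μ_W : W → W_r`. -/
def ExtendedBundle.toRestricted {m : ℕ} (w : ExtendedBundle B m) : RestrictedBundle B m :=
  ⟨w.jet, Submodule.Quotient.mk w.covector⟩

/-- The momentum coordinates `(p⁰, …, p^m)`, as a linear form on the space of vertical
vectors `(v₀, …, v_m)`. -/
abbrev MomentumModel (n m : ℕ) : Type := (Fin (m + 1) → EuclideanSpace ℝ (Fin n)) →L[ℝ] ℝ

/-- The model space of `W_r`: coordinates `((t, q₀, …, q_{2m+1}), (p⁰, …, p^m))`. -/
abbrev RestrictedModel (n m : ℕ) : Type := JetModel n (2 * m + 1) × MomentumModel n m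

section Momentum

variable {m : ℕ}

/-- The momentum coordinates, in the adapted chart `c`, of a covector at `q`: its values on the
vertical coordinate vectors of the natural chart of `J^m π` induced by `c`. -/
def covectorCoord (c : AdaptedChart B) (q : Jet B m) (α : Covector q) : MomentumModel n m :=
  (show JetModel n m →L[ℝ] ℝ from α).comp
    ((Jet.jacobian c (adaptedChartAt q.base) q).comp (ContinuousLinearMap.inr ℝ ℝ _))

/-- The momentum coordinates of a restricted covector. -/
def momentumCoord (c : AdaptedChart B) (q : Jet B m) (p : RestrictedCovector q) :
    MomentumModel n m :=
  covectorCoord c q (Quotient.out p)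

/-- The covector `p_i dq_i` at `q`, in the natural chart of `J^m π` induced by `c`. -/
def covectorOfCoord (c : AdaptedChart B) (q : Jet B m) (p : MomentumModel n m) : Covector q :=
  show JetModel n m →L[ℝ] ℝ from
    p.comp ((ContinuousLinearMap.snd ℝ ℝ _).comp (Jet.jacobian (adaptedChartAt q.base) c q))

/-- The restricted covector with prescribed momentum coordinates. -/
def momentumOfCoord (c : AdaptedChart B) (q : Jet B m) (p : MomentumModel n m) :
    RestrictedCovector q :=
  Submodule.Quotient.mk (covectorOfCoord c q p)

theorem momentumCoord_mk {c : AdaptedChart B} {q : Jet B m} (hc : q.base ∈ c.chart.source)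
    (α : Covector q) : momentumCoord c q (Submodule.Quotient.mk α) = covectorCoord c q α := by
  have h1 : (Submodule.Quotient.mk (Quotient.out
      (Submodule.Quotient.mk α : RestrictedCovector q)) : RestrictedCovector q) =
      Submodule.Quotient.mk α := Quotient.out_eq _
  rw [Submodule.Quotient.eq, Submodule.mem_span_singleton] at h1
  obtain ⟨a, ha⟩ := h1
  refine ContinuousLinearMap.ext fun v => ?_
  have h2 := congrArg (fun β : Covector q => β
    (Jet.jacobian c (adaptedChartAt q.base) q ((0 : ℝ), v))) ha
  have h3 : Jet.dt q (Jet.jacobian c (adaptedChartAt q.base) q ((0 : ℝ), v)) = 0 := by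
    exact (Jet.dt_apply q _).trans (Jet.fst_jacobian hc (mem_adaptedChartAt_source _) _)
  have h4 : a * Jet.dt q (Jet.jacobian c (adaptedChartAt q.base) q ((0 : ℝ), v)) =
      momentumCoord c q (Submodule.Quotient.mk α) v - covectorCoord c q α v := h2
  rw [h3, mul_zero] at h4
  exact (sub_eq_zero.1 h4.symm)

theorem momentumCoord_momentumOfCoord {c c' : AdaptedChart B} {q : Jet B m}
    (hc : q.base ∈ c.chart.source) (hc' : q.base ∈ c'.chart.source) (p : MomentumModel n m) :
    momentumCoord c' q (momentumOfCoord c q p) =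
      p.comp ((ContinuousLinearMap.snd ℝ ℝ _).comp
        ((Jet.jacobian c' c q).comp (ContinuousLinearMap.inr ℝ ℝ _))) := by
  rw [momentumOfCoord, momentumCoord_mk hc',
    ← Jet.jacobian_comp hc' (mem_adaptedChartAt_source _) hc]
  rfl

theorem momentumOfCoord_momentumCoord {c : AdaptedChart B} {q : Jet B m}
    (hc : q.base ∈ c.chart.source) (p : RestrictedCovector q) :
    momentumOfCoord c q (momentumCoord c q p) = p := by
  induction p using Submodule.Quotient.induction_on with
  | _ α =>
    rw [momentumCoord_mk hc, momentumOfCoord, Submodule.Quotient.eq, Submodule.mem_span_singleton]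
    have hq := mem_adaptedChartAt_source q.base
    refine ⟨-(show JetModel n m →L[ℝ] ℝ from α)
      (Jet.jacobian c (adaptedChartAt q.base) q ((1 : ℝ), 0)), ?_⟩
    refine ContinuousLinearMap.ext fun (v : JetModel n m) => ?_
    set α' : JetModel n m →L[ℝ] ℝ := α
    set D := Jet.jacobian c (adaptedChartAt q.base) q
    set D' := Jet.jacobian (adaptedChartAt q.base) c q
    have hDD : ∀ v : JetModel n m, D (D' v) = v := fun v => by
      have := congrArg (fun A : JetModel n m →L[ℝ] JetModel n m => A v)
        ((Jet.jacobian_comp hq hc hq).trans (Jet.jacobian_self hq))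
      exact this
    change -α' (D ((1 : ℝ), 0)) * Jet.dt q v = α' (D (0, (D' v).2)) - α' v
    have h1 : Jet.dt q v = (D' v).1 := by
      exact (Jet.dt_apply q v).trans (Jet.fst_jacobian hq hc v).symm
    have h2 : α' v = (D' v).1 * α' (D ((1 : ℝ), 0)) + α' (D (0, (D' v).2)) := by
      have h3 : D' v = (D' v).1 • ((1 : ℝ), (0 : Fin (m + 1) → EuclideanSpace ℝ (Fin n)))
          + (0, (D' v).2) := by
        refine Prod.ext ?_ ?_ <;> simp
      calc α' v = α' (D (D' v)) := by rw [hDD]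
        _ = _ := by
          conv_lhs => rw [h3]
          rw [map_add, map_smul, map_add, map_smul, smul_eq_mul]
    rw [h1, h2]
    ring

end Momentum

namespace RestrictedBundle

variable {m : ℕ}

/-- The projection `W_r → J^{k-1} π`, where `k = m + 1`. -/
def baseJet (w : RestrictedBundle B m) : Jet B m := Jet.proj (by omega) w.jet

/-- The projection `W_r → ℝ`. -/
def time (w : RestrictedBundle B m) : ℝ := w.jet.time

theorem base_baseJet (w : RestrictedBundle B m) : w.baseJet.base = w.jet.base :=
  Jet.proj_base _ _

/-- Natural coordinates `(t, q₀, …, q_{2m+1}, p⁰, …, p^m)` of `W_r` in an adapted chart. -/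
def coord (c : AdaptedChart B) (w : RestrictedBundle B m) : RestrictedModel n m :=
  (Jet.coord c w.jet, momentumCoord c w.baseJet w.momentum)

/-- The point of `W_r` with prescribed natural coordinates. -/
def ofCoord (w₀ : RestrictedBundle B m) (c : AdaptedChart B) (x : RestrictedModel n m) :
    RestrictedBundle B m :=
  ⟨Jet.ofCoord w₀.jet c x.1, momentumOfCoord c _ x.2⟩

theorem ofCoord_coord (w₀ : RestrictedBundle B m) (c : AdaptedChart B) {w : RestrictedBundle B m}
    (hw : w.jet.base ∈ c.chart.source) : ofCoord w₀ c (coord c w) = w := by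
  obtain ⟨y, p⟩ := w
  have key : ∀ y', y' = y →
      (⟨y', momentumOfCoord c _ (momentumCoord c (Jet.proj (by omega) y) p)⟩ :
        RestrictedBundle B m) = ⟨y, p⟩ := by
    rintro _ rfl
    rw [momentumOfCoord_momentumCoord]
    rw [Jet.proj_base]; exact hw
  exact key _ (Jet.ofCoord_coord w₀.jet c hw)

theorem coord_mk {c c' : AdaptedChart B} {y : Jet B (2 * m + 1)} (hc : y.base ∈ c.chart.source)
    (hc' : y.base ∈ c'.chart.source) (p : MomentumModel n m) :
    coord c' (⟨y, momentumOfCoord c _ p⟩ : RestrictedBundle B m) =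
      (Jet.coord c' y, p.comp ((ContinuousLinearMap.snd ℝ ℝ _).comp
        ((Jet.jacobian c' c (Jet.proj (by omega : m ≤ 2 * m + 1) y)).comp
          (ContinuousLinearMap.inr ℝ ℝ _)))) := by
  refine Prod.ext rfl ?_
  exact momentumCoord_momentumOfCoord (by rw [Jet.proj_base]; exact hc)
    (by rw [Jet.proj_base]; exact hc') p

theorem coord_ofCoord (w₀ : RestrictedBundle B m) (c : AdaptedChart B) {x : RestrictedModel n m}
    (hx : (x.1.1, x.1.2 0) ∈ c.chart.target) : coord c (ofCoord w₀ c x) = x := by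
  have hb : (Jet.ofCoord w₀.jet c x.1).base ∈ c.chart.source := by
    rw [Jet.base_ofCoord _ _ hx]; exact c.chart.map_target hx
  rw [ofCoord, coord_mk hb hb, Jet.coord_ofCoord _ _ hx,
    Jet.jacobian_self (by rw [Jet.proj_base]; exact hb)]
  rfl

/-- The change of natural coordinates in `W_r` between two adapted charts. -/
def transition (c c' : AdaptedChart B) (x : RestrictedModel n m) : RestrictedModel n m :=
  (Jet.transition c c' x.1, x.2.comp ((ContinuousLinearMap.snd ℝ ℝ _).comp
    ((fderiv ℝ (Jet.transition (k := m) c' c)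
      (Jet.transition c c' (Jet.restrictModel (by omega) x.1))).comp
        (ContinuousLinearMap.inr ℝ ℝ _))))

/-- The domain of the change of natural coordinates. -/
def overlap (m : ℕ) (c c' : AdaptedChart B) : Set (RestrictedModel n m) :=
  Prod.fst ⁻¹' Jet.overlap (2 * m + 1) c c'

theorem isOpen_overlap (c c' : AdaptedChart B) : IsOpen (overlap m c c') :=
  (Jet.isOpen_overlap c c').preimage continuous_fst

theorem coord_ofCoord_eq_transition (w₀ : RestrictedBundle B m) {c c' : AdaptedChart B}
    {x : RestrictedModel n m} (hx : x ∈ overlap m c c') :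
    coord c' (ofCoord w₀ c x) = transition c c' x := by
  have hb : (Jet.ofCoord w₀.jet c x.1).base ∈ c.chart.source := by
    rw [Jet.base_ofCoord _ _ hx.1]; exact c.chart.map_target hx.1
  have hb' : (Jet.ofCoord w₀.jet c x.1).base ∈ c'.chart.source := by
    rw [Jet.base_ofCoord _ _ hx.1]; exact hx.2
  rw [ofCoord, coord_mk hb hb', Jet.coord_ofCoord_eq_transition _ hx, transition, Jet.jacobian,
    ← Jet.transition_coord (by rw [Jet.proj_base]; exact hb) (by rw [Jet.proj_base]; exact hb'),
    Jet.coord_proj _ _ hb, Jet.coord_ofCoord _ _ hx.1]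

theorem contDiffOn_transition (c c' : AdaptedChart B) :
    ContDiffOn ℝ ∞ (transition (m := m) c c') (overlap m c c') := by
  have h1 : ContDiffOn ℝ ∞ (fun x : RestrictedModel n m => Jet.transition c c' x.1)
      (overlap m c c') :=
    (Jet.contDiffOn_transition c c').comp contDiffOn_fst fun x hx => hx
  have hr : ContDiff ℝ ∞ (fun x : RestrictedModel n m =>
      Jet.restrictModel (by omega : m ≤ 2 * m + 1) x.1) := by
    unfold Jet.restrictModel
    fun_prop
  have hro : ∀ x ∈ overlap m c c',
      Jet.restrictModel (by omega : m ≤ 2 * m + 1) x.1 ∈ Jet.overlap m c c' := fun x hx => hx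
  have h2 : ContDiffOn ℝ ∞ (fun x : RestrictedModel n m =>
      Jet.transition c c' (Jet.restrictModel (by omega : m ≤ 2 * m + 1) x.1)) (overlap m c c') :=
    (Jet.contDiffOn_transition c c').comp hr.contDiffOn hro
  have hto : ∀ x ∈ Jet.overlap m c c', Jet.transition c c' x ∈ Jet.overlap m c' c := by
    intro x hx
    let y : Jet B m :=
      Jet.ofCoord (Jet.mk m _ _ (Jet.isSectionNear_taylorSection c x hx.1)) c x
    have hy : y.base ∈ c.chart.source := by
      rw [Jet.base_ofCoord _ _ hx.1]; exact c.chart.map_target hx.1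
    have hy' : y.base ∈ c'.chart.source := by
      rw [Jet.base_ofCoord _ _ hx.1]; exact hx.2
    rw [← Jet.coord_ofCoord_eq_transition _ hx]
    exact Jet.coord_mem_overlap hy' hy
  have h3 : ContDiffOn ℝ ∞ (fun x : RestrictedModel n m => fderiv ℝ (Jet.transition (k := m) c' c)
      (Jet.transition c c' (Jet.restrictModel (by omega : m ≤ 2 * m + 1) x.1))) (overlap m c c') :=
    ((Jet.contDiffOn_transition c' c).fderiv_of_isOpen (Jet.isOpen_overlap c' c)
      (by simp)).comp h2 fun x hx => hto _ (hro x hx)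
  exact h1.prodMk (contDiffOn_snd.clm_comp
    (contDiffOn_const.clm_comp (h3.clm_comp contDiffOn_const)))

/-- The chart of `W_r` induced by an adapted chart of `E`. -/
def chartEquiv (w₀ : RestrictedBundle B m) (c : AdaptedChart B) :
    PartialEquiv (RestrictedBundle B m) (RestrictedModel n m) where
  toFun := coord c
  invFun := ofCoord w₀ c
  source := {w | w.jet.base ∈ c.chart.source}
  target := {x | (x.1.1, x.1.2 0) ∈ c.chart.target}
  map_source' _ hw := Jet.coord_mem_target c hw
  map_target' x hx := by
    change (Jet.ofCoord w₀.jet c x.1).base ∈ c.chart.source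
    rw [Jet.base_ofCoord _ _ hx]; exact c.chart.map_target hx
  left_inv' _ hw := ofCoord_coord w₀ c hw
  right_inv' _ hx := coord_ofCoord w₀ c hx

theorem chartEquiv_trans_source (w₀ w₁ : RestrictedBundle B m) (c c' : AdaptedChart B) :
    ((chartEquiv w₀ c).symm.trans (chartEquiv w₁ c')).source = overlap m c c' := by
  ext x
  change (x.1.1, x.1.2 0) ∈ c.chart.target ∧ (Jet.ofCoord w₀.jet c x.1).base ∈ c'.chart.source ↔ _
  refine and_congr_right fun hx => ?_
  rw [Jet.base_ofCoord _ c hx]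

variable (B m) in
/-- The atlas of natural coordinates on `W_r`. -/
def core : ChartedSpaceCore (RestrictedModel n m) (RestrictedBundle B m) where
  atlas := {e | ∃ w₀ c, e = chartEquiv w₀ c}
  chartAt w := chartEquiv w (adaptedChartAt w.jet.base)
  mem_chart_source w := mem_adaptedChartAt_source w.jet.base
  chart_mem_atlas w := ⟨_, _, rfl⟩
  open_source := by
    rintro _ _ ⟨w₀, c, rfl⟩ ⟨w₁, c', rfl⟩
    rw [chartEquiv_trans_source]
    exact isOpen_overlap c c'
  continuousOn_toFun := by
    rintro _ _ ⟨w₀, c, rfl⟩ ⟨w₁, c', rfl⟩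
    rw [chartEquiv_trans_source]
    exact (contDiffOn_transition c c').continuousOn.congr
      fun x hx => coord_ofCoord_eq_transition w₀ hx

instance : TopologicalSpace (RestrictedBundle B m) := (core B m).toTopologicalSpace

instance : ChartedSpace (RestrictedModel n m) (RestrictedBundle B m) := (core B m).toChartedSpace

instance : IsManifold 𝓘(ℝ, RestrictedModel n m) ∞ (RestrictedBundle B m) := by
  refine isManifold_of_contDiffOn _ _ _ fun e e' he he' => ?_
  obtain ⟨_, ⟨d, rfl⟩, hd⟩ := he
  obtain ⟨_, ⟨d', rfl⟩, hd'⟩ := he'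
  obtain ⟨⟨w₀, c, rfl⟩, rfl⟩ := by simpa using hd
  obtain ⟨⟨w₁, c', rfl⟩, rfl⟩ := by simpa using hd'
  have hs : 𝓘(ℝ, RestrictedModel n m).symm ⁻¹'
      ((chartEquiv w₀ c).symm.trans (chartEquiv w₁ c')).source
      ∩ range 𝓘(ℝ, RestrictedModel n m) = overlap m c c' := by
    rw [chartEquiv_trans_source]; simp
  refine ((contDiffOn_transition c c').congr fun x hx => ?_).mono hs.subset
  exact coord_ofCoord_eq_transition w₀ hx

end RestrictedBundle

/-- The jet prolongation `s ↦ j^k_s φ` of a section `φ`; at the times near which `φ` is not a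
smooth section, it takes the irrelevant value `y₀`. -/
def prolongation {k : ℕ} (y₀ : Jet B k) (φ : ℝ → B.E) (s : ℝ) : Jet B k :=
  open Classical in if h : IsSectionNear B φ s then Jet.mk k φ s h else y₀

theorem hasMFDerivAt_prolongation {k : ℕ} (y₀ : Jet B k) {φ : ℝ → B.E} {t : ℝ}
    (h : IsSectionNear B φ t) :
    HasMFDerivAt 𝓘(ℝ, ℝ) 𝓘(ℝ, JetModel n k) (prolongation y₀ φ) t
      (show ℝ →L[ℝ] JetModel n k from (ContinuousLinearMap.toSpanSingleton ℝ ((1 : ℝ),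
        fun i : Fin (k + 1) =>
          (iteratedDeriv ((i : ℕ) + 1) ((adaptedChartAt (φ t)).chart ∘ φ) t).2))) := by
  set c := adaptedChartAt (φ t) with hcdef
  have hc : φ t ∈ c.chart.source := mem_adaptedChartAt_source _
  have ht : prolongation y₀ φ t = Jet.mk k φ t h := by rw [prolongation, dif_pos h]
  have hev : ∀ᶠ s in 𝓝 t, Jet.coord c (prolongation y₀ φ s) =
      (s, fun i : Fin (k + 1) => (iteratedDeriv (i : ℕ) (c.chart ∘ φ) s).2) := by
    filter_upwards [Filter.Eventually.eventually_nhds h, Jet.eventually_mem_source h c hc]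
      with s hs hs'
    have hs : IsSectionNear B φ s := hs
    rw [prolongation, dif_pos hs, Jet.coord_mk c hs hs']
  have hcd : ContDiffAt ℝ ∞ (c.chart ∘ φ) t := Jet.contDiffAt_chart_comp h c hc
  have hd : HasDerivAt
      (fun s => (s, fun i : Fin (k + 1) => (iteratedDeriv (i : ℕ) (c.chart ∘ φ) s).2))
      ((1 : ℝ), fun i : Fin (k + 1) => (iteratedDeriv ((i : ℕ) + 1) (c.chart ∘ φ) t).2) t := by
    refine (hasDerivAt_id t).prodMk (hasDerivAt_pi.2 fun i => ?_)
    have h1 : DifferentiableAt ℝ (iteratedDeriv (i : ℕ) (c.chart ∘ φ)) t := by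
      have := hcd.contDiffWithinAt.differentiableWithinAt_iteratedDerivWithin (s := univ)
        (m := (i : ℕ)) (by exact_mod_cast WithTop.coe_lt_top _) (by simp)
      rwa [iteratedDerivWithin_univ, differentiableWithinAt_univ] at this
    rw [iteratedDeriv_succ]
    exact h1.hasDerivAt.snd
  have hd' := hd.congr_of_eventuallyEq hev
  have hchart : ∀ y : Jet B k,
      chartAt (JetModel n k) (prolongation y₀ φ t) y = Jet.coord c y := by
    rw [ht]; intro y; rfl
  refine ⟨?_, ?_⟩
  · have hsrc : prolongation y₀ φ ⁻¹'
        (chartAt (JetModel n k) (prolongation y₀ φ t)).source ∈ 𝓝 t := by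
      rw [ht]
      filter_upwards [Filter.Eventually.eventually_nhds h, Jet.eventually_mem_source h c hc]
        with s hs hs'
      have hs : IsSectionNear B φ s := hs
      change (prolongation y₀ φ s).base ∈ c.chart.source
      rw [prolongation, dif_pos hs]
      exact hs'
    rw [(chartAt (JetModel n k) (prolongation y₀ φ t)).continuousAt_iff_continuousAt_comp_left hsrc]
    exact hd'.continuousAt.congr (Eventually.of_forall fun s => (hchart _).symm)
  · refine (hd'.hasFDerivAt.congr_of_eventuallyEq
      (Eventually.of_forall fun s => ?_)).hasFDerivWithinAt
    exact hchart _

variable {m : ℕ}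

/-- The vector tangent at time `t` to the prolongation `s ↦ j^m_s φ` of any representative `φ`
of the jet `y = j^{2m+1}_t φ`. -/
def totalVector (y : Jet B (2 * m + 1)) :
    TangentSpace 𝓘(ℝ, JetModel n m) (Jet.proj (by omega : m ≤ 2 * m + 1) y) :=
  show JetModel n m from mfderiv 𝓘(ℝ, ℝ) 𝓘(ℝ, JetModel n m)
    (prolongation (Jet.proj (by omega : m ≤ 2 * m + 1) y)
      (Quotient.out (s := jetSetoid B _) y).toFun) y.time
    (1 : ℝ)

/-- The definition of `totalVector` does not depend on the representative. -/
theorem totalVector_mk (y₀ : Jet B m) {φ : ℝ → B.E} {t : ℝ} (h : IsSectionNear B φ t) :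
    (show JetModel n m from totalVector (Jet.mk (2 * m + 1) φ t h)) =
      (show JetModel n m from
        mfderiv 𝓘(ℝ, ℝ) 𝓘(ℝ, JetModel n m) (prolongation y₀ φ) t (1 : ℝ)) := by
  have h1 := Quotient.mk_out (s := jetSetoid B (2 * m + 1)) ⟨t, φ, h⟩
  set σ := Quotient.out (s := jetSetoid B (2 * m + 1)) (Quotient.mk _ ⟨t, φ, h⟩)
  obtain ⟨h2, h3, h4⟩ := h1
  change σ.time = t at h2
  change σ.toFun σ.time = φ t at h3
  have hσ : IsSectionNear B σ.toFun t := h2 ▸ σ.isSection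
  have e1 := (hasMFDerivAt_prolongation (Jet.proj (by omega : m ≤ 2 * m + 1)
    (Jet.mk (2 * m + 1) φ t h)) hσ).mfderiv
  have e2 := (hasMFDerivAt_prolongation y₀ h).mfderiv
  change (mfderiv 𝓘(ℝ, ℝ) 𝓘(ℝ, JetModel n m) (prolongation _ σ.toFun) t : ℝ →L[ℝ] JetModel n m) 1
    = (mfderiv 𝓘(ℝ, ℝ) 𝓘(ℝ, JetModel n m) (prolongation y₀ φ) t : ℝ →L[ℝ] JetModel n m) 1
  have e : ∀ i : Fin (m + 1),
      iteratedDeriv ((i : ℕ) + 1) ((adaptedChartAt (σ.toFun t)).chart ∘ σ.toFun) t =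
      iteratedDeriv ((i : ℕ) + 1) ((adaptedChartAt (φ t)).chart ∘ φ) t := by
    intro i
    rw [h2] at h3
    rw [h3]
    have := h4 (adaptedChartAt (φ t)) (by
      change σ.toFun σ.time ∈ _
      rw [h2, h3]; exact mem_adaptedChartAt_source _) ((i : ℕ) + 1) (by have := i.2; omega)
    rw [h2] at this
    exact this
  refine (congrArg (fun A : ℝ →L[ℝ] JetModel n m => A 1) e1).trans
    (Eq.trans ?_ (congrArg (fun A : ℝ →L[ℝ] JetModel n m => A 1) e2).symm)
  simp only [e]

theorem dt_totalVector (y : Jet B (2 * m + 1)) : Jet.dt _ (totalVector y) = 1 := by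
  obtain ⟨φ, t, h, rfl⟩ := Jet.exists_rep y
  have e2 := (hasMFDerivAt_prolongation (Jet.mk m φ t h) h).mfderiv
  have e3 := (totalVector_mk (Jet.mk m φ t h) h).trans
    (congrArg (fun A : ℝ →L[ℝ] JetModel n m => A 1) e2)
  refine (Jet.dt_apply _ _).trans ((congrArg Prod.fst e3).trans ?_)
  simp

/-- The coupling function `Ĉ` on `W`: the coupling 1-form is `Ĉ dt`. -/
def couplingFunction (w : ExtendedBundle B m) : ℝ := w.covector (totalVector w.jet)

/-- The pullback `L̂` to `W` of a Lagrangian function `L` on `J^k π`, `k = m + 1`. -/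
def lagrangianFunction (L : Jet B (m + 1) → ℝ) (w : ExtendedBundle B m) : ℝ :=
  L (Jet.proj (by omega : m + 1 ≤ 2 * m + 1) w.jet)

/-- The Hamiltonian submanifold `W_o ⊆ W`. -/
def hamiltonianSubmanifold (L : Jet B (m + 1) → ℝ) : Set (ExtendedBundle B m) :=
  {w | couplingFunction w = lagrangianFunction L w}

theorem covector_adjust {q : Jet B m} {τ : TangentSpace 𝓘(ℝ, JetModel n m) q}
    (hτ : Jet.dt q τ = 1) (ℓ : ℝ) (α β : Covector q) :
    β = α + (ℓ - α τ) • Jet.dt q ↔ β τ = ℓ ∧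
      (Submodule.Quotient.mk β : RestrictedCovector q) = Submodule.Quotient.mk α := by
  rw [Submodule.Quotient.eq, Submodule.mem_span_singleton]
  constructor
  · rintro rfl
    refine ⟨?_, ℓ - α τ, (add_sub_cancel_left _ _).symm⟩
    change α τ + (ℓ - α τ) * Jet.dt q τ = ℓ
    rw [hτ]; ring
  · rintro ⟨h1, a, ha⟩
    have h2 : a * Jet.dt q τ = β τ - α τ := congrArg (fun γ : Covector q => γ τ) ha
    rw [hτ, h1, mul_one] at h2
    rw [← h2, ha, add_sub_cancel]

/-- The Hamiltonian section `ĥ : W_r → W`. -/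
def hamiltonianSection (L : Jet B (m + 1) → ℝ) (w : RestrictedBundle B m) : ExtendedBundle B m :=
  let α : Covector (Jet.proj (by omega : m ≤ 2 * m + 1) w.jet) := Quotient.out w.momentum
  ⟨w.jet, α + (lagrangianFunction L ⟨w.jet, α⟩ - couplingFunction ⟨w.jet, α⟩) • Jet.dt _⟩

/-- `ĥ w` is the unique point of `W_o` over `w`. -/
theorem eq_hamiltonianSection_iff (L : Jet B (m + 1) → ℝ) (w : RestrictedBundle B m)
    (w' : ExtendedBundle B m) :
    w' = hamiltonianSection L w ↔ w' ∈ hamiltonianSubmanifold L ∧ w'.toRestricted = w := by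
  obtain ⟨y, p⟩ := w
  obtain ⟨y', β⟩ := w'
  by_cases hy : y' = y
  · subst hy
    have h := covector_adjust (dt_totalVector y')
      (L (Jet.proj (by omega : m + 1 ≤ 2 * m + 1) y')) (Quotient.out p) β
    have hp : (Submodule.Quotient.mk (Quotient.out p) :
        RestrictedCovector (Jet.proj (by omega : m ≤ 2 * m + 1) y')) = p := Quotient.out_eq _
    rw [hp] at h
    refine Iff.trans ⟨fun h' => ?_, fun h' => congrArg (ExtendedBundle.mk y') h'⟩
      (h.trans (and_congr_right fun _ =>
        ⟨fun h' => congrArg (RestrictedBundle.mk y') h', fun h' => ?_⟩))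
    · exact (ExtendedBundle.mk.inj h').2
    · exact eq_of_heq (RestrictedBundle.mk.inj h').2
  · refine ⟨fun h => (hy (congrArg ExtendedBundle.jet h)).elim,
      fun h => (hy (congrArg RestrictedBundle.jet h.2)).elim⟩

section ExteriorDerivative

variable {H M : Type*} [NormedAddCommGroup H] [NormedSpace ℝ H] [TopologicalSpace M]
  [ChartedSpace H M]

/-- The expression of a 1-form in the preferred chart at `w₀`. -/
def chartExpression (θ : (w : M) → TangentSpace 𝓘(ℝ, H) w →L[ℝ] ℝ) (w₀ : M) (x : H) :
    H →L[ℝ] ℝ :=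
  (show H →L[ℝ] ℝ from θ ((chartAt H w₀).symm x)).comp
    (show H →L[ℝ] H from mfderiv 𝓘(ℝ, H) 𝓘(ℝ, H) (chartAt H w₀).symm x)

/-- The exterior derivative of a 1-form `θ`, computed at `w` in the preferred chart at `w`, through
which Mathlib identifies the tangent space at `w` with the model space. -/
def exteriorDerivative (θ : (w : M) → TangentSpace 𝓘(ℝ, H) w →L[ℝ] ℝ) (w : M)
    (u v : TangentSpace 𝓘(ℝ, H) w) : ℝ :=
  fderiv ℝ (chartExpression θ w) (chartAt H w w) u v -
    fderiv ℝ (chartExpression θ w) (chartAt H w w) v u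

end ExteriorDerivative

/-- The form `Θ_r = ĥ^* Θ` on `W_r`, where `Θ` is the pullback to `W` of the canonical 1-form
of `T*(J^{k-1} π)`: it sends a tangent vector `u` at `w` to the value of the covector of `ĥ w` on
the projection of `u` to `J^{k-1} π`. -/
def unifiedOneForm (L : Jet B (m + 1) → ℝ) (w : RestrictedBundle B m) :
    TangentSpace 𝓘(ℝ, RestrictedModel n m) w →L[ℝ] ℝ :=
  (show TangentSpace 𝓘(ℝ, JetModel n m) w.baseJet →L[ℝ] ℝ from
    (hamiltonianSection L w).covector).comp
    (mfderiv 𝓘(ℝ, RestrictedModel n m) 𝓘(ℝ, JetModel n m) RestrictedBundle.baseJet w)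

/-- The form `Ω_r = -dΘ_r` on `W_r`. -/
def unifiedTwoForm (L : Jet B (m + 1) → ℝ) (w : RestrictedBundle B m)
    (u v : TangentSpace 𝓘(ℝ, RestrictedModel n m) w) : ℝ :=
  -exteriorDerivative (unifiedOneForm L) w u v

/-- The form `dt` on `W_r`, the pullback of the volume form of `ℝ`. -/
def timeForm (w : RestrictedBundle B m) : TangentSpace 𝓘(ℝ, RestrictedModel n m) w →L[ℝ] ℝ :=
  mfderiv 𝓘(ℝ, RestrictedModel n m) 𝓘(ℝ, ℝ) RestrictedBundle.time w

/-- Smooth global sections of `W_r → ℝ`. -/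
def IsGlobalSection (ψ : ℝ → RestrictedBundle B m) : Prop :=
  ContMDiff 𝓘(ℝ, ℝ) 𝓘(ℝ, RestrictedModel n m) ∞ ψ ∧ ∀ t, (ψ t).time = t

/-- The curve `ψ` in `W_r` is holonomic (of type 1) at `t`: its component in `J^{2k-1} π` is there
the `(2k-1)`-jet of its projection to `E`. -/
def IsHolonomicAt (ψ : ℝ → RestrictedBundle B m) (t : ℝ) : Prop :=
  ∃ h : IsSectionNear B (fun s => (ψ s).jet.base) t,
    (ψ t).jet = Jet.mk (2 * m + 1) (fun s => (ψ s).jet.base) t h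

/-- The curve `ψ` is holonomic. -/
def IsHolonomic (ψ : ℝ → RestrictedBundle B m) : Prop := ∀ t, IsHolonomicAt ψ t

variable (B m) in
/-- (Not necessarily smooth) vector fields on `W_r`. -/
abbrev VectorFieldOn : Type u :=
  (w : RestrictedBundle B m) → TangentSpace 𝓘(ℝ, RestrictedModel n m) w

/-- Smoothness of a vector field on `W_r`. -/
def IsSmoothField (X : VectorFieldOn B m) : Prop :=
  ContMDiff 𝓘(ℝ, RestrictedModel n m) 𝓘(ℝ, RestrictedModel n m).tangent ∞
    fun w => (⟨w, X w⟩ : TangentBundle 𝓘(ℝ, RestrictedModel n m) (RestrictedBundle B m))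

/-- The canonical lifting `ψ'` of a curve `ψ` to the tangent bundle. -/
def velocity (ψ : ℝ → RestrictedBundle B m) (t : ℝ) :
    TangentSpace 𝓘(ℝ, RestrictedModel n m) (ψ t) :=
  mfderiv 𝓘(ℝ, ℝ) 𝓘(ℝ, RestrictedModel n m) ψ t (1 : ℝ)

/-- The function `f` such that `ψ^* Θ_r = f dt`. -/
def pullbackOneForm (L : Jet B (m + 1) → ℝ) (ψ : ℝ → RestrictedBundle B m) (t : ℝ) : ℝ :=
  unifiedOneForm L (ψ t) (velocity ψ t)

/-- The Lagrangian-Hamiltonian functional `LH(ψ) = ∫ ψ^* Θ_r`. -/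
def functionalLH (L : Jet B (m + 1) → ℝ) (ψ : ℝ → RestrictedBundle B m) : ℝ :=
  ∫ t : ℝ, pullbackOneForm L ψ t

/-- `σ` is a local one-parameter group of the vector field `Z`, defined for `|s| < ε`. -/
structure IsLocalFlow (Z : VectorFieldOn B m) (ε : ℝ)
    (σ : ℝ → RestrictedBundle B m → RestrictedBundle B m) : Prop where
  pos : 0 < ε
  smooth : ContMDiffOn (𝓘(ℝ, ℝ).prod 𝓘(ℝ, RestrictedModel n m)) 𝓘(ℝ, RestrictedModel n m) ∞
    (fun x : ℝ × RestrictedBundle B m => σ x.1 x.2) (Ioo (-ε) ε ×ˢ univ)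
  zero : ∀ w, σ 0 w = w
  integral : ∀ w, IsMIntegralCurveOn (fun s => σ s w) Z (Ioo (-ε) ε)

/-- `ψ` is a solution of the Lagrangian-Hamiltonian variational problem: it is holonomic, and it is
a critical point of `LH` for the variations `ψ_s = σ_s ∘ ψ`, with `σ` a local one-parameter group
of a compactly supported vertical vector field. -/
def IsVariationalSolution (L : Jet B (m + 1) → ℝ) (ψ : ℝ → RestrictedBundle B m) : Prop :=
  IsHolonomic ψ ∧
    ∀ Z : VectorFieldOn B m, IsSmoothField Z → (∀ w, timeForm w (Z w) = 0) →
      IsCompact (closure {w | Z w ≠ 0}) →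
      ∀ (ε : ℝ) (σ : ℝ → RestrictedBundle B m → RestrictedBundle B m), IsLocalFlow Z ε σ →
        HasDerivAt (fun s => functionalLH L (σ s ∘ ψ)) 0 0

/-- `X` is transverse to the projection `W_r → ℝ`. -/
def IsTransverse (X : VectorFieldOn B m) : Prop := ∀ w, timeForm w (X w) ≠ 0

/-- `X` is a semispray of type 1 on `W_r`: its integral sections, defined on arbitrary open sets of
times, are holonomic. -/
def IsSemispray (X : VectorFieldOn B m) : Prop :=
  ∀ (γ : ℝ → RestrictedBundle B m) (I : Set ℝ), IsOpen I →
    (∀ t ∈ I, (γ t).time = t) → IsMIntegralCurveOn γ X I → ∀ t ∈ I, IsHolonomicAt γ t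

/-- The points of `W_r` at which `i(X) Ω_r = 0` has a transverse solution. -/
def compatibilitySet (L : Jet B (m + 1) → ℝ) : Set (RestrictedBundle B m) :=
  {w | ∃ u : TangentSpace 𝓘(ℝ, RestrictedModel n m) w,
    timeForm w u ≠ 0 ∧ ∀ v, unifiedTwoForm L w u v = 0}

end SkinnerRusk

end

open SkinnerRusk

/-! Throughout, `k = m + 1`. In natural coordinates the equation `i(u)Ω_r = 0` for a vector with
`dt(u) = 1` splits into two families (`forall_flatExteriorDerivative_eq_zero_iff`). The momentum
directions give `u(q_i) = q_{i+1}` for `i ≤ m`. A vertical jet direction `v` gives `u(p)(v₀, …, v_m)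
= dL̂(v) - p(v₁, …, v_{m+1})`. The time direction adds nothing, because `Ω_r` is skew and `dt(u) =
1`. The equations with `v₀ = … = v_m = 0` contain no unknown: they are conditions on the point, and
they cut out `W_1`. The other equations of the second family fix the momentum components of `u`.
Hence over `W_1` a holonomic vector is a solution as soon as its momentum components have the forced
values, and its component along `q_{2m+1}` remains free.

The assertions (2) and (3) agree because every tangent vector extends to a smooth vector field. To
pass from (3) to (4′), the free component is prescribed near a point of the curve as a function of
time alone, namely the one read off `ψ'`; elsewhere it is arbitrary. Being holonomic with `dt = 1`,
solving the equation on `W_1`, and agreeing with `ψ'` on the image of `ψ` are convex conditions on a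
vector, so a partition of unity glues the local fields (`exists_local_field`, `exists_semispray`). A
field of holonomic vectors is a semispray: along an integral curve each `q_{i+1}` is the derivative
of `q_i`.

For (1), the variations differ from `ψ` only over a bounded interval of times, and the derivative of
the functional is the integral of `-Ω_r(Z, ψ')` (`exists_hasDerivAt_functionalLH`). This gives (2) ⇒
(1). Conversely, `dt(ψ') = 1` and `Ω_r(ψ', ψ') = 0` reduce the claim to vertical vectors, and the
fundamental lemma of the calculus of variations applies (`not_pos_of_isVariationalSolution`). Its
test field has to come with a flow. Here it is a bump function times an infinitesimal rotation in a
chart, the bump being invariant under the rotation, so that the flow is explicit. -/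

namespace SkinnerRusk

/-! ### Exterior derivatives of 1-forms in arbitrary charts -/

section Forms

variable {H M P : Type*} [NormedAddCommGroup H] [NormedSpace ℝ H] [TopologicalSpace M]
  [ChartedSpace H M] [NormedAddCommGroup P] [NormedSpace ℝ P]

/-- The exterior derivative of a 1-form on a normed space. -/
noncomputable def flatExteriorDerivative (Θ : H → H →L[ℝ] ℝ) (x u v : H) : ℝ :=
  fderiv ℝ Θ x u v - fderiv ℝ Θ x v u

/-- The product rule produces a term with the second derivative of `y`; it is symmetric in `a` and
`b` and cancels on antisymmetrisation. -/
theorem flatExteriorDerivative_pullback {Θ : H → H →L[ℝ] ℝ} {y : P → H} {z : P}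
    (hΘ : DifferentiableAt ℝ Θ (y z)) (hy : ContDiffAt ℝ ∞ y z) (a b : P) :
    flatExteriorDerivative (fun z' => (Θ (y z')).comp (fderiv ℝ y z')) z a b =
      flatExteriorDerivative Θ (y z) (fderiv ℝ y z a) (fderiv ℝ y z b) := by
  have hy1 : DifferentiableAt ℝ y z := hy.differentiableAt (by simp)
  have hy2 : DifferentiableAt ℝ (fderiv ℝ y) z :=
    (hy.fderiv_right (m := ∞) (by simp)).differentiableAt (by simp)
  have hsymm : fderiv ℝ (fderiv ℝ y) z a b = fderiv ℝ (fderiv ℝ y) z b a :=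
    (hy.isSymmSndFDerivAt (by simpa using WithTop.coe_le_coe.2 (le_top : (2 : ℕ∞) ≤ ⊤))).eq a b
  have h1 := (hΘ.hasFDerivAt.comp z hy1.hasFDerivAt).clm_comp hy2.hasFDerivAt
  have h2 : ∀ a b, fderiv ℝ (fun z' => (Θ (y z')).comp (fderiv ℝ y z')) z a b =
      Θ (y z) (fderiv ℝ (fderiv ℝ y) z a b) +
        fderiv ℝ Θ (y z) (fderiv ℝ y z a) (fderiv ℝ y z b) := by
    intro a b
    have h3 := h1.fderiv
    simp only [Function.comp_def] at h3
    rw [h3]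
    simp
  simp only [flatExteriorDerivative, h2, hsymm]
  ring

/-- The pullback of a 1-form by a map. -/
noncomputable def pullbackForm (θ : (w : M) → TangentSpace 𝓘(ℝ, H) w →L[ℝ] ℝ) (Φ : P → M) (z : P) : P →L[ℝ] ℝ :=
  (show H →L[ℝ] ℝ from θ (Φ z)).comp
    (show P →L[ℝ] H from mfderiv 𝓘(ℝ, P) 𝓘(ℝ, H) Φ z)

/-- `Θ` is the coordinate expression of the 1-form `θ` in the chart `e`. -/
structure IsExpression (θ : (w : M) → TangentSpace 𝓘(ℝ, H) w →L[ℝ] ℝ)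
    (e : OpenPartialHomeomorph M H) (Θ : H → H →L[ℝ] ℝ) : Prop where
  mem_atlas : e ∈ atlas H M
  apply_eq : ∀ w ∈ e.source, ∀ u : TangentSpace 𝓘(ℝ, H) w,
    θ w u = Θ (e w) (mfderiv 𝓘(ℝ, H) 𝓘(ℝ, H) e w u)
  smooth : ContDiffOn ℝ ∞ Θ e.target

variable [IsManifold 𝓘(ℝ, H) ∞ M] {θ : (w : M) → TangentSpace 𝓘(ℝ, H) w →L[ℝ] ℝ}
  {e : OpenPartialHomeomorph M H} {Θ : H → H →L[ℝ] ℝ}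

theorem contMDiffAt_chart (he : e ∈ atlas H M) {w : M} (hw : w ∈ e.source) :
    ContMDiffAt 𝓘(ℝ, H) 𝓘(ℝ, H) ∞ e w :=
  contMDiffAt_of_mem_maximalAtlas (IsManifold.subset_maximalAtlas he) hw

theorem contMDiffAt_chart_symm (he : e ∈ atlas H M) {x : H} (hx : x ∈ e.target) :
    ContMDiffAt 𝓘(ℝ, H) 𝓘(ℝ, H) ∞ e.symm x :=
  contMDiffAt_symm_of_mem_maximalAtlas (IsManifold.subset_maximalAtlas he) hx

theorem contDiffAt_chart_comp_of_contMDiffAt (he : e ∈ atlas H M) {Φ : P → M} {z : P}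
    (hΦ : ContMDiffAt 𝓘(ℝ, P) 𝓘(ℝ, H) ∞ Φ z) (hz : Φ z ∈ e.source) :
    ContDiffAt ℝ ∞ (e ∘ Φ) z :=
  contMDiffAt_iff_contDiffAt.1 ((contMDiffAt_chart he hz).comp z hΦ)

theorem fderiv_chart_comp (he : e ∈ atlas H M) {Φ : P → M} {z : P}
    (hΦ : MDifferentiableAt 𝓘(ℝ, P) 𝓘(ℝ, H) Φ z) (hz : Φ z ∈ e.source) (a : P) :
    fderiv ℝ (e ∘ Φ) z a =
      mfderiv 𝓘(ℝ, H) 𝓘(ℝ, H) e (Φ z) (mfderiv 𝓘(ℝ, P) 𝓘(ℝ, H) Φ z a) := by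
  rw [← mfderiv_eq_fderiv,
    mfderiv_comp z ((contMDiffAt_chart he hz).mdifferentiableAt (by simp)) hΦ]
  rfl

/-- The tangent space at `w` is the model space as seen through the preferred chart at `w`, so at
that point a change of charts and the manifold derivative of `e` have the same matrix. -/
theorem fderiv_chart_comp_symm (he : e ∈ atlas H M) {w : M} (hw : w ∈ e.source)
    (a : TangentSpace 𝓘(ℝ, H) w) :
    fderiv ℝ (e ∘ (chartAt H w).symm) (chartAt H w w) a = mfderiv 𝓘(ℝ, H) 𝓘(ℝ, H) e w a := by
  have h1 := (((contMDiffAt_chart he hw).mdifferentiableAt (by simp)).hasMFDerivAt).2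
  have h2 : HasFDerivAt (e ∘ (chartAt H w).symm)
      (show H →L[ℝ] H from mfderiv 𝓘(ℝ, H) 𝓘(ℝ, H) e w) (chartAt H w w) := by
    have h2 := h1.hasFDerivAt (by simp)
    simpa [writtenInExtChartAt, Function.comp_def, chartAt_self_eq] using! h2
  exact congrArg (fun A : H →L[ℝ] H => A a) h2.fderiv

theorem IsExpression.pullbackForm_eventuallyEq (h : IsExpression θ e Θ) {Φ : P → M} {z : P}
    (hΦ : ContMDiffAt 𝓘(ℝ, P) 𝓘(ℝ, H) ∞ Φ z) (hz : Φ z ∈ e.source) :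
    pullbackForm θ Φ =ᶠ[𝓝 z] fun z' => (Θ ((e ∘ Φ) z')).comp (fderiv ℝ (e ∘ Φ) z') := by
  -- Being `C^∞` at a point does not spread to a neighbourhood, but being `C^1` does, and this is
  -- enough for the chain rule at nearby points.
  have h1 : ∀ᶠ z' in 𝓝 z, ContMDiffAt 𝓘(ℝ, P) 𝓘(ℝ, H) 1 Φ z' :=
    (contMDiffAt_iff_contMDiffAt_nhds (by simp)).1
      (hΦ.of_le (WithTop.coe_le_coe.2 (le_top : (1 : ℕ∞) ≤ ⊤)))
  filter_upwards [h1, hΦ.continuousAt.eventually (e.open_source.mem_nhds hz)] with z' h1 h2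
  ext a
  simp only [ContinuousLinearMap.comp_apply]
  rw [fderiv_chart_comp h.mem_atlas (h1.mdifferentiableAt (by simp)) h2]
  exact h.apply_eq _ h2 _

theorem IsExpression.contDiffAt_pullbackForm (h : IsExpression θ e Θ) {Φ : P → M} {z : P}
    (hΦ : ContMDiffAt 𝓘(ℝ, P) 𝓘(ℝ, H) ∞ Φ z) (hz : Φ z ∈ e.source) :
    ContDiffAt ℝ ∞ (pullbackForm θ Φ) z := by
  refine ContDiffAt.congr_of_eventuallyEq ?_ (h.pullbackForm_eventuallyEq hΦ hz)
  have hy := contDiffAt_chart_comp_of_contMDiffAt h.mem_atlas hΦ hz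
  have h1 : ContDiffAt ℝ ∞ Θ ((e ∘ Φ) z) :=
    h.smooth.contDiffAt (e.open_target.mem_nhds (e.map_source hz))
  exact (h1.comp z hy).clm_comp (hy.fderiv_right (by simp))

theorem flatExteriorDerivative_congr {A A' : P → P →L[ℝ] ℝ} {z : P} (h : A =ᶠ[𝓝 z] A') (a b : P) :
    flatExteriorDerivative A z a b = flatExteriorDerivative A' z a b := by
  simp only [flatExteriorDerivative, h.fderiv_eq]

theorem IsExpression.flatExteriorDerivative_pullbackForm (h : IsExpression θ e Θ) {Φ : P → M}
    {z : P} (hΦ : ContMDiffAt 𝓘(ℝ, P) 𝓘(ℝ, H) ∞ Φ z) (hz : Φ z ∈ e.source) (a b : P) :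
    flatExteriorDerivative (pullbackForm θ Φ) z a b =
      flatExteriorDerivative Θ (e (Φ z)) (fderiv ℝ (e ∘ Φ) z a) (fderiv ℝ (e ∘ Φ) z b) := by
  rw [flatExteriorDerivative_congr (h.pullbackForm_eventuallyEq hΦ hz)]
  refine flatExteriorDerivative_pullback (y := e ∘ Φ) ((h.smooth.contDiffAt
    (e.open_target.mem_nhds (e.map_source hz))).differentiableAt (by simp))
    (contDiffAt_chart_comp_of_contMDiffAt (Φ := Φ) h.mem_atlas hΦ hz) a b

/-- The exterior derivative can be computed in any chart. -/
theorem IsExpression.exteriorDerivative_eq (h : IsExpression θ e Θ) {w : M} (hw : w ∈ e.source)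
    (u v : TangentSpace 𝓘(ℝ, H) w) :
    exteriorDerivative θ w u v = flatExteriorDerivative Θ (e w)
      (mfderiv 𝓘(ℝ, H) 𝓘(ℝ, H) e w u) (mfderiv 𝓘(ℝ, H) 𝓘(ℝ, H) e w v) := by
  have hs := contMDiffAt_chart_symm (H := H) (chart_mem_atlas H w) (mem_chart_target H w)
  have hl : (chartAt H w).symm (chartAt H w w) = w := (chartAt H w).left_inv (mem_chart_source H w)
  have h1 := h.flatExteriorDerivative_pullbackForm hs (by rwa [hl]) u v
  rw [fderiv_chart_comp_symm h.mem_atlas hw, fderiv_chart_comp_symm h.mem_atlas hw, hl] at h1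
  -- By definition `exteriorDerivative` is the flat exterior derivative of the pullback by the
  -- inverse of the preferred chart.
  exact h1

theorem IsExpression.flatExteriorDerivative_pullbackForm_eq (h : IsExpression θ e Θ) {Φ : P → M}
    {z : P} (hΦ : ContMDiffAt 𝓘(ℝ, P) 𝓘(ℝ, H) ∞ Φ z) (hz : Φ z ∈ e.source) (a b : P) :
    flatExteriorDerivative (pullbackForm θ Φ) z a b =
      exteriorDerivative θ (Φ z) (mfderiv 𝓘(ℝ, P) 𝓘(ℝ, H) Φ z a)
        (mfderiv 𝓘(ℝ, P) 𝓘(ℝ, H) Φ z b) := by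
  have hd : MDifferentiableAt 𝓘(ℝ, P) 𝓘(ℝ, H) Φ z := hΦ.mdifferentiableAt (by simp)
  rw [h.flatExteriorDerivative_pullbackForm hΦ hz, h.exteriorDerivative_eq hz,
    fderiv_chart_comp h.mem_atlas hd hz, fderiv_chart_comp h.mem_atlas hd hz]

end Forms

end SkinnerRusk

namespace SkinnerRusk

/-! ### Vector fields in charts and smoothness of integral curves -/

section Fields

variable {H M : Type*} [NormedAddCommGroup H] [NormedSpace ℝ H] [TopologicalSpace M]
  [ChartedSpace H M] [IsManifold 𝓘(ℝ, H) ∞ M] {e : OpenPartialHomeomorph M H}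

/-- The vector field with coordinate expression `F` in the chart `e`. -/
noncomputable def chartField (e : OpenPartialHomeomorph M H) (F : H → H) (w : M) :
    TangentSpace 𝓘(ℝ, H) w :=
  VectorField.mpullback 𝓘(ℝ, H) 𝓘(ℝ, H) e (fun x => (F x : TangentSpace 𝓘(ℝ, H) x)) w

theorem chart_mdifferentiable (he : e ∈ atlas H M) : e.MDifferentiable 𝓘(ℝ, H) 𝓘(ℝ, H) :=
  have : IsManifold 𝓘(ℝ, H) 1 M := .of_le (n := ∞) (WithTop.coe_le_coe.2 le_top)
  mdifferentiable_of_mem_atlas he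

theorem isInvertible_mfderiv_chart (he : e ∈ atlas H M) {w : M} (hw : w ∈ e.source) :
    (mfderiv 𝓘(ℝ, H) 𝓘(ℝ, H) e w).IsInvertible :=
  ⟨(chart_mdifferentiable he).mfderiv hw, rfl⟩

theorem isInvertible_mfderiv_chart_symm (he : e ∈ atlas H M) {x : H} (hx : x ∈ e.target) :
    (mfderiv 𝓘(ℝ, H) 𝓘(ℝ, H) e.symm x).IsInvertible :=
  ⟨(chart_mdifferentiable he).symm.mfderiv hx, rfl⟩

theorem mfderiv_chartField (he : e ∈ atlas H M) (F : H → H) {w : M} (hw : w ∈ e.source) :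
    mfderiv 𝓘(ℝ, H) 𝓘(ℝ, H) e w (chartField e F w) = F (e w) :=
  (isInvertible_mfderiv_chart he hw).self_apply_inverse _

theorem eq_chartField (he : e ∈ atlas H M) (F : H → H) {w : M} (hw : w ∈ e.source)
    {u : TangentSpace 𝓘(ℝ, H) w} (hu : mfderiv 𝓘(ℝ, H) 𝓘(ℝ, H) e w u = F (e w)) :
    u = chartField e F w :=
  (isInvertible_mfderiv_chart he hw).injective (hu.trans (mfderiv_chartField he F hw).symm)

theorem contMDiffAt_chartField [CompleteSpace H] (he : e ∈ atlas H M) {F : H → H} {w : M}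
    (hw : w ∈ e.source) (hF : ContDiffAt ℝ ∞ F (e w)) :
    ContMDiffAt 𝓘(ℝ, H) 𝓘(ℝ, H).tangent ∞
      (fun w => (⟨w, chartField e F w⟩ : TangentBundle 𝓘(ℝ, H) M)) w :=
  have : IsManifold 𝓘(ℝ, H) 1 M := .of_le (n := ∞) (WithTop.coe_le_coe.2 le_top)
  ContMDiffAt.mpullback_vectorField_preimage (n := ∞) (contMDiffAt_vectorSpace_iff_contDiffAt.2 hF)
    (contMDiffAt_chart he hw) (isInvertible_mfderiv_chart he hw) (by simp)

/-- The coordinate expression of a vector field in the chart `e`. -/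
noncomputable def fieldExpression (e : OpenPartialHomeomorph M H)
    (X : (w : M) → TangentSpace 𝓘(ℝ, H) w) (x : H) : H :=
  VectorField.mpullback 𝓘(ℝ, H) 𝓘(ℝ, H) e.symm X x

theorem contDiffAt_fieldExpression [CompleteSpace H] (he : e ∈ atlas H M)
    {X : (w : M) → TangentSpace 𝓘(ℝ, H) w} {x : H} (hx : x ∈ e.target)
    (hX : ContMDiffAt 𝓘(ℝ, H) 𝓘(ℝ, H).tangent ∞
      (fun w => (⟨w, X w⟩ : TangentBundle 𝓘(ℝ, H) M)) (e.symm x)) :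
    ContDiffAt ℝ ∞ (fieldExpression e X) x :=
  have : IsManifold 𝓘(ℝ, H) 1 M := .of_le (n := ∞) (WithTop.coe_le_coe.2 le_top)
  contMDiffAt_vectorSpace_iff_contDiffAt.1 <|
    ContMDiffAt.mpullback_vectorField_preimage (n := ∞) hX
    (contMDiffAt_chart_symm he hx) (isInvertible_mfderiv_chart_symm he hx) (by simp)

theorem fieldExpression_apply (he : e ∈ atlas H M) (X : (w : M) → TangentSpace 𝓘(ℝ, H) w)
    {w : M} (hw : w ∈ e.source) :
    fieldExpression e X (e w) = mfderiv 𝓘(ℝ, H) 𝓘(ℝ, H) e w (X w) := by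
  have h1 := (chart_mdifferentiable he).symm_comp_deriv hw
  have h2 := (chart_mdifferentiable he).comp_symm_deriv (e.map_source hw)
  rw [fieldExpression, VectorField.mpullback_apply]
  rw [e.left_inv hw] at h2 ⊢
  rw [ContinuousLinearMap.inverse_eq h1 h2]

theorem hasDerivAt_chart_comp (he : e ∈ atlas H M) {γ : ℝ → M} {t : ℝ}
    {u : TangentSpace 𝓘(ℝ, H) (γ t)}
    (hγ : HasMFDerivAt 𝓘(ℝ, ℝ) 𝓘(ℝ, H) γ t ((1 : ℝ →L[ℝ] ℝ).smulRight u))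
    (hw : γ t ∈ e.source) :
    HasDerivAt (e ∘ γ) (mfderiv 𝓘(ℝ, H) 𝓘(ℝ, H) e (γ t) u) t := by
  have h1 := ((chart_mdifferentiable he).mdifferentiableAt hw).hasMFDerivAt.comp t hγ
  have h2 := hasMFDerivAt_iff_hasFDerivAt.1 h1
  refine hasDerivAt_iff_hasFDerivAt.2 (h2.congr_fderiv ?_)
  ext
  change (mfderiv 𝓘(ℝ, H) 𝓘(ℝ, H) e (γ t)) ((1 : ℝ) • u) = (1 : ℝ) • _
  rw [one_smul, one_smul]

theorem hasMFDerivAt_of_hasDerivAt_chart_comp (he : e ∈ atlas H M) {γ : ℝ → M} {t : ℝ}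
    {u : TangentSpace 𝓘(ℝ, H) (γ t)} (hc : ContinuousAt γ t) (hw : γ t ∈ e.source)
    (hγ : HasDerivAt (e ∘ γ) (mfderiv 𝓘(ℝ, H) 𝓘(ℝ, H) e (γ t) u) t) :
    HasMFDerivAt 𝓘(ℝ, ℝ) 𝓘(ℝ, H) γ t ((1 : ℝ →L[ℝ] ℝ).smulRight u) := by
  have h1 := hasMFDerivAt_iff_hasFDerivAt.2 hγ.hasFDerivAt
  have h2 := (chart_mdifferentiable he).mdifferentiableAt_symm (e.map_source hw)
  have h3 := HasMFDerivAt.comp t h2.hasMFDerivAt h1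
  have h4 : e.symm ∘ (e ∘ γ) =ᶠ[𝓝 t] γ := by
    filter_upwards [hc.eventually (e.open_source.mem_nhds hw)] with s hs
    exact e.left_inv hs
  have h5 := h3.congr_of_eventuallyEq h4.symm
  refine h5.congr_mfderiv ?_
  refine ContinuousLinearMap.ext_ring ?_
  have h6 := congrArg (fun A : H →L[ℝ] H => A u) ((chart_mdifferentiable he).symm_comp_deriv hw)
  change (mfderiv 𝓘(ℝ, H) 𝓘(ℝ, H) e.symm (e (γ t)) : H →L[ℝ] H)
    ((1 : ℝ) • (mfderiv 𝓘(ℝ, H) 𝓘(ℝ, H) e (γ t) : H →L[ℝ] H) u) = (1 : ℝ) • (u : H)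
  rw [one_smul, one_smul]
  exact h6

/-- Bootstrap: if `y` is `C^k`, then so is `y' = F ∘ y`, hence `y` is `C^{k+1}`. -/
theorem contDiffOn_of_hasDerivAt {y : ℝ → H} {F : H → H} {J : Set ℝ} {U : Set H} (hJ : IsOpen J)
    (hF : ContDiffOn ℝ ∞ F U) (hyU : ∀ t ∈ J, y t ∈ U) (hy : ∀ t ∈ J, HasDerivAt y (F (y t)) t) :
    ContDiffOn ℝ ∞ y J := by
  refine contDiffOn_infty.2 fun k => ?_
  induction k with
  | zero => exact contDiffOn_zero.2 fun t ht => (hy t ht).continuousAt.continuousWithinAt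
  | succ k ih =>
    rw [Nat.cast_succ]
    refine (contDiffOn_succ_iff_deriv_of_isOpen hJ).2
      ⟨fun t ht => (hy t ht).differentiableAt.differentiableWithinAt,
        fun h => absurd h (WithTop.natCast_ne_top k), ?_⟩
    refine ((hF.of_le (by exact_mod_cast le_top)).comp ih hyU).congr fun t ht => ?_
    exact (hy t ht).deriv

/-- Integral curves of a smooth vector field are smooth. -/
theorem contMDiffAt_of_isMIntegralCurveAt [CompleteSpace H]
    {X : (w : M) → TangentSpace 𝓘(ℝ, H) w} {γ : ℝ → M} {t : ℝ}
    (hX : ContMDiff 𝓘(ℝ, H) 𝓘(ℝ, H).tangent ∞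
      (fun w => (⟨w, X w⟩ : TangentBundle 𝓘(ℝ, H) M)))
    (hγ : IsMIntegralCurveAt γ X t) : ContMDiffAt 𝓘(ℝ, ℝ) 𝓘(ℝ, H) ∞ γ t := by
  set e := chartAt H (γ t)
  have he : e ∈ atlas H M := chart_mem_atlas H _
  have hc := hγ.continuousAt
  have hev : ∀ᶠ s in 𝓝 t, γ s ∈ e.source :=
    hc.eventually (e.open_source.mem_nhds (mem_chart_source H _))
  obtain ⟨J, hJ, hJo, htJ⟩ := eventually_nhds_iff.1 (hev.and hγ)
  have h1 : ContDiffOn ℝ ∞ (e ∘ γ) J := by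
    refine contDiffOn_of_hasDerivAt (F := fieldExpression e X) (U := e.target) hJo ?_
      (fun s hs => e.map_source (hJ s hs).1) fun s hs => ?_
    · exact fun x hx => (contDiffAt_fieldExpression he hx hX.contMDiffAt).contDiffWithinAt
    · have := hasDerivAt_chart_comp he (hJ s hs).2 (hJ s hs).1
      rwa [← fieldExpression_apply he X (hJ s hs).1] at this
  have h2 := (contMDiffAt_chart_symm he (e.map_source (hJ t htJ).1)).comp t
    (h1.contDiffAt (hJo.mem_nhds htJ)).contMDiffAt
  refine h2.congr_of_eventuallyEq ?_
  filter_upwards [hev] with s hs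
  exact (e.left_inv hs).symm

end Fields

end SkinnerRusk

/-! ### Natural charts and topology of `J^k π` and `W_r` -/

namespace SkinnerRusk

variable {n : ℕ} {B : ConfigurationBundle.{u, v} n}

namespace Jet

variable {k r : ℕ}

/-- The natural chart of `J^k π` induced by an adapted chart of `E`. -/
noncomputable def chart (y₀ : Jet B k) (c : AdaptedChart B) :
    OpenPartialHomeomorph (Jet B k) (JetModel n k) :=
  (core B k).openPartialHomeomorph (chartEquiv y₀ c) ⟨y₀, c, rfl⟩

theorem chart_mem_atlas (y₀ : Jet B k) (c : AdaptedChart B) :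
    chart y₀ c ∈ atlas (JetModel n k) (Jet B k) :=
  mem_iUnion₂.2 ⟨chartEquiv y₀ c, ⟨y₀, c, rfl⟩, rfl⟩

theorem mem_chart_source {y₀ : Jet B k} {c : AdaptedChart B} {y : Jet B k} :
    y ∈ (chart y₀ c).source ↔ y.base ∈ c.chart.source := Iff.rfl

theorem coe_chart (y₀ : Jet B k) (c : AdaptedChart B) : ⇑(chart y₀ c) = coord c := rfl

theorem contMDiffAt_coord {c : AdaptedChart B} {y : Jet B k} (hy : y.base ∈ c.chart.source) :
    ContMDiffAt 𝓘(ℝ, JetModel n k) 𝓘(ℝ, JetModel n k) ∞ (coord c) y :=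
  contMDiffAt_chart (chart_mem_atlas y c) hy

theorem contDiff_restrictModel (h : r ≤ k) : ContDiff ℝ ∞ (restrictModel (n := n) h) := by
  unfold restrictModel
  fun_prop

theorem eventually_base_mem {c : AdaptedChart B} {y : Jet B k} (hy : y.base ∈ c.chart.source) :
    ∀ᶠ y' : Jet B k in 𝓝 y, y'.base ∈ c.chart.source :=
  (chart y c).open_source.mem_nhds (mem_chart_source.2 hy)

theorem contMDiff_proj (h : r ≤ k) :
    ContMDiff 𝓘(ℝ, JetModel n k) 𝓘(ℝ, JetModel n r) ∞ (proj h : Jet B k → Jet B r) := by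
  intro y
  obtain ⟨c, hc⟩ := exists_adaptedChart y.base
  have hc' : (proj h y).base ∈ c.chart.source := by rwa [proj_base]
  have hx : restrictModel h (coord c y) ∈ (chart (proj h y) c).target := by
    rw [← coord_proj h c hc]
    exact (chart (proj h y) c).map_source hc'
  have h1 := (contMDiffAt_chart_symm (chart_mem_atlas (proj h y) c) hx).comp y
    ((contDiff_restrictModel h).contMDiff.contMDiffAt.comp y (contMDiffAt_coord hc))
  refine h1.congr_of_eventuallyEq ?_
  filter_upwards [eventually_base_mem hc] with y' hy'
  have h2 : (proj h y').base ∈ c.chart.source := by rwa [proj_base]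
  change proj h y' = (chart (proj h y) c).symm (restrictModel h (coord c y'))
  rw [← coord_proj h c hy']
  exact ((chart (proj h y) c).left_inv h2).symm

theorem contMDiff_base : ContMDiff 𝓘(ℝ, JetModel n k) (𝓡 (n + 1)) ∞ (base : Jet B k → B.E) := by
  intro y
  obtain ⟨c, hc⟩ := exists_adaptedChart y.base
  let f : JetModel n k → ℝ × EuclideanSpace ℝ (Fin n) := fun x => (x.1, x.2 0)
  have hf : ContDiff ℝ ∞ f := by fun_prop
  have h1 : ContMDiffAt 𝓘(ℝ, ℝ × EuclideanSpace ℝ (Fin n)) (𝓡 (n + 1)) ∞ c.chart.symm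
      (f (coord c y)) :=
    (c.smooth_symm _ (coord_mem_target c hc)).contMDiffAt
      (c.chart.open_target.mem_nhds (coord_mem_target c hc))
  refine (h1.comp y (hf.contMDiff.contMDiffAt.comp y
    (contMDiffAt_coord hc))).congr_of_eventuallyEq ?_
  filter_upwards [eventually_base_mem hc] with y' hy'
  change y'.base = c.chart.symm ((coord c y').1, (coord c y').2 0)
  rw [coord_fst_snd_zero c hy', c.chart.left_inv hy']

theorem exists_base_eq (p : B.E) : ∃ y : Jet B k, y.base = p := by
  let c := adaptedChartAt p
  have hc : p ∈ c.chart.source := mem_adaptedChartAt_source p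
  have hx : ((c.chart p).1, (fun _ : Fin (k + 1) => (c.chart p).2) 0) ∈ c.chart.target :=
    c.chart.map_source hc
  -- Only the zeroth derivative coordinate matters for the base point; the higher ones are filled in
  -- arbitrarily.
  refine ⟨ofCoord (mk k _ _ (isSectionNear_taylorSection (k := k) c
    ((c.chart p).1, fun _ => (c.chart p).2) hx)) c ((c.chart p).1, fun _ => (c.chart p).2), ?_⟩
  rw [base_ofCoord _ _ hx]
  exact c.chart.left_inv hc

end Jet

namespace RestrictedBundle

variable {m : ℕ}

/-- The natural chart of `W_r` induced by an adapted chart of `E`. -/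
noncomputable def chart (w₀ : RestrictedBundle B m) (c : AdaptedChart B) :
    OpenPartialHomeomorph (RestrictedBundle B m) (RestrictedModel n m) :=
  (core B m).openPartialHomeomorph (chartEquiv w₀ c) ⟨w₀, c, rfl⟩

theorem chart_mem_atlas (w₀ : RestrictedBundle B m) (c : AdaptedChart B) :
    chart w₀ c ∈ atlas (RestrictedModel n m) (RestrictedBundle B m) :=
  mem_iUnion₂.2 ⟨chartEquiv w₀ c, ⟨w₀, c, rfl⟩, rfl⟩

theorem mem_chart_source {w₀ : RestrictedBundle B m} {c : AdaptedChart B}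
    {w : RestrictedBundle B m} : w ∈ (chart w₀ c).source ↔ w.jet.base ∈ c.chart.source := Iff.rfl

theorem contMDiffAt_coord {c : AdaptedChart B} {w : RestrictedBundle B m}
    (hw : w.jet.base ∈ c.chart.source) :
    ContMDiffAt 𝓘(ℝ, RestrictedModel n m) 𝓘(ℝ, RestrictedModel n m) ∞ (coord c) w :=
  contMDiffAt_chart (chart_mem_atlas w c) hw

theorem mdifferentiableAt_coord {c : AdaptedChart B} {w : RestrictedBundle B m}
    (hw : w.jet.base ∈ c.chart.source) :
    MDifferentiableAt 𝓘(ℝ, RestrictedModel n m) 𝓘(ℝ, RestrictedModel n m) (coord c) w :=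
  (contMDiffAt_coord hw).mdifferentiableAt (by simp)

theorem eventually_base_mem {c : AdaptedChart B} {w : RestrictedBundle B m}
    (hw : w.jet.base ∈ c.chart.source) :
    ∀ᶠ w' : RestrictedBundle B m in 𝓝 w, w'.jet.base ∈ c.chart.source :=
  (chart w c).open_source.mem_nhds (mem_chart_source.2 hw)

theorem contMDiff_jet : ContMDiff 𝓘(ℝ, RestrictedModel n m) 𝓘(ℝ, JetModel n (2 * m + 1)) ∞
    (jet : RestrictedBundle B m → Jet B (2 * m + 1)) := by
  intro w
  obtain ⟨c, hc⟩ := exists_adaptedChart w.jet.base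
  have hx : (coord c w).1 ∈ (Jet.chart w.jet c).target := (Jet.chart w.jet c).map_source hc
  have h1 := (contMDiffAt_chart_symm (Jet.chart_mem_atlas w.jet c) hx).comp w
    (contDiff_fst.contMDiff.contMDiffAt.comp w (contMDiffAt_coord hc))
  refine h1.congr_of_eventuallyEq ?_
  filter_upwards [eventually_base_mem hc] with w' hw'
  exact ((Jet.chart w.jet c).left_inv hw').symm

theorem contMDiff_time : ContMDiff 𝓘(ℝ, RestrictedModel n m) 𝓘(ℝ, ℝ) ∞
    (time : RestrictedBundle B m → ℝ) :=
  Jet.contMDiff_time.comp contMDiff_jet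

theorem contMDiff_base : ContMDiff 𝓘(ℝ, RestrictedModel n m) (𝓡 (n + 1)) ∞
    fun w : RestrictedBundle B m => w.jet.base :=
  Jet.contMDiff_base.comp contMDiff_jet

theorem exists_base_eq (p : B.E) : ∃ w : RestrictedBundle B m, w.jet.base = p :=
  let ⟨y, hy⟩ := Jet.exists_base_eq p
  ⟨⟨y, 0⟩, hy⟩

/-- Points over distinct points of `E` are separated by open sets pulled back from `E`, and points
over the same point lie in a common natural chart. Uniqueness of integral curves, partitions of
unity and extension by zero off a compact set all rest on this. -/
instance : T2Space (RestrictedBundle B m) := by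
  refine t2Space_iff_disjoint_nhds.2 fun w w' hne => ?_
  by_cases hb : w.jet.base = w'.jet.base
  · obtain ⟨c, hc⟩ := exists_adaptedChart w.jet.base
    have hw : w ∈ (chart w c).source := hc
    have hw' : w' ∈ (chart w c).source := by
      rw [mem_chart_source, ← hb]; exact hc
    have hne' : chart w c w ≠ chart w c w' := fun h => hne ((chart w c).injOn hw hw' h)
    exact (Filter.disjoint_comap (m := chart w c) (disjoint_nhds_nhds.2 hne')).mono
      ((chart w c).continuousAt hw).le_comap ((chart w c).continuousAt hw').le_comap
  · exact (Filter.disjoint_comap (m := fun w : RestrictedBundle B m => w.jet.base)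
      (disjoint_nhds_nhds.2 hb)).mono
      contMDiff_base.continuous.continuousAt.le_comap contMDiff_base.continuous.continuousAt.le_comap

/-- Countably many adapted charts cover `E`, and the domain of a natural chart is the full preimage
of the domain of its adapted chart. -/
instance : SecondCountableTopology (RestrictedBundle B m) := by
  obtain ⟨s, hs, hsU⟩ := TopologicalSpace.countable_cover_nhds (α := B.E)
    (f := fun p => (adaptedChartAt p).chart.source) fun p =>
    (adaptedChartAt p).chart.open_source.mem_nhds (mem_adaptedChartAt_source p)
  choose f hf using exists_base_eq (B := B) (m := m)
  refine ChartedSpace.secondCountable_of_countable_cover (RestrictedModel n m) (s := f '' s) ?_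
    (hs.image f)
  refine eq_univ_of_forall fun w => ?_
  have hw : w.jet.base ∈ ⋃ p ∈ s, (adaptedChartAt p).chart.source := hsU ▸ mem_univ _
  obtain ⟨p, hp, hwp⟩ := mem_iUnion₂.1 hw
  refine mem_iUnion₂.2 ⟨f p, mem_image_of_mem f hp, ?_⟩
  change w.jet.base ∈ (adaptedChartAt (f p).jet.base).chart.source
  rwa [hf]

instance : LocallyCompactSpace (RestrictedBundle B m) :=
  Manifold.locallyCompact_of_finiteDimensional 𝓘(ℝ, RestrictedModel n m)

end RestrictedBundle

end SkinnerRusk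

/-! ### Coordinate expression of `Θ_r` -/

namespace SkinnerRusk

variable {n : ℕ} {B : ConfigurationBundle.{u, v} n}

namespace Jet

variable {k r : ℕ}

/-- The derivative at `q` of the natural coordinates induced by `c`. -/
noncomputable def coordDeriv (c : AdaptedChart B) (q : Jet B k) :
    JetModel n k →L[ℝ] JetModel n k :=
  mfderiv 𝓘(ℝ, JetModel n k) 𝓘(ℝ, JetModel n k) (coord c) q

/-- Momentum coordinates were defined through Jacobians from the preferred adapted chart; this
translates them into the language of manifold derivatives. -/
theorem jacobian_eq_mfderiv {c : AdaptedChart B} {q : Jet B k} (hc : q.base ∈ c.chart.source)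
    (u : TangentSpace 𝓘(ℝ, JetModel n k) q) :
    jacobian (adaptedChartAt q.base) c q u = coordDeriv c q u := by
  have hq := mem_adaptedChartAt_source q.base
  rw [jacobian]
  refine Eq.trans (congrArg (fun A : JetModel n k →L[ℝ] JetModel n k => A u)
    (Filter.EventuallyEq.fderiv_eq ?_)) (fderiv_chart_comp_symm (chart_mem_atlas q c) hc u)
  filter_upwards [(isOpen_overlap (k := k) (adaptedChartAt q.base) c).mem_nhds
    (coord_mem_overlap hq hc)] with x hx
  exact (coord_ofCoord_eq_transition q hx).symm

theorem coordDeriv_injective {c : AdaptedChart B} {q : Jet B k} (hc : q.base ∈ c.chart.source) :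
    Function.Injective (coordDeriv c q) :=
  (isInvertible_mfderiv_chart (chart_mem_atlas q c) hc).injective

theorem mdifferentiableAt_coord {c : AdaptedChart B} {y : Jet B k} (hy : y.base ∈ c.chart.source) :
    MDifferentiableAt 𝓘(ℝ, JetModel n k) 𝓘(ℝ, JetModel n k) (coord c) y :=
  (contMDiffAt_coord hy).mdifferentiableAt (by simp)

/-- Unlike the computation in the preferred chart, this one is available in every adapted chart
around `φ t`. -/
theorem hasDerivAt_coord_prolongation (y₀ : Jet B k) {φ : ℝ → B.E} {t : ℝ}
    (h : IsSectionNear B φ t) {c : AdaptedChart B} (hc : φ t ∈ c.chart.source) :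
    HasDerivAt (fun s => coord c (prolongation y₀ φ s))
      ((1 : ℝ), fun i : Fin (k + 1) => (iteratedDeriv ((i : ℕ) + 1) (c.chart ∘ φ) t).2) t := by
  have hev : (fun s => coord c (prolongation y₀ φ s)) =ᶠ[𝓝 t]
      fun s => (s, fun i : Fin (k + 1) => (iteratedDeriv (i : ℕ) (c.chart ∘ φ) s).2) := by
    filter_upwards [Filter.Eventually.eventually_nhds h, eventually_mem_source h c hc]
      with s hs hs'
    have hs : IsSectionNear B φ s := hs
    rw [prolongation, dif_pos hs, coord_mk c hs hs']
  refine HasDerivAt.congr_of_eventuallyEq ?_ hev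
  refine (hasDerivAt_id t).prodMk (hasDerivAt_pi.2 fun i => ?_)
  have h1 : DifferentiableAt ℝ (iteratedDeriv (i : ℕ) (c.chart ∘ φ)) t := by
    have := (contDiffAt_chart_comp h c hc).contDiffWithinAt.differentiableWithinAt_iteratedDerivWithin
      (s := univ) (m := (i : ℕ)) (by exact_mod_cast WithTop.coe_lt_top _) (by simp)
    rwa [iteratedDerivWithin_univ, differentiableWithinAt_univ] at this
  rw [iteratedDeriv_succ]
  exact h1.hasDerivAt.snd

theorem coordDeriv_prolongation (y₀ : Jet B k) {φ : ℝ → B.E} {t : ℝ}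
    (h : IsSectionNear B φ t) {c : AdaptedChart B} (hc : φ t ∈ c.chart.source) :
    coordDeriv c (mk k φ t h) (show JetModel n k from
      mfderiv 𝓘(ℝ, ℝ) 𝓘(ℝ, JetModel n k) (prolongation y₀ φ) t (1 : ℝ)) =
      ((1 : ℝ), fun i : Fin (k + 1) => (iteratedDeriv ((i : ℕ) + 1) (c.chart ∘ φ) t).2) := by
  have ht : prolongation y₀ φ t = mk k φ t h := by rw [prolongation, dif_pos h]
  have hb : (prolongation y₀ φ t).base ∈ c.chart.source := by rw [ht]; exact hc
  let A : ℝ →L[ℝ] JetModel n k := mfderiv 𝓘(ℝ, ℝ) 𝓘(ℝ, JetModel n k) (prolongation y₀ φ) t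
  have h1 : HasFDerivAt (fun s => coord c (prolongation y₀ φ s))
      ((coordDeriv c (prolongation y₀ φ t)).comp A) t :=
    hasMFDerivAt_iff_hasFDerivAt.1 ((mdifferentiableAt_coord hb).hasMFDerivAt.comp t
      (hasMFDerivAt_prolongation y₀ h).mdifferentiableAt.hasMFDerivAt)
  rw [ht] at h1
  have h3 := congrArg (fun A : ℝ →L[ℝ] JetModel n k => A 1)
    (h1.unique (hasDerivAt_coord_prolongation y₀ h hc).hasFDerivAt)
  exact h3.trans (one_smul ℝ _)

/-- The projection `(v₀, …, v_k) ↦ (v₀, …, v_r)`. -/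
noncomputable def lower (n : ℕ) (h : r ≤ k) : (Fin (k + 1) → EuclideanSpace ℝ (Fin n)) →L[ℝ]
    (Fin (r + 1) → EuclideanSpace ℝ (Fin n)) :=
  ContinuousLinearMap.pi fun i => ContinuousLinearMap.proj (Fin.castLE (Nat.succ_le_succ h) i)

/-- The shift `(v₀, …, v_k) ↦ (v₁, …, v_{r+1})`. -/
noncomputable def shift (n : ℕ) (h : r + 1 ≤ k) : (Fin (k + 1) → EuclideanSpace ℝ (Fin n)) →L[ℝ]
    (Fin (r + 1) → EuclideanSpace ℝ (Fin n)) :=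
  ContinuousLinearMap.pi fun i => ContinuousLinearMap.proj
    (Fin.castLE (Nat.succ_le_succ h) i.succ)

/-- The covector `α` at `q` in the natural chart induced by `c`. -/
theorem covector_apply {c : AdaptedChart B} {q : Jet B k} (hc : q.base ∈ c.chart.source)
    (α : Covector q) (u : TangentSpace 𝓘(ℝ, JetModel n k) q) :
    α u = (coordDeriv c q u).1 *
        (show JetModel n k →L[ℝ] ℝ from α) (jacobian c (adaptedChartAt q.base) q ((1 : ℝ), 0)) +
      covectorCoord c q α (coordDeriv c q u).2 := by
  rw [← jacobian_eq_mfderiv hc u]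
  have hq := mem_adaptedChartAt_source q.base
  set α' : JetModel n k →L[ℝ] ℝ := α
  set D := jacobian c (adaptedChartAt q.base) q
  set D' := jacobian (adaptedChartAt q.base) c q
  set z : JetModel n k := D' u
  have hDD : D z = u :=
    congrArg (fun A : JetModel n k →L[ℝ] JetModel n k => A u)
      ((jacobian_comp hq hc hq).trans (jacobian_self hq))
  have h3 : z = z.1 • ((1 : ℝ), (0 : Fin (k + 1) → EuclideanSpace ℝ (Fin n))) + (0, z.2) := by
    refine Prod.ext ?_ ?_ <;> simp
  have h4 : α' (D z) = z.1 * α' (D ((1 : ℝ), 0)) + α' (D (0, z.2)) := by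
    conv_lhs => rw [h3]
    rw [map_add, map_smul, map_add, map_smul, smul_eq_mul]
  exact (congrArg α' hDD.symm).trans h4

/-- The total derivative is `∂_t + q_{i+1} ∂_{q_i}` in every adapted chart; since `m + 1 ≤ 2m + 1`,
the jet `y` knows all the `q_{i+1}` required. -/
theorem coordDeriv_totalVector {m : ℕ} {c : AdaptedChart B} {y : Jet B (2 * m + 1)}
    (hc : y.base ∈ c.chart.source) :
    coordDeriv c (proj (by omega : m ≤ 2 * m + 1) y) (totalVector y) =
      ((1 : ℝ), shift n (by omega : m + 1 ≤ 2 * m + 1) (coord c y).2) := by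
  obtain ⟨φ, t, h, rfl⟩ := exists_rep y
  have h1 := totalVector_mk (mk m φ t h) h
  have h2 := coordDeriv_prolongation (mk m φ t h) h (c := c) hc
  rw [coord_mk c h hc]
  exact (congrArg (coordDeriv c (mk m φ t h)) h1).trans h2

end Jet

namespace RestrictedBundle

variable {m r : ℕ}

/-- The derivative at `w` of the natural coordinates induced by `c`. -/
noncomputable def coordDeriv (c : AdaptedChart B) (w : RestrictedBundle B m) :
    RestrictedModel n m →L[ℝ] RestrictedModel n m :=
  mfderiv 𝓘(ℝ, RestrictedModel n m) 𝓘(ℝ, RestrictedModel n m) (coord c) w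

theorem coordDeriv_proj (h : r ≤ 2 * m + 1) {c : AdaptedChart B} {w : RestrictedBundle B m}
    (hc : w.jet.base ∈ c.chart.source) (u : TangentSpace 𝓘(ℝ, RestrictedModel n m) w) :
    Jet.coordDeriv c (Jet.proj h w.jet) (show JetModel n r from
      mfderiv 𝓘(ℝ, RestrictedModel n m) 𝓘(ℝ, JetModel n r)
        (fun w : RestrictedBundle B m => Jet.proj h w.jet) w u) =
    ((coordDeriv c w u).1.1, Jet.lower n h (coordDeriv c w u).1.2) := by
  let R : RestrictedModel n m →L[ℝ] JetModel n r :=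
    ((ContinuousLinearMap.fst ℝ _ _).prod
      ((Jet.lower n h).comp (ContinuousLinearMap.snd ℝ _ _))).comp (ContinuousLinearMap.fst ℝ _ _)
  have hb : (Jet.proj h w.jet).base ∈ c.chart.source := by rwa [Jet.proj_base]
  have h1 := (Jet.mdifferentiableAt_coord hb).hasMFDerivAt.comp w
    (((Jet.contMDiff_proj (B := B) h).comp contMDiff_jet).contMDiffAt.mdifferentiableAt
      (by simp)).hasMFDerivAt
  have h2 := (R.hasMFDerivAt (x := coord c w)).comp w (mdifferentiableAt_coord hc).hasMFDerivAt
  have h3 : Jet.coord c ∘ (fun w : RestrictedBundle B m => Jet.proj h w.jet) =ᶠ[𝓝 w]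
      R ∘ coord c := by
    filter_upwards [eventually_base_mem hc] with w' hw'
    exact Jet.coord_proj h c hw'
  exact congrArg (fun A : RestrictedModel n m →L[ℝ] JetModel n r => A u)
    (hasMFDerivAt_unique h1 (h2.congr_of_eventuallyEq h3))

theorem timeForm_apply {c : AdaptedChart B} {w : RestrictedBundle B m}
    (hc : w.jet.base ∈ c.chart.source) (u : TangentSpace 𝓘(ℝ, RestrictedModel n m) w) :
    timeForm w u = (coordDeriv c w u).1.1 := by
  let R : RestrictedModel n m →L[ℝ] ℝ :=
    (ContinuousLinearMap.fst ℝ _ _).comp (ContinuousLinearMap.fst ℝ _ _)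
  have h2 := (R.hasMFDerivAt (x := coord c w)).comp w (mdifferentiableAt_coord hc).hasMFDerivAt
  exact congrArg (fun A : RestrictedModel n m →L[ℝ] ℝ => A u) h2.mfderiv

end RestrictedBundle

section OneForm

variable {m : ℕ}

/-- The form `p^i dq_i + (ℓ - p^i q_{i+1}) dt` in natural coordinates. -/
noncomputable def coordOneForm (ℓ : JetModel n (2 * m + 1) → ℝ) (x : RestrictedModel n m) :
    RestrictedModel n m →L[ℝ] ℝ :=
  x.2.comp ((Jet.lower n (by omega : m ≤ 2 * m + 1)).comp
      ((ContinuousLinearMap.snd ℝ _ _).comp (ContinuousLinearMap.fst ℝ _ _))) +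
    (ℓ x.1 - x.2 (Jet.shift n (by omega : m + 1 ≤ 2 * m + 1) x.1.2)) •
      ((ContinuousLinearMap.fst ℝ _ _).comp (ContinuousLinearMap.fst ℝ _ _))

/-- The Lagrangian function `L̂` in natural coordinates of `J^{2k-1} π`. -/
noncomputable def coordLagrangian (L : Jet B (m + 1) → ℝ) (y₀ : Jet B (2 * m + 1))
    (c : AdaptedChart B) (x : JetModel n (2 * m + 1)) : ℝ :=
  L (Jet.proj (by omega : m + 1 ≤ 2 * m + 1) ((Jet.chart y₀ c).symm x))

theorem contDiffOn_coordLagrangian {L : Jet B (m + 1) → ℝ}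
    (hL : ContMDiff 𝓘(ℝ, JetModel n (m + 1)) 𝓘(ℝ, ℝ) ∞ L) (y₀ : Jet B (2 * m + 1))
    (c : AdaptedChart B) :
    ContDiffOn ℝ ∞ (coordLagrangian L y₀ c) (Jet.chart y₀ c).target := fun x hx =>
  (contMDiffAt_iff_contDiffAt.1 ((hL.comp (Jet.contMDiff_proj _)).contMDiffAt.comp x
    (contMDiffAt_chart_symm (Jet.chart_mem_atlas y₀ c) hx))).contDiffWithinAt

theorem contDiffOn_coordOneForm {ℓ : JetModel n (2 * m + 1) → ℝ} {U : Set (JetModel n (2 * m + 1))}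
    (hℓ : ContDiffOn ℝ ∞ ℓ U) :
    ContDiffOn ℝ ∞ (coordOneForm (n := n) (m := m) ℓ) (Prod.fst ⁻¹' U) := by
  unfold coordOneForm
  have h1 : ContDiffOn ℝ ∞ (fun x : RestrictedModel n m => ℓ x.1) (Prod.fst ⁻¹' U) :=
    hℓ.comp contDiffOn_fst fun x hx => hx
  have h2 : ContDiff ℝ ∞ fun x : RestrictedModel n m =>
      x.2 (Jet.shift n (by omega : m + 1 ≤ 2 * m + 1) x.1.2) :=
    contDiff_snd.clm_apply ((ContinuousLinearMap.contDiff _).comp (contDiff_snd.comp contDiff_fst))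
  exact (contDiff_snd.clm_comp contDiff_const).contDiffOn.add
    ((h1.sub h2.contDiffOn).smul contDiffOn_const)

/-- `ĥ` is a section of the quotient map, so it can change a covector only by a multiple of `dt`,
which the momentum coordinates do not see. -/
theorem covectorCoord_hamiltonianSection {c : AdaptedChart B} (L : Jet B (m + 1) → ℝ)
    {w : RestrictedBundle B m} (hc : w.jet.base ∈ c.chart.source) :
    covectorCoord c w.baseJet (hamiltonianSection L w).covector = (RestrictedBundle.coord c w).2 := by
  have h1 := ((eq_hamiltonianSection_iff L w _).1 rfl).2
  have h2 : (Submodule.Quotient.mk (hamiltonianSection L w).covector :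
      RestrictedCovector w.baseJet) = w.momentum :=
    eq_of_heq (RestrictedBundle.mk.inj h1).2
  have h3 : w.baseJet.base ∈ c.chart.source := by rwa [w.base_baseJet]
  exact (momentumCoord_mk h3 _).symm.trans (congrArg (momentumCoord c w.baseJet) h2)

theorem covector_totalVector (L : Jet B (m + 1) → ℝ) (w : RestrictedBundle B m) :
    (hamiltonianSection L w).covector (totalVector w.jet) =
      L (Jet.proj (by omega : m + 1 ≤ 2 * m + 1) w.jet) :=
  ((eq_hamiltonianSection_iff L w _).1 rfl).1

/-- The natural coordinate expression of `Θ_r`. -/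
theorem unifiedOneForm_apply (L : Jet B (m + 1) → ℝ) (y₀ : Jet B (2 * m + 1)) {c : AdaptedChart B}
    {w : RestrictedBundle B m} (hc : w.jet.base ∈ c.chart.source)
    (u : TangentSpace 𝓘(ℝ, RestrictedModel n m) w) :
    unifiedOneForm L w u = coordOneForm (coordLagrangian L y₀ c) (RestrictedBundle.coord c w)
      (RestrictedBundle.coordDeriv c w u) := by
  have hb : w.baseJet.base ∈ c.chart.source := by rwa [w.base_baseJet]
  have hy : (Jet.chart y₀ c).symm (Jet.coord c w.jet) = w.jet := (Jet.chart y₀ c).left_inv hc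
  have h1 := Jet.covector_apply hb (hamiltonianSection L w).covector
    (mfderiv 𝓘(ℝ, RestrictedModel n m) 𝓘(ℝ, JetModel n m) RestrictedBundle.baseJet w u)
  have h2 := Jet.covector_apply hb (hamiltonianSection L w).covector (totalVector w.jet)
  have h3 : Jet.coordDeriv c w.baseJet (totalVector w.jet) = _ := Jet.coordDeriv_totalVector hc
  have h4 : Jet.coordDeriv c w.baseJet (mfderiv 𝓘(ℝ, RestrictedModel n m) 𝓘(ℝ, JetModel n m)
      RestrictedBundle.baseJet w u) = _ := RestrictedBundle.coordDeriv_proj (by omega) hc u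
  have h5 := covectorCoord_hamiltonianSection L hc
  rw [h5, h3, one_mul] at h2
  rw [h5, h4] at h1
  -- The only unknown is the coefficient of `dt` in the covector of `ĥ w`. Evaluating on the total
  -- vector, where the value is `L̂` by the condition `Ĉ = L̂`, gives `L̂ - p^i q_{i+1}`.
  have h7 := sub_eq_of_eq_add (h2.symm.trans (covector_totalVector L w)).symm
  refine h1.trans ?_
  rw [← h7, coordOneForm, coordLagrangian]
  change _ = (RestrictedBundle.coord c w).2 _ + (L (Jet.proj _ ((Jet.chart y₀ c).symm
    (Jet.coord c w.jet))) - _) * _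
  rw [hy, add_comm]
  exact congrArg _ (mul_comm _ _)

end OneForm

end SkinnerRusk

namespace SkinnerRusk

variable {n : ℕ} {B : ConfigurationBundle.{u, v} n} {m : ℕ}

/-! ### The equation `i(u)Ω_r = 0` in natural coordinates -/

section TwoForm

theorem flatExteriorDerivative_coordOneForm {ℓ : JetModel n (2 * m + 1) → ℝ}
    {x : RestrictedModel n m} (hℓ : DifferentiableAt ℝ ℓ x.1) (u v : RestrictedModel n m) :
    flatExteriorDerivative (coordOneForm ℓ) x u v =
      u.2 (Jet.lower n (by omega : m ≤ 2 * m + 1) v.1.2) -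
      v.2 (Jet.lower n (by omega : m ≤ 2 * m + 1) u.1.2) +
      (fderiv ℝ ℓ x.1 u.1 - u.2 (Jet.shift n (by omega : m + 1 ≤ 2 * m + 1) x.1.2) -
        x.2 (Jet.shift n (by omega : m + 1 ≤ 2 * m + 1) u.1.2)) * v.1.1 -
      (fderiv ℝ ℓ x.1 v.1 - v.2 (Jet.shift n (by omega : m + 1 ≤ 2 * m + 1) x.1.2) -
        x.2 (Jet.shift n (by omega : m + 1 ≤ 2 * m + 1) v.1.2)) * u.1.1 := by
  have h1 : HasFDerivAt (fun x : RestrictedModel n m => ℓ x.1)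
      ((fderiv ℝ ℓ x.1).comp (ContinuousLinearMap.fst ℝ _ _)) x :=
    HasFDerivAt.comp x hℓ.hasFDerivAt hasFDerivAt_fst
  let S : RestrictedModel n m →L[ℝ] (Fin (m + 1) → EuclideanSpace ℝ (Fin n)) :=
    (Jet.shift n (by omega : m + 1 ≤ 2 * m + 1)).comp
      ((ContinuousLinearMap.snd ℝ _ _).comp (ContinuousLinearMap.fst ℝ _ _))
  have h2 : HasFDerivAt (fun x : RestrictedModel n m => x.2 (S x)) _ x :=
    (hasFDerivAt_snd (𝕜 := ℝ)).clm_apply S.hasFDerivAt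
  let A : RestrictedModel n m →L[ℝ] (Fin (m + 1) → EuclideanSpace ℝ (Fin n)) :=
    (Jet.lower n (by omega : m ≤ 2 * m + 1)).comp
      ((ContinuousLinearMap.snd ℝ _ _).comp (ContinuousLinearMap.fst ℝ _ _))
  let T : RestrictedModel n m →L[ℝ] ℝ :=
    (ContinuousLinearMap.fst ℝ _ _).comp (ContinuousLinearMap.fst ℝ _ _)
  have h3 := ((hasFDerivAt_snd (𝕜 := ℝ) (p := x)).clm_comp (hasFDerivAt_const A x)).add
      ((h1.sub h2).smul (hasFDerivAt_const T x))
  rw [flatExteriorDerivative, show coordOneForm (n := n) (m := m) ℓ = _ from rfl]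
  erw [h3.fderiv]
  simp [S, A, T]
  ring

/-- Testing against pure momentum directions yields the first condition, against vertical jet
directions the second. These two exhaust the equation: `u` itself has `dt(u) = 1`, and pairing it
with itself gives zero. -/
theorem forall_flatExteriorDerivative_eq_zero_iff {ℓ : JetModel n (2 * m + 1) → ℝ}
    {x : RestrictedModel n m} (hℓ : DifferentiableAt ℝ ℓ x.1) {u : RestrictedModel n m}
    (hu : u.1.1 = 1) :
    (∀ v, flatExteriorDerivative (coordOneForm ℓ) x u v = 0) ↔
      Jet.lower n (by omega : m ≤ 2 * m + 1) u.1.2 =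
        Jet.shift n (by omega : m + 1 ≤ 2 * m + 1) x.1.2 ∧
      ∀ v, u.2 (Jet.lower n (by omega : m ≤ 2 * m + 1) v) =
        fderiv ℝ ℓ x.1 ((0 : ℝ), v) - x.2 (Jet.shift n (by omega : m + 1 ≤ 2 * m + 1) v) := by
  simp only [flatExteriorDerivative_coordOneForm hℓ, hu, mul_one]
  constructor
  · intro h
    have h1 : Jet.lower n (by omega : m ≤ 2 * m + 1) u.1.2 =
        Jet.shift n (by omega : m + 1 ≤ 2 * m + 1) x.1.2 := by
      refine (SeparatingDual.eq_iff_forall_dual_eq (R := ℝ)).2 fun g => ?_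
      have := h (0, g)
      simp at this
      linarith
    refine ⟨h1, fun v => ?_⟩
    have := h (((0 : ℝ), v), 0)
    simp at this
    linarith
  · rintro ⟨h1, h2⟩ v
    have h3 : ∀ z : JetModel n (2 * m + 1), fderiv ℝ ℓ x.1 z =
        z.1 * fderiv ℝ ℓ x.1 ((1 : ℝ), 0) + fderiv ℝ ℓ x.1 ((0 : ℝ), z.2) := by
      intro z
      have h5 : z = z.1 • ((1 : ℝ), (0 : Fin (2 * m + 2) → EuclideanSpace ℝ (Fin n))) +
          (0, z.2) := by
        refine Prod.ext ?_ ?_ <;> simp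
      conv_lhs => rw [h5]
      rw [map_add, map_smul, smul_eq_mul]
    -- The second condition for the jet component of `u` itself makes the remaining coefficient of
    -- `v.1.1` vanish.
    have h4 := h2 u.1.2
    rw [h1] at h4
    rw [h1, h2, h3 u.1, h3 v.1, hu, h4]
    ring

theorem isExpression_unifiedOneForm {L : Jet B (m + 1) → ℝ}
    (hL : ContMDiff 𝓘(ℝ, JetModel n (m + 1)) 𝓘(ℝ, ℝ) ∞ L) (w₀ : RestrictedBundle B m)
    (c : AdaptedChart B) :
    IsExpression (unifiedOneForm L) (RestrictedBundle.chart w₀ c)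
      (coordOneForm (coordLagrangian L w₀.jet c)) where
  mem_atlas := RestrictedBundle.chart_mem_atlas w₀ c
  apply_eq _ hw u := unifiedOneForm_apply L w₀.jet hw u
  smooth := contDiffOn_coordOneForm (contDiffOn_coordLagrangian hL w₀.jet c)

theorem unifiedTwoForm_apply {L : Jet B (m + 1) → ℝ}
    (hL : ContMDiff 𝓘(ℝ, JetModel n (m + 1)) 𝓘(ℝ, ℝ) ∞ L) (w₀ : RestrictedBundle B m)
    {c : AdaptedChart B} {w : RestrictedBundle B m} (hc : w.jet.base ∈ c.chart.source)
    (u v : TangentSpace 𝓘(ℝ, RestrictedModel n m) w) :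
    unifiedTwoForm L w u v = -flatExteriorDerivative (coordOneForm (coordLagrangian L w₀.jet c))
      (RestrictedBundle.coord c w) (RestrictedBundle.coordDeriv c w u)
      (RestrictedBundle.coordDeriv c w v) :=
  congrArg Neg.neg ((isExpression_unifiedOneForm hL w₀ c).exteriorDerivative_eq hc u v)

theorem unifiedTwoForm_swap (L : Jet B (m + 1) → ℝ) (w : RestrictedBundle B m)
    (u v : TangentSpace 𝓘(ℝ, RestrictedModel n m) w) :
    unifiedTwoForm L w u v = -unifiedTwoForm L w v u := by
  simp [unifiedTwoForm, exteriorDerivative]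

/-- The form `Ω_r` at `w` as a bilinear form on the model space. -/
noncomputable def unifiedTwoFormLinear (L : Jet B (m + 1) → ℝ) (w : RestrictedBundle B m) :
    RestrictedModel n m →L[ℝ] RestrictedModel n m →L[ℝ] ℝ :=
  let D := fderiv ℝ (chartExpression (unifiedOneForm L) w) (chartAt (RestrictedModel n m) w w)
  D.flip - D

theorem unifiedTwoForm_eq_linear (L : Jet B (m + 1) → ℝ) (w : RestrictedBundle B m)
    (u v : TangentSpace 𝓘(ℝ, RestrictedModel n m) w) :
    unifiedTwoForm L w u v = unifiedTwoFormLinear L w u v := by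
  rw [unifiedTwoForm, exteriorDerivative, neg_sub]
  rfl

theorem differentiableAt_coordLagrangian {L : Jet B (m + 1) → ℝ}
    (hL : ContMDiff 𝓘(ℝ, JetModel n (m + 1)) 𝓘(ℝ, ℝ) ∞ L) (y₀ : Jet B (2 * m + 1))
    {c : AdaptedChart B} {w : RestrictedBundle B m} (hc : w.jet.base ∈ c.chart.source) :
    DifferentiableAt ℝ (coordLagrangian L y₀ c) (RestrictedBundle.coord c w).1 :=
  ((contDiffOn_coordLagrangian hL y₀ c).contDiffAt ((Jet.chart y₀ c).open_target.mem_nhds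
    ((Jet.chart y₀ c).map_source hc))).differentiableAt (by simp)

theorem RestrictedBundle.coordDeriv_surjective {c : AdaptedChart B} {w : RestrictedBundle B m}
    (hc : w.jet.base ∈ c.chart.source) : Function.Surjective (RestrictedBundle.coordDeriv c w) :=
  (isInvertible_mfderiv_chart (RestrictedBundle.chart_mem_atlas w c) hc).surjective

/-- The equation `i(u) Ω_r = 0` in natural coordinates, for `dt(u) = 1`. -/
theorem forall_unifiedTwoForm_eq_zero_iff {L : Jet B (m + 1) → ℝ}
    (hL : ContMDiff 𝓘(ℝ, JetModel n (m + 1)) 𝓘(ℝ, ℝ) ∞ L) (w₀ : RestrictedBundle B m)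
    {c : AdaptedChart B} {w : RestrictedBundle B m} (hc : w.jet.base ∈ c.chart.source)
    {u : TangentSpace 𝓘(ℝ, RestrictedModel n m) w} (hu : timeForm w u = 1) :
    (∀ v, unifiedTwoForm L w u v = 0) ↔
      Jet.lower n (by omega : m ≤ 2 * m + 1) (RestrictedBundle.coordDeriv c w u).1.2 =
        Jet.shift n (by omega : m + 1 ≤ 2 * m + 1) (RestrictedBundle.coord c w).1.2 ∧
      ∀ v, (RestrictedBundle.coordDeriv c w u).2 (Jet.lower n (by omega : m ≤ 2 * m + 1) v) =
        fderiv ℝ (coordLagrangian L w₀.jet c) (RestrictedBundle.coord c w).1 ((0 : ℝ), v) -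
          (RestrictedBundle.coord c w).2 (Jet.shift n (by omega : m + 1 ≤ 2 * m + 1) v) := by
  rw [← forall_flatExteriorDerivative_eq_zero_iff
    (differentiableAt_coordLagrangian hL w₀.jet hc) (by rw [← RestrictedBundle.timeForm_apply hc, hu])]
  constructor
  · intro h v
    obtain ⟨v', rfl⟩ := RestrictedBundle.coordDeriv_surjective hc v
    exact neg_eq_zero.1 ((unifiedTwoForm_apply hL w₀ hc u v').symm.trans (h v'))
  · intro h v
    exact (unifiedTwoForm_apply hL w₀ hc u v).trans (neg_eq_zero.2 (h _))

end TwoForm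

/-! ### Holonomic vectors, holonomic curves and semisprays -/

section Holonomic

/-- Any `(k+1)`-jet determines a tangent vector of `J^k π`. -/
theorem Jet.exists_total_vector {k : ℕ} (y : Jet B (k + 1)) : ∃ τ : JetModel n k,
    ∀ c : AdaptedChart B, y.base ∈ c.chart.source →
      Jet.coordDeriv c (Jet.proj (by omega : k ≤ k + 1) y) τ =
        ((1 : ℝ), Jet.shift n le_rfl (Jet.coord c y).2) := by
  obtain ⟨φ, t, h, rfl⟩ := Jet.exists_rep y
  refine ⟨mfderiv 𝓘(ℝ, ℝ) 𝓘(ℝ, JetModel n k) (prolongation (Jet.mk k φ t h) φ) t (1 : ℝ),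
    fun c hc => ?_⟩
  have h2 := Jet.coordDeriv_prolongation (Jet.mk k φ t h) h (c := c) hc
  rw [Jet.coord_mk c h hc]
  exact h2

/-- The vectors `u` at `w` with `dt(u) = 1` along which holonomic curves may go. -/
def IsHolonomicVector (w : RestrictedBundle B m) (u : TangentSpace 𝓘(ℝ, RestrictedModel n m) w) :
    Prop :=
  timeForm w u = 1 ∧ ∀ c : AdaptedChart B, w.jet.base ∈ c.chart.source →
    Jet.lower n (by omega : 2 * m ≤ 2 * m + 1) (RestrictedBundle.coordDeriv c w u).1.2 =
      Jet.shift n le_rfl (RestrictedBundle.coord c w).1.2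

/-- One chart suffices: the condition there says that `u` projects to the tangent vector of `J^{2m}
π` determined by the jet of `w`, and that vector is the same for all charts. -/
theorem isHolonomicVector_iff {c : AdaptedChart B} {w : RestrictedBundle B m}
    (hc : w.jet.base ∈ c.chart.source) {u : TangentSpace 𝓘(ℝ, RestrictedModel n m) w} :
    IsHolonomicVector w u ↔ timeForm w u = 1 ∧
      Jet.lower n (by omega : 2 * m ≤ 2 * m + 1) (RestrictedBundle.coordDeriv c w u).1.2 =
        Jet.shift n le_rfl (RestrictedBundle.coord c w).1.2 := by
  refine ⟨fun h => ⟨h.1, h.2 c hc⟩, fun h => ⟨h.1, fun c' hc' => ?_⟩⟩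
  obtain ⟨τ, hτ⟩ := Jet.exists_total_vector w.jet
  have h1 := RestrictedBundle.coordDeriv_proj (by omega : 2 * m ≤ 2 * m + 1) hc u
  have h1' := RestrictedBundle.coordDeriv_proj (by omega : 2 * m ≤ 2 * m + 1) hc' u
  rw [h.2, ← RestrictedBundle.timeForm_apply hc, h.1] at h1
  have h2 := Jet.coordDeriv_injective (by rwa [Jet.proj_base]) (h1.trans (hτ c hc).symm)
  rw [h2] at h1'
  exact (congrArg Prod.snd ((hτ c' hc').symm.trans h1')).symm

theorem hasDerivAt_coord_comp {ψ : ℝ → RestrictedBundle B m} {t : ℝ}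
    (hψ : MDifferentiableAt 𝓘(ℝ, ℝ) 𝓘(ℝ, RestrictedModel n m) ψ t) {c : AdaptedChart B}
    (hc : (ψ t).jet.base ∈ c.chart.source) :
    HasDerivAt (fun s => RestrictedBundle.coord c (ψ s))
      (RestrictedBundle.coordDeriv c (ψ t) (velocity ψ t)) t := by
  refine hasDerivAt_chart_comp (RestrictedBundle.chart_mem_atlas (ψ t) c) ?_ hc
  refine hψ.hasMFDerivAt.congr_mfderiv (ContinuousLinearMap.ext_ring ?_)
  exact (one_smul ℝ (velocity ψ t)).symm

/-- Holonomy is needed on a neighbourhood of `t`, since it is the identity of the jet component with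
a prolongation that gets differentiated. -/
theorem isHolonomicVector_velocity {ψ : ℝ → RestrictedBundle B m} {t : ℝ}
    (hψ : MDifferentiableAt 𝓘(ℝ, ℝ) 𝓘(ℝ, RestrictedModel n m) ψ t)
    (hhol : ∀ᶠ s in 𝓝 t, IsHolonomicAt ψ s) : IsHolonomicVector (ψ t) (velocity ψ t) := by
  obtain ⟨c, hc⟩ := exists_adaptedChart (ψ t).jet.base
  obtain ⟨h, ht⟩ := hhol.self_of_nhds
  set φ : ℝ → B.E := fun s => (ψ s).jet.base
  have h1 : HasDerivAt (fun s => (RestrictedBundle.coord c (ψ s)).1)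
      (RestrictedBundle.coordDeriv c (ψ t) (velocity ψ t)).1 t :=
    (hasDerivAt_coord_comp hψ hc).fst
  have h2 := Jet.hasDerivAt_coord_prolongation (ψ t).jet h (c := c) hc
  have h3 : (fun s => (RestrictedBundle.coord c (ψ s)).1) =ᶠ[𝓝 t]
      fun s => Jet.coord c (prolongation (ψ t).jet φ s) := by
    filter_upwards [hhol] with s ⟨hs, hs'⟩
    rw [prolongation, dif_pos hs, ← hs']
    rfl
  have h4 := h1.unique (h2.congr_of_eventuallyEq h3)
  rw [isHolonomicVector_iff hc, RestrictedBundle.timeForm_apply hc]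
  refine ⟨congrArg Prod.fst h4, ?_⟩
  rw [h4]
  change _ = Jet.shift n le_rfl (Jet.coord c (ψ t).jet).2
  rw [ht, Jet.coord_mk c h hc]
  rfl

/-- Converse of `isHolonomicVector_velocity`: the equations `q_i' = q_{i+1}` identify each `q_i`
along the curve with the `i`-th derivative of `q_0`. -/
theorem isHolonomicAt_of_hasDerivAt {γ : ℝ → RestrictedBundle B m} {t : ℝ}
    (hγ : ∀ᶠ s in 𝓝 t, ContMDiffAt 𝓘(ℝ, ℝ) 𝓘(ℝ, RestrictedModel n m) ∞ γ s ∧ (γ s).time = s ∧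
      IsHolonomicVector (γ s) (velocity γ s)) : IsHolonomicAt γ t := by
  obtain ⟨c, hc⟩ := exists_adaptedChart (γ t).jet.base
  have hn : IsSectionNear B (fun s => (γ s).jet.base) t := by
    filter_upwards [hγ] with s hs
    refine ⟨RestrictedBundle.contMDiff_base.contMDiffAt.comp s hs.1, ?_⟩
    obtain ⟨c, hc⟩ := exists_adaptedChart (γ s).jet.base
    rw [← c.fst_eq _ hc, ← Jet.coord_fst_snd_zero c hc]
    exact hs.2.1
  have hsrc : ∀ᶠ s in 𝓝 t, (γ s).jet.base ∈ c.chart.source :=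
    Jet.eventually_mem_source hn c hc
  refine ⟨hn, ?_⟩
  let g : ℝ → EuclideanSpace ℝ (Fin n) := fun s => (c.chart (γ s).jet.base).2
  -- The induction differentiates, so it has to carry equality near `t`. The passage from `i` to `i
  -- + 1` uses only `i ≤ 2m`, which is as far as holonomic vectors are constrained.
  have key : ∀ i (hi : i < 2 * m + 2), iteratedDeriv i g =ᶠ[𝓝 t]
      fun s => (RestrictedBundle.coord c (γ s)).1.2 ⟨i, hi⟩ := by
    intro i
    induction i with
    | zero =>
      intro _
      filter_upwards [hsrc] with s hs
      rw [iteratedDeriv_zero]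
      exact (congrArg Prod.snd (Jet.coord_fst_snd_zero c hs)).symm
    | succ i ih =>
      intro hi
      rw [iteratedDeriv_succ]
      refine (ih (by omega)).deriv.trans ?_
      filter_upwards [hsrc, hγ] with s hs hs'
      have h1 := ((hasDerivAt_coord_comp (hs'.1.mdifferentiableAt (by simp)) hs).fst).snd
      have h2 := hasDerivAt_pi.1 h1 ⟨i, by omega⟩
      rw [h2.deriv]
      exact congrFun (hs'.2.2.2 c hs) ⟨i, by omega⟩
  have hc' : (Jet.mk (2 * m + 1) (fun s => (γ s).jet.base) t hn).base ∈ c.chart.source := hc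
  refine (Jet.chart (γ t).jet c).injOn (Jet.mem_chart_source.2 hc) (Jet.mem_chart_source.2 hc') ?_
  rw [Jet.coe_chart, Jet.coord_mk c hn hc]
  refine Prod.ext hγ.self_of_nhds.2.1 (funext fun i => ?_)
  have h3 := iteratedDeriv_clm_comp (ContinuousLinearMap.snd ℝ ℝ (EuclideanSpace ℝ (Fin n)))
    (Jet.contDiffAt_chart_comp hn c hc) i
  exact (key i i.2).self_of_nhds.symm.trans h3

/-- An integral curve is smooth because `X` is, and its velocity is the value of `X`, a holonomic
vector. -/
theorem isSemispray_of_isHolonomicVector {X : VectorFieldOn B m} (hX : IsSmoothField X)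
    (h : ∀ w, IsHolonomicVector w (X w)) : IsSemispray X := by
  intro γ I hI hγt hγ t ht
  refine isHolonomicAt_of_hasDerivAt ?_
  filter_upwards [hI.mem_nhds ht] with s hs
  have h1 : IsMIntegralCurveAt γ X s := hγ.isMIntegralCurveAt (hI.mem_nhds hs)
  refine ⟨contMDiffAt_of_isMIntegralCurveAt hX h1, hγt s hs, ?_⟩
  have h2 : velocity γ s = X (γ s) := by
    rw [velocity, h1.hasMFDerivAt.mfderiv]
    exact one_smul ℝ (X (γ s))
  rw [h2]
  exact h _

end Holonomic

end SkinnerRusk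

/-! ### Gluing of vector fields and the local model of a semispray -/

namespace SkinnerRusk

variable {n : ℕ} {B : ConfigurationBundle.{u, v} n} {m : ℕ}

/-- A partition of unity glues local solutions of a pointwise convex condition. This serves both to
extend a single tangent vector and to build the semispray. -/
theorem exists_isSmoothField_forall_mem
    (S : (w : RestrictedBundle B m) → Set (TangentSpace 𝓘(ℝ, RestrictedModel n m) w))
    (hS : ∀ w, Convex ℝ (S w))
    (hloc : ∀ w₀, ∃ U ∈ 𝓝 w₀, ∃ X : VectorFieldOn B m,
      ContMDiffOn 𝓘(ℝ, RestrictedModel n m) 𝓘(ℝ, RestrictedModel n m).tangent ∞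
        (fun w => (⟨w, X w⟩ : TangentBundle 𝓘(ℝ, RestrictedModel n m) (RestrictedBundle B m))) U ∧
      ∀ w ∈ U, X w ∈ S w) :
    ∃ X : VectorFieldOn B m, IsSmoothField X ∧ ∀ w, X w ∈ S w := by
  have : IsManifold 𝓘(ℝ, RestrictedModel n m) 1 (RestrictedBundle B m) :=
    .of_le (n := ∞) (WithTop.coe_le_coe.2 le_top)
  obtain ⟨s, hs⟩ := exists_contMDiffSection_forall_mem_convex_of_local (n := ⊤)
    𝓘(ℝ, RestrictedModel n m) (F_fiber := RestrictedModel n m)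
    (TangentSpace 𝓘(ℝ, RestrictedModel n m) : RestrictedBundle B m → Type) S hS hloc
  exact ⟨s, s.contMDiff, hs⟩

theorem contMDiffOn_chartField (w₀ : RestrictedBundle B m) (c : AdaptedChart B)
    {F : RestrictedModel n m → RestrictedModel n m} {U : Set (RestrictedModel n m)}
    (hU : IsOpen U) (hF : ContDiffOn ℝ ∞ F U) :
    ContMDiffOn 𝓘(ℝ, RestrictedModel n m) 𝓘(ℝ, RestrictedModel n m).tangent ∞
      (fun w => (⟨w, chartField (RestrictedBundle.chart w₀ c) F w⟩ :
        TangentBundle 𝓘(ℝ, RestrictedModel n m) (RestrictedBundle B m)))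
      ((RestrictedBundle.chart w₀ c).source ∩ RestrictedBundle.chart w₀ c ⁻¹' U) :=
  fun _ hw => (contMDiffAt_chartField (RestrictedBundle.chart_mem_atlas w₀ c) hw.1
    (hF.contDiffAt (hU.mem_nhds hw.2))).contMDiffWithinAt

/-- The convex condition is a prescribed value at `w₀` and nothing elsewhere: a field constant in a
chart solves it near `w₀`, the zero field away from `w₀`. -/
theorem exists_isSmoothField_eq (w₀ : RestrictedBundle B m)
    (v : TangentSpace 𝓘(ℝ, RestrictedModel n m) w₀) :
    ∃ X : VectorFieldOn B m, IsSmoothField X ∧ X w₀ = v := by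
  refine (exists_isSmoothField_forall_mem (B := B) (m := m)
    (fun w => {u | w = w₀ → (show RestrictedModel n m from u) = v}) ?_ ?_).imp
    fun X h => ⟨h.1, h.2 w₀ rfl⟩
  · intro w u hu u' hu' a b _ _ hab hw
    change a • (show RestrictedModel n m from u) + b • (show RestrictedModel n m from u') = v
    rw [hu hw, hu' hw]
    exact Convex.combo_self hab _
  · intro w₁
    by_cases hw : w₁ = w₀
    · subst hw
      obtain ⟨c, hc⟩ := exists_adaptedChart w₁.jet.base
      let e := RestrictedBundle.chart w₁ c
      refine ⟨e.source ∩ e ⁻¹' univ, ?_, chartField e fun _ => RestrictedBundle.coordDeriv c w₁ v,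
        contMDiffOn_chartField w₁ c isOpen_univ contDiffOn_const, ?_⟩
      · simpa using e.open_source.mem_nhds hc
      · rintro w - rfl
        exact (eq_chartField (RestrictedBundle.chart_mem_atlas w c)
          (fun _ => RestrictedBundle.coordDeriv c w v) hc rfl).symm
    · refine ⟨{w₀}ᶜ, isOpen_compl_singleton.mem_nhds hw, fun _ => 0, ?_, fun w h h' => (h h').elim⟩
      exact (Bundle.contMDiff_zeroSection ℝ _).contMDiffOn

theorem map_combo {E F : Type*} [AddCommGroup E] [Module ℝ E] [TopologicalSpace E]
    [AddCommGroup F] [Module ℝ F] [TopologicalSpace F] (A : E →L[ℝ] F) (a b : ℝ) (u v : E) :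
    A (a • u + b • v) = a • A u + b • A v := by
  rw [map_add, map_smul, map_smul]

/-- All the defining equations are affine in `u`. -/
theorem isHolonomicVector_convex (w : RestrictedBundle B m) :
    Convex ℝ {u | IsHolonomicVector w u} := by
  intro u hu u' hu' a b _ _ hab
  refine ⟨?_, fun c hc => ?_⟩
  · rw [map_add, map_smul, map_smul, hu.1, hu'.1, smul_eq_mul, smul_eq_mul, mul_one, mul_one, hab]
  · have h1 : RestrictedBundle.coordDeriv c w (a • u + b • u') =
        a • RestrictedBundle.coordDeriv c w u + b • RestrictedBundle.coordDeriv c w u' :=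
      map_combo (RestrictedBundle.coordDeriv c w) a b u u'
    rw [h1]
    simp only [Prod.fst_add, Prod.snd_add, Prod.smul_fst, Prod.smul_snd, map_add, map_smul]
    rw [hu.2 c hc, hu'.2 c hc]
    exact Convex.combo_self hab _

theorem unifiedTwoForm_convex (L : Jet B (m + 1) → ℝ) (w : RestrictedBundle B m) :
    Convex ℝ {u | ∀ v, unifiedTwoForm L w u v = 0} := by
  intro u hu u' hu' a b _ _ _ v
  have h1 := hu v
  have h2 := hu' v
  rw [unifiedTwoForm_eq_linear] at h1 h2 ⊢
  have h3 : unifiedTwoFormLinear L w (a • u + b • u') v =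
      a * unifiedTwoFormLinear L w u v + b * unifiedTwoFormLinear L w u' v :=
    map_combo ((unifiedTwoFormLinear L w).flip v) a b u u'
  rw [h3, h1, h2, mul_zero, mul_zero, add_zero]

theorem unifiedTwoForm_smul (L : Jet B (m + 1) → ℝ) (w : RestrictedBundle B m) (a : ℝ)
    (u v : TangentSpace 𝓘(ℝ, RestrictedModel n m) w) :
    unifiedTwoForm L w (a • u) v = a * unifiedTwoForm L w u v := by
  rw [unifiedTwoForm_eq_linear, unifiedTwoForm_eq_linear]
  exact map_smul ((unifiedTwoFormLinear L w).flip v) a (show RestrictedModel n m from u)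

/-- The extension `(v₀, …, v_m) ↦ (v₀, …, v_m, 0, …, 0)`. -/
noncomputable def Jet.extend (n : ℕ) (r k : ℕ) : (Fin (r + 1) → EuclideanSpace ℝ (Fin n)) →L[ℝ]
    (Fin (k + 1) → EuclideanSpace ℝ (Fin n)) :=
  ContinuousLinearMap.pi fun j =>
    if h : (j : ℕ) < r + 1 then ContinuousLinearMap.proj ⟨j, h⟩ else 0

theorem Jet.lower_extend {r k : ℕ} (h : r ≤ k) (v : Fin (r + 1) → EuclideanSpace ℝ (Fin n)) :
    Jet.lower n h (Jet.extend n r k v) = v := by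
  funext i
  simp [Jet.lower, Jet.extend, Nat.lt_succ_iff.1 i.2]

/-- In natural coordinates, the vector fields `∂_t + q_{i+1} ∂_{q_i} + a(t) ∂_{q_{2m+1}} +
(∂L/∂q_i - p^{i-1}) ∂_{p^i}`. -/
noncomputable def coordField (ℓ : JetModel n (2 * m + 1) → ℝ) (a : ℝ → EuclideanSpace ℝ (Fin n))
    (x : RestrictedModel n m) : RestrictedModel n m :=
  (((1 : ℝ), Fin.snoc (α := fun _ => EuclideanSpace ℝ (Fin n)) (Jet.shift n le_rfl x.1.2) (a x.1.1)),
    ((fderiv ℝ ℓ x.1).comp (ContinuousLinearMap.inr ℝ ℝ _) -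
      x.2.comp (Jet.shift n (by omega : m + 1 ≤ 2 * m + 1))).comp (Jet.extend n m (2 * m + 1)))

theorem contDiffOn_coordField {ℓ : JetModel n (2 * m + 1) → ℝ} {a : ℝ → EuclideanSpace ℝ (Fin n)}
    {U : Set (JetModel n (2 * m + 1))} (hU : IsOpen U) (hℓ : ContDiffOn ℝ ∞ ℓ U) {J : Set ℝ}
    (ha : ContDiffOn ℝ ∞ a J) :
    ContDiffOn ℝ ∞ (coordField (n := n) (m := m) ℓ a) {x | x.1 ∈ U ∧ x.1.1 ∈ J} := by
  refine ContDiffOn.prodMk (contDiffOn_const.prodMk (contDiffOn_pi.2 fun i => ?_)) ?_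
  · refine Fin.lastCases ?_ (fun i => ?_) i
    · simp only [Fin.snoc_last]
      exact ha.comp (contDiff_fst.comp contDiff_fst).contDiffOn fun x hx => hx.2
    · simp only [Fin.snoc_castSucc]
      have h1 : ContDiff ℝ ∞ fun x : RestrictedModel n m => Jet.shift n le_rfl x.1.2 :=
        (ContinuousLinearMap.contDiff _).comp (contDiff_snd.comp contDiff_fst)
      exact ((contDiff_pi.1 h1) i).contDiffOn
  · have h1 : ContDiffOn ℝ ∞ (fun x : RestrictedModel n m => fderiv ℝ ℓ x.1)
        {x | x.1 ∈ U ∧ x.1.1 ∈ J} :=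
      (hℓ.fderiv_of_isOpen hU (by simp)).comp contDiffOn_fst fun x hx => hx.1
    exact ((h1.clm_comp contDiffOn_const).sub (contDiffOn_snd.clm_comp contDiffOn_const)).clm_comp
      contDiffOn_const

theorem lower_coordField (ℓ : JetModel n (2 * m + 1) → ℝ) (a : ℝ → EuclideanSpace ℝ (Fin n))
    (x : RestrictedModel n m) :
    Jet.lower n (by omega : 2 * m ≤ 2 * m + 1) (coordField ℓ a x).1.2 =
      Jet.shift n le_rfl x.1.2 := by
  funext i
  exact Fin.snoc_castSucc (α := fun _ => EuclideanSpace ℝ (Fin n)) (a x.1.1)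
    (Jet.shift n le_rfl x.1.2) i

/-- As `m ≤ 2m`, holonomy already contains the first half of the equation `i(u)Ω_r = 0`. -/
theorem lower_eq_shift_of_lower {x y : Fin (2 * m + 1 + 1) → EuclideanSpace ℝ (Fin n)}
    (h : Jet.lower n (by omega : 2 * m ≤ 2 * m + 1) y = Jet.shift n le_rfl x) :
    Jet.lower n (by omega : m ≤ 2 * m + 1) y = Jet.shift n (by omega : m + 1 ≤ 2 * m + 1) x := by
  funext i
  exact congrFun h (Fin.castLE (by omega) i)

end SkinnerRusk

/-! ### Construction of the semispray and the equivalence of (2), (3), (4), (4′) -/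

namespace SkinnerRusk

variable {n : ℕ} {B : ConfigurationBundle.{u, v} n} {m : ℕ} {L : Jet B (m + 1) → ℝ}

theorem exists_normalized_of_mem_compatibilitySet {w : RestrictedBundle B m}
    (hw : w ∈ compatibilitySet L) :
    ∃ u : TangentSpace 𝓘(ℝ, RestrictedModel n m) w, timeForm w u = 1 ∧
      ∀ v, unifiedTwoForm L w u v = 0 := by
  obtain ⟨u, hu, h⟩ := hw
  refine ⟨(timeForm w u)⁻¹ • u, ?_, fun v => ?_⟩
  · rw [map_smul, smul_eq_mul, inv_mul_cancel₀ hu]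
  · rw [unifiedTwoForm_smul, h, mul_zero]

section LocalField

variable (hL : ContMDiff 𝓘(ℝ, JetModel n (m + 1)) 𝓘(ℝ, ℝ) ∞ L) (w₀ : RestrictedBundle B m)
  {c : AdaptedChart B} {w : RestrictedBundle B m} (hc : w.jet.base ∈ c.chart.source)
  {u : TangentSpace 𝓘(ℝ, RestrictedModel n m) w}

include hc in
theorem isHolonomicVector_of_coordField {ℓ : JetModel n (2 * m + 1) → ℝ}
    {a : ℝ → EuclideanSpace ℝ (Fin n)}
    (hu : RestrictedBundle.coordDeriv c w u = coordField ℓ a (RestrictedBundle.coord c w)) :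
    IsHolonomicVector w u := by
  rw [isHolonomicVector_iff hc, RestrictedBundle.timeForm_apply hc, hu]
  exact ⟨rfl, lower_coordField _ _ _⟩

include hL hc in
-- The equation determines the momentum components of a normalised solution: every `(v₀, …, v_m)` is
-- the lower part of its extension by zeros. The function `a` enters only the jet component, so it
-- may be anything.
theorem coordDeriv_snd_eq (hu : timeForm w u = 1) (h : ∀ v, unifiedTwoForm L w u v = 0)
    (a : ℝ → EuclideanSpace ℝ (Fin n)) :
    (RestrictedBundle.coordDeriv c w u).2 =
      (coordField (coordLagrangian L w₀.jet c) a (RestrictedBundle.coord c w)).2 := by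
  have h1 := ((forall_unifiedTwoForm_eq_zero_iff hL w₀ hc hu).1 h).2
  ext1 v
  have h2 := h1 (Jet.extend n m (2 * m + 1) v)
  rw [Jet.lower_extend] at h2
  exact h2

include hL hc in
-- Over `W_1` some normalised solution exists, and it shares its momentum components with
-- `coordField`. The second family of equations involves only these components, so it passes to `u`;
-- the first family is part of holonomy.
theorem unifiedTwoForm_eq_zero_of_coordField {a : ℝ → EuclideanSpace ℝ (Fin n)}
    (hu : RestrictedBundle.coordDeriv c w u =
      coordField (coordLagrangian L w₀.jet c) a (RestrictedBundle.coord c w))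
    (hw : w ∈ compatibilitySet L) : ∀ v, unifiedTwoForm L w u v = 0 := by
  obtain ⟨u', hu', h'⟩ := exists_normalized_of_mem_compatibilitySet hw
  have h1 := ((forall_unifiedTwoForm_eq_zero_iff hL w₀ hc hu').1 h').2
  have h2 := coordDeriv_snd_eq hL w₀ hc hu' h' a
  have hol := isHolonomicVector_of_coordField hc hu
  refine (forall_unifiedTwoForm_eq_zero_iff hL w₀ hc hol.1).2
    ⟨lower_eq_shift_of_lower (hol.2 c hc), fun v => ?_⟩
  rw [hu, ← h2]
  exact h1 v

include hL hc in
-- A holonomic solution has one free component, along `q_{2m+1}`; matching `a` with it at the time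
-- of `w` leaves no choice.
theorem coordDeriv_eq_coordField (hu : IsHolonomicVector w u)
    (h : ∀ v, unifiedTwoForm L w u v = 0) {a : ℝ → EuclideanSpace ℝ (Fin n)}
    (ha : a w.time = (RestrictedBundle.coordDeriv c w u).1.2 (Fin.last _)) :
    RestrictedBundle.coordDeriv c w u =
      coordField (coordLagrangian L w₀.jet c) a (RestrictedBundle.coord c w) := by
  refine Prod.ext (Prod.ext ?_ (funext fun i => ?_)) (coordDeriv_snd_eq hL w₀ hc hu.1 h a)
  · exact (RestrictedBundle.timeForm_apply hc u).symm.trans hu.1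
  · refine Fin.lastCases ?_ (fun i => ?_) i
    · rw [← ha]
      exact (Fin.snoc_last (α := fun _ => EuclideanSpace ℝ (Fin n)) _ _).symm
    · exact (congrFun (hu.2 c hc) i).trans 
        (congrFun (lower_coordField (coordLagrangian L w₀.jet c) a _) i).symm

end LocalField

section Global

variable (hL : ContMDiff 𝓘(ℝ, JetModel n (m + 1)) 𝓘(ℝ, ℝ) ∞ L)
  {ψ : ℝ → RestrictedBundle B m} (hψ : IsGlobalSection ψ)

theorem isMIntegralCurve_iff_velocity {X : VectorFieldOn B m}
    (hψ : ContMDiff 𝓘(ℝ, ℝ) 𝓘(ℝ, RestrictedModel n m) ∞ ψ) :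
    IsMIntegralCurve ψ X ↔ ∀ t, velocity ψ t = X (ψ t) := by
  refine forall_congr' fun t => ⟨fun h => ?_, fun h => ?_⟩
  · rw [velocity, h.mfderiv]
    exact one_smul ℝ (X (ψ t))
  · refine ((hψ.contMDiffAt (x := t)).mdifferentiableAt (by simp)).hasMFDerivAt.congr_mfderiv
      (ContinuousLinearMap.ext_ring ?_)
    exact h.trans (one_smul ℝ (X (ψ t))).symm

include hL hψ in
-- The condition `ψ w.time = w` means that `w` lies on the image of `ψ`. The three requirements on
-- `X` are chosen convex, ready for gluing; near the image everything is settled by the choice of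
-- `a`.
theorem exists_local_field (hhol : IsHolonomic ψ)
    (h : ∀ t, ∀ v, unifiedTwoForm L (ψ t) (velocity ψ t) v = 0) (w₀ : RestrictedBundle B m) :
    ∃ U ∈ 𝓝 w₀, ∃ X : VectorFieldOn B m,
      ContMDiffOn 𝓘(ℝ, RestrictedModel n m) 𝓘(ℝ, RestrictedModel n m).tangent ∞
        (fun w => (⟨w, X w⟩ : TangentBundle 𝓘(ℝ, RestrictedModel n m) (RestrictedBundle B m))) U ∧
      ∀ w ∈ U, IsHolonomicVector w (X w) ∧
        (w ∈ compatibilitySet L → ∀ v, unifiedTwoForm L w (X w) v = 0) ∧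
        (ψ w.time = w → (show RestrictedModel n m from X w) = velocity ψ w.time) := by
  obtain ⟨c, hc⟩ := exists_adaptedChart w₀.jet.base
  set e := RestrictedBundle.chart w₀ c with hedef
  have he := RestrictedBundle.chart_mem_atlas w₀ c
  set ℓ := coordLagrangian L w₀.jet c with hℓdef
  have hℓ : ContDiffOn ℝ ∞ ℓ (Jet.chart w₀.jet c).target := contDiffOn_coordLagrangian hL _ _
  have hTo : IsOpen (Jet.chart w₀.jet c).target := (Jet.chart w₀.jet c).open_target
  let J : Set ℝ := ψ ⁻¹' e.source
  have hJ : IsOpen J := e.open_source.preimage hψ.1.continuous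
  have hcd : ContDiffOn ℝ ∞ (e ∘ ψ) J := fun t ht =>
    (contDiffAt_chart_comp_of_contMDiffAt he hψ.1.contMDiffAt ht).contDiffWithinAt
  have hda : ∀ (a : ℝ → EuclideanSpace ℝ (Fin n)) (w : RestrictedBundle B m),
      w.jet.base ∈ c.chart.source →
      RestrictedBundle.coordDeriv c w (chartField e (coordField ℓ a) w) =
        coordField ℓ a (RestrictedBundle.coord c w) :=
    fun a w hw => mfderiv_chartField he (coordField ℓ a) hw
  by_cases hw₀ : ψ w₀.time = w₀
  -- The free component is the derivative of the coordinate `q_{2m+1}` along `ψ`. As `ψ` is a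
  -- section, this is a function of the coordinate `t`, smooth at the times `J` at which `ψ` is in
  -- the chart.
  · let a : ℝ → EuclideanSpace ℝ (Fin n) := fun t => (deriv (e ∘ ψ) t).1.2 (Fin.last _)
    have ha : ContDiffOn ℝ ∞ a J := by
      have h1 : ContDiffOn ℝ ∞ (deriv (e ∘ ψ)) J := hcd.deriv_of_isOpen hJ (by simp)
      exact contDiffOn_pi.1 h1.fst.snd (Fin.last _)
    have hU : IsOpen {x : RestrictedModel n m | x.1 ∈ (Jet.chart w₀.jet c).target ∧ x.1.1 ∈ J} :=
      (hTo.preimage continuous_fst).inter (hJ.preimage (continuous_fst.comp continuous_fst))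
    refine ⟨_, (e.isOpen_inter_preimage hU).mem_nhds ⟨hc, e.map_source hc, ?_⟩,
      chartField e (coordField ℓ a),
      contMDiffOn_chartField w₀ c hU (contDiffOn_coordField hTo hℓ ha), fun w hw => ?_⟩
    · change ψ w₀.time ∈ e.source
      rwa [hw₀]
    · have hwc : w.jet.base ∈ c.chart.source := hw.1
      refine ⟨isHolonomicVector_of_coordField hwc (hda a w hwc),
        unifiedTwoForm_eq_zero_of_coordField hL w₀ hwc (hda a w hwc), fun hwt => ?_⟩
      -- Stated at the points `ψ t`, so that both vectors belong to the same tangent space; the case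
      -- of `w` follows by rewriting in the model space.
      have key : ∀ t, (ψ t).time = t → (ψ t).jet.base ∈ c.chart.source →
          (show RestrictedModel n m from chartField e (coordField ℓ a) (ψ t)) = velocity ψ t := by
        intro t ht htc
        refine (eq_chartField he (coordField ℓ a) htc ?_).symm
        have hmd := (hψ.1.contMDiffAt (x := t)).mdifferentiableAt (by simp)
        refine coordDeriv_eq_coordField hL w₀ htc
          (isHolonomicVector_velocity hmd (Eventually.of_forall hhol)) (h t) ?_
        rw [ht]
        exact congrArg (fun x : RestrictedModel n m => x.1.2 (Fin.last _))
          (hasDerivAt_coord_comp hmd htc).deriv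
      have h3 := key w.time (hψ.2 _) (by rwa [hwt])
      rw [hwt] at h3
      exact h3
  -- The image of `ψ` is closed, so off it a whole neighbourhood carries no matching condition and
  -- the free component can be zero.
  · have hU : IsOpen {w : RestrictedBundle B m | ψ w.time ≠ w} :=
      isOpen_ne_fun (hψ.1.continuous.comp RestrictedBundle.contMDiff_time.continuous) continuous_id
    refine ⟨e.source ∩ {w | ψ w.time ≠ w}, (e.open_source.inter hU).mem_nhds ⟨hc, hw₀⟩,
      chartField e (coordField ℓ 0), ?_, fun w hw => ?_⟩
    · refine (contMDiffOn_chartField w₀ c (hTo.preimage continuous_fst)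
        (F := coordField ℓ 0) ?_).mono fun w hw => ⟨hw.1, e.map_source hw.1⟩
      exact (contDiffOn_coordField hTo hℓ (a := 0) (J := univ) contDiffOn_const).mono
        fun x hx => ⟨hx, trivial⟩
    · have hwc : w.jet.base ∈ c.chart.source := hw.1
      exact ⟨isHolonomicVector_of_coordField hwc (hda 0 w hwc),
        unifiedTwoForm_eq_zero_of_coordField hL w₀ hwc (hda 0 w hwc), fun h' => (hw.2 h').elim⟩

include hL hψ in
-- The field is glued from those of `exists_local_field`. The vectors `ψ'` themselves are solutions
-- with `dt = 1`, which puts `ψ` in `W_1`.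
theorem exists_semispray (hhol : IsHolonomic ψ)
    (h : ∀ t, ∀ v, unifiedTwoForm L (ψ t) (velocity ψ t) v = 0) :
    ∃ X : VectorFieldOn B m, IsSmoothField X ∧ (∀ w, timeForm w (X w) = 1) ∧ IsSemispray X ∧
      IsMIntegralCurve ψ X ∧ (∀ t, ψ t ∈ compatibilitySet L) ∧
      ∀ w ∈ compatibilitySet L, ∀ v, unifiedTwoForm L w (X w) v = 0 := by
  obtain ⟨X, hX, hXS⟩ := exists_isSmoothField_forall_mem (B := B) (m := m)
    (fun w => {u | IsHolonomicVector w u ∧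
        (w ∈ compatibilitySet L → ∀ v, unifiedTwoForm L w u v = 0) ∧
        (ψ w.time = w → (show RestrictedModel n m from u) = velocity ψ w.time)})
    (fun w u hu u' hu' a b ha hb hab =>
      ⟨isHolonomicVector_convex w hu.1 hu'.1 ha hb hab, fun hw =>
        unifiedTwoForm_convex L w (hu.2.1 hw) (hu'.2.1 hw) ha hb hab, fun hw => by
          change a • (show RestrictedModel n m from u) + b • (show RestrictedModel n m from u') = _
          rw [hu.2.2 hw, hu'.2.2 hw]
          exact Convex.combo_self hab _⟩)
    (exists_local_field hL hψ hhol h)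
  refine ⟨X, hX, fun w => (hXS w).1.1, isSemispray_of_isHolonomicVector hX fun w => (hXS w).1,
    (isMIntegralCurve_iff_velocity hψ.1).2 fun t => ?_, fun t => ⟨velocity ψ t, ?_, h t⟩,
    fun w hw => (hXS w).2.1 hw⟩
  · have h1 := (hXS (ψ t)).2.2 (by rw [hψ.2])
    have h2 : ∀ s, s = t → (show RestrictedModel n m from velocity ψ s) = velocity ψ t := by
      rintro _ rfl
      rfl
    exact (h1.trans (h2 _ (hψ.2 t))).symm
  · rw [(isHolonomicVector_velocity ((hψ.1.contMDiffAt (x := t)).mdifferentiableAt (by simp))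
      (Eventually.of_forall hhol)).1]
    exact one_ne_zero

include hL hψ in
-- The substance is the passage from the second entry to the fourth. The third returns to the second
-- because `ψ` is itself an integral section of the semispray, hence holonomic with `ψ' = X ∘ ψ`.
theorem tfae_solutions :
    List.TFAE [
      IsHolonomic ψ ∧ ∀ Y : VectorFieldOn B m, IsSmoothField Y →
        ∀ t, unifiedTwoForm L (ψ t) (Y (ψ t)) (velocity ψ t) = 0,
      IsHolonomic ψ ∧ ∀ t, ∀ v, unifiedTwoForm L (ψ t) (velocity ψ t) v = 0,
      ∃ X : VectorFieldOn B m, IsSmoothField X ∧ IsTransverse X ∧ IsSemispray X ∧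
        IsMIntegralCurve ψ X ∧ ∀ t, ∀ v, unifiedTwoForm L (ψ t) (X (ψ t)) v = 0,
      ∃ X : VectorFieldOn B m, IsSmoothField X ∧ (∀ w, timeForm w (X w) = 1) ∧ IsSemispray X ∧
        IsMIntegralCurve ψ X ∧ (∀ t, ψ t ∈ compatibilitySet L) ∧
        ∀ w ∈ compatibilitySet L, ∀ v, unifiedTwoForm L w (X w) v = 0] := by
  tfae_have 1 → 2 := fun h => ⟨h.1, fun t v => by
    obtain ⟨Y, hY, rfl⟩ := exists_isSmoothField_eq (ψ t) v
    rw [unifiedTwoForm_swap, h.2 Y hY, neg_zero]⟩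
  tfae_have 2 → 1 := fun h => ⟨h.1, fun Y _ t => by rw [unifiedTwoForm_swap, h.2, neg_zero]⟩
  tfae_have 2 → 4 := fun h => exists_semispray hL hψ h.1 h.2
  tfae_have 4 → 3 := fun ⟨X, h1, h2, h3, h4, h5, h6⟩ =>
    ⟨X, h1, fun w => by rw [h2]; exact one_ne_zero, h3, h4, fun t => h6 _ (h5 t)⟩
  tfae_have 3 → 2 := fun ⟨X, h1, h2, h3, h4, h5⟩ => by
    refine ⟨fun t => h3 ψ univ isOpen_univ (fun s _ => hψ.2 s) (h4.isMIntegralCurveOn _) t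
      (mem_univ t), fun t => ?_⟩
    rw [(isMIntegralCurve_iff_velocity hψ.1).1 h4]
    exact h5 t
  tfae_finish

end Global

end SkinnerRusk

namespace SkinnerRusk

/-! ### Differentiation of the integral of a 1-form along a family of curves -/

section Calculus

variable {F : ℝ × ℝ → ℝ × ℝ →L[ℝ] ℝ} {ε T : ℝ}

/-- The first variation of the integral of a 1-form on a family of curves that is constant near the
ends. -/
theorem hasDerivAt_integral_form (hε : 0 < ε) (hT : 0 < T)
    (hF : ContDiffOn ℝ ∞ F (Ioo (-ε) ε ×ˢ univ))
    (hout : ∀ s ∈ Ioo (-ε) ε, ∀ t, T ≤ |t| → F (s, t) (0, 1) = F (0, t) (0, 1))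
    (hend : ∀ t, T ≤ |t| → F (0, t) (1, 0) = 0)
    (hint : Integrable fun t => F (0, t) (0, 1)) :
    HasDerivAt (fun s => ∫ t, F (s, t) (0, 1))
      (∫ t in (-T)..T, flatExteriorDerivative F (0, t) (1, 0) (0, 1)) 0 := by
  have hO : IsOpen (Ioo (-ε) ε ×ˢ (univ : Set ℝ)) := isOpen_Ioo.prod isOpen_univ
  have hd : ∀ s ∈ Ioo (-ε) ε, ∀ t, HasFDerivAt F (fderiv ℝ F (s, t)) (s, t) := fun s hs t =>
    ((hF.contDiffAt (hO.mem_nhds ⟨hs, trivial⟩)).differentiableAt (by simp)).hasFDerivAt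
  have hDc : ContinuousOn (fderiv ℝ F) (Ioo (-ε) ε ×ˢ univ) :=
    hF.continuousOn_fderiv_of_isOpen hO (by simp)
  have h0 : (0 : ℝ) ∈ Ioo (-ε) ε := ⟨by linarith, hε⟩
  have hs : ∀ s ∈ Ioo (-ε) ε, ∀ t a, HasDerivAt (fun s => F (s, t) a)
      (fderiv ℝ F (s, t) (1, 0) a) s := by
    intro s hs t a
    have h1 : HasDerivAt (fun s : ℝ => ((s, t) : ℝ × ℝ)) (1, 0) s :=
      (hasDerivAt_id s).prodMk (hasDerivAt_const s t)
    have h2 := (hd s hs t).comp_hasDerivAt s h1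
    simpa using h2.clm_apply (hasDerivAt_const s a)
  have ht : ∀ s ∈ Ioo (-ε) ε, ∀ t a, HasDerivAt (fun t => F (s, t) a)
      (fderiv ℝ F (s, t) (0, 1) a) t := by
    intro s hs t a
    have h1 : HasDerivAt (fun t : ℝ => ((s, t) : ℝ × ℝ)) (0, 1) t :=
      (hasDerivAt_const t s).prodMk (hasDerivAt_id t)
    have h2 := (hd s hs t).comp_hasDerivAt t h1
    simpa using h2.clm_apply (hasDerivAt_const t a)
  have hc : ∀ s ∈ Ioo (-ε) ε, ∀ a, Continuous fun t => F (s, t) a := fun s hs a =>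
    continuous_iff_continuousAt.2 fun t => (ht s hs t a).continuousAt
  have hcD : ∀ a b, Continuous fun t => fderiv ℝ F (0, t) a b := by
    intro a b
    have h1 : Continuous fun t : ℝ => fderiv ℝ F (0, t) :=
      continuousOn_univ.1 (hDc.comp (by fun_prop) fun t _ => ⟨h0, trivial⟩)
    exact (h1.clm_apply continuous_const).clm_apply continuous_const
  -- the integral over the line reduces to an interval
  have hsplit : ∀ s ∈ Ioo (-ε) ε, ∫ t, F (s, t) (0, 1) =
      (∫ t, F (0, t) (0, 1)) + ∫ t in (-T)..T, (F (s, t) (0, 1) - F (0, t) (0, 1)) := by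
    intro s hs
    have hcs : Continuous fun t => F (s, t) (0, 1) - F (0, t) (0, 1) := (hc s hs _).sub (hc 0 h0 _)
    have hsupp : Function.support (fun t => F (s, t) (0, 1) - F (0, t) (0, 1)) ⊆ Ioc (-T) T := by
      intro t ht
      by_contra hn
      refine ht (sub_eq_zero.2 (hout s hs t ?_))
      by_contra hlt
      obtain ⟨h1, h2⟩ := abs_lt.1 (not_le.1 hlt)
      exact hn ⟨h1, h2.le⟩
    have hi : Integrable fun t => F (s, t) (0, 1) - F (0, t) (0, 1) := by
      refine hcs.integrable_of_hasCompactSupport ?_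
      exact HasCompactSupport.of_support_subset_isCompact isCompact_Icc
        (hsupp.trans Ioc_subset_Icc_self)
    rw [intervalIntegral.integral_eq_integral_of_support_subset hsupp, ← integral_add hint hi]
    exact integral_congr_ae (Eventually.of_forall fun t => by simp)
  -- Halving `ε` leaves a compact rectangle inside the domain, on which the `s`-derivative is
  -- bounded; the bound is the dominating function below.
  obtain ⟨C, hC⟩ : ∃ C, ∀ z ∈ Icc (-(ε / 2)) (ε / 2) ×ˢ Icc (-T) T,
      ‖fderiv ℝ F z (1, 0) (0, 1)‖ ≤ C := by
    refine (isCompact_Icc.prod isCompact_Icc).exists_bound_of_continuousOn ?_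
    refine ((hDc.mono ?_).clm_apply continuousOn_const).clm_apply continuousOn_const
    rintro ⟨s, t⟩ ⟨hs, -⟩
    exact ⟨⟨by linarith [hs.1], by linarith [hs.2]⟩, trivial⟩
  have hball : ∀ s ∈ Metric.ball (0 : ℝ) (ε / 2), s ∈ Ioo (-ε) ε ∧ s ∈ Icc (-(ε / 2)) (ε / 2) := by
    intro s hs
    rw [Metric.mem_ball, dist_zero_right, Real.norm_eq_abs, abs_lt] at hs
    exact ⟨⟨by linarith, by linarith⟩, ⟨hs.1.le, hs.2.le⟩⟩
  have hII : uIoc (-T) T ⊆ Icc (-T) T := by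
    rw [uIoc_of_le (by linarith)]
    exact Ioc_subset_Icc_self
  -- Differentiation under the integral sign, applied to the difference with the curve at `s = 0`;
  -- that subtracted term is constant in `s`.
  have key := intervalIntegral.hasDerivAt_integral_of_dominated_loc_of_deriv_le
    (F := fun s t => F (s, t) (0, 1) - F (0, t) (0, 1)) (x₀ := (0 : ℝ))
    (F' := fun s t => fderiv ℝ F (s, t) (1, 0) (0, 1)) (a := -T) (b := T) (μ := volume)
    (bound := fun _ => C) (Metric.ball_mem_nhds 0 (half_pos hε))
    (by
      filter_upwards [Metric.ball_mem_nhds (0 : ℝ) (half_pos hε)] with s hs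
      exact ((hc s (hball s hs).1 _).sub (hc 0 h0 _)).aestronglyMeasurable)
    (by simp)
    (hcD _ _).aestronglyMeasurable
    (Eventually.of_forall fun t ht s hs => hC _ ⟨(hball s hs).2, hII ht⟩)
    (by simp)
    (Eventually.of_forall fun t _ s hs' => (hs s (hball s hs').1 t _).sub_const _)
  -- The other half of the exterior derivative is the `t`-derivative of `F (0, t) (1, 0)`, so it
  -- integrates to boundary values, which vanish at `±T`.
  have h1 : ∫ t in (-T)..T, flatExteriorDerivative F (0, t) (1, 0) (0, 1) =
      ∫ t in (-T)..T, fderiv ℝ F (0, t) (1, 0) (0, 1) := by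
    have h2 : ∫ t in (-T)..T, fderiv ℝ F (0, t) (0, 1) (1, 0) = 0 := by
      rw [intervalIntegral.integral_eq_sub_of_hasDerivAt (fun t _ => ht 0 h0 t _)
        ((hcD _ _).intervalIntegrable _ _), hend T (le_abs_self T),
        hend (-T) (by rw [abs_neg]; exact le_abs_self T), sub_zero]
    simp only [flatExteriorDerivative]
    rw [intervalIntegral.integral_sub ((hcD _ _).intervalIntegrable _ _)
      ((hcD _ _).intervalIntegrable _ _), h2, sub_zero]
  rw [h1]
  refine (key.2.const_add (∫ t, F (0, t) (0, 1))).congr_of_eventuallyEq ?_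
  filter_upwards [Metric.ball_mem_nhds (0 : ℝ) (half_pos hε)] with s hs
  exact hsplit s (hball s hs).1

end Calculus

variable {n : ℕ} {B : ConfigurationBundle.{u, v} n} {m : ℕ}

/-! ### The first variation of the functional -/

section Variation

variable {L : Jet B (m + 1) → ℝ} {ψ : ℝ → RestrictedBundle B m} {Z : VectorFieldOn B m} {ε : ℝ}
  {σ : ℝ → RestrictedBundle B m → RestrictedBundle B m}

theorem mfderiv_comp_curve {P H M : Type*} [NormedAddCommGroup P] [NormedSpace ℝ P]
    [NormedAddCommGroup H] [NormedSpace ℝ H] [TopologicalSpace M] [ChartedSpace H M]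
    {Φ : P → M} {γ : ℝ → P} {t : ℝ} {a : P}
    (hΦ : MDifferentiableAt 𝓘(ℝ, P) 𝓘(ℝ, H) Φ (γ t)) (hγ : HasDerivAt γ a t) :
    (show H from mfderiv 𝓘(ℝ, ℝ) 𝓘(ℝ, H) (fun s => Φ (γ s)) t (1 : ℝ)) =
      mfderiv 𝓘(ℝ, P) 𝓘(ℝ, H) Φ (γ t) a := by
  have h1 := (hΦ.hasMFDerivAt.comp t hγ.hasFDerivAt.hasMFDerivAt).mfderiv
  refine (congrArg (fun A : ℝ →L[ℝ] H => A 1) h1).trans ?_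
  exact congrArg (mfderiv 𝓘(ℝ, P) 𝓘(ℝ, H) Φ (γ t) : P →L[ℝ] H) (one_smul ℝ a)

theorem pullbackOneForm_congr {γ γ' : ℝ → RestrictedBundle B m} {t : ℝ} (h : γ =ᶠ[𝓝 t] γ') :
    pullbackOneForm L γ t = pullbackOneForm L γ' t := by
  have h1 : (show RestrictedModel n m →L[ℝ] ℝ from unifiedOneForm L (γ t)) =
      unifiedOneForm L (γ' t) := by rw [h.self_of_nhds]
  have h2 : (show ℝ →L[ℝ] RestrictedModel n m from
      mfderiv 𝓘(ℝ, ℝ) 𝓘(ℝ, RestrictedModel n m) γ t) =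
      mfderiv 𝓘(ℝ, ℝ) 𝓘(ℝ, RestrictedModel n m) γ' t := h.mfderiv_eq
  exact congrArg₂ (fun (A : RestrictedModel n m →L[ℝ] ℝ) (D : ℝ →L[ℝ] RestrictedModel n m) =>
    A (D 1)) h1 h2

/-- At a zero of `Z` the constant curve is an integral curve, and integral curves are unique. -/
theorem IsLocalFlow.eq_self (hσ : IsLocalFlow Z ε σ) (hZ : IsSmoothField Z)
    {w : RestrictedBundle B m} (hw : Z w = 0) {s : ℝ} (hs : s ∈ Ioo (-ε) ε) : σ s w = w := by
  have : IsManifold 𝓘(ℝ, RestrictedModel n m) 1 (RestrictedBundle B m) :=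
    .of_le (n := ∞) (WithTop.coe_le_coe.2 le_top)
  have h0 : (0 : ℝ) ∈ Ioo (-ε) ε := ⟨neg_lt_zero.2 hσ.pos, hσ.pos⟩
  have hc : IsMIntegralCurveOn (fun _ => w) Z (Ioo (-ε) ε) := by
    intro s _
    refine (hasMFDerivAt_const w s).hasMFDerivWithinAt.congr_mfderiv
      (ContinuousLinearMap.ext_ring ?_)
    rw [hw]
    exact (smul_zero (1 : ℝ)).symm
  exact isMIntegralCurveOn_Ioo_eqOn_of_contMDiff_boundaryless h0
    (hZ.of_le (WithTop.coe_le_coe.2 le_top)) (hσ.integral w) hc (hσ.zero w) hs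

/-- The first variation formula. -/
theorem exists_hasDerivAt_functionalLH
    (hL : ContMDiff 𝓘(ℝ, JetModel n (m + 1)) 𝓘(ℝ, ℝ) ∞ L) (hψ : IsGlobalSection ψ)
    (hint : Integrable (pullbackOneForm L ψ)) (hZ : IsSmoothField Z)
    (hK : IsCompact (closure {w | Z w ≠ 0})) (hσ : IsLocalFlow Z ε σ) :
    ∃ T > 0, (∀ t, T ≤ |t| → Z (ψ t) = 0) ∧
      Continuous (fun t => unifiedTwoForm L (ψ t) (Z (ψ t)) (velocity ψ t)) ∧
      HasDerivAt (fun s => functionalLH L (σ s ∘ ψ))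
        (∫ t in (-T)..T, -unifiedTwoForm L (ψ t) (Z (ψ t)) (velocity ψ t)) 0 := by
  set K := closure {w | Z w ≠ 0}
  have hKZ : ∀ w ∉ K, Z w = 0 := fun w hw => by
    by_contra h
    exact hw (subset_closure h)
  obtain ⟨C, hC⟩ := hK.exists_bound_of_continuousOn
    (RestrictedBundle.contMDiff_time (B := B) (m := m)).continuous.continuousOn
  -- Times are bounded by `C` on `K`, and `ψ t` has time `t`, so `ψ t` is outside `K` once `|t| ≥
  -- T`.
  let T := |C| + 1
  have hT : 0 < T := by positivity
  have hTK : ∀ t, T ≤ |t| → ψ t ∉ K := by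
    intro t ht hw
    have h1 := hC _ hw
    rw [hψ.2, Real.norm_eq_abs] at h1
    have h2 := le_abs_self C
    simp only [T] at ht
    linarith
  have h0 : (0 : ℝ) ∈ Ioo (-ε) ε := ⟨neg_lt_zero.2 hσ.pos, hσ.pos⟩
  have hO : IsOpen (Ioo (-ε) ε ×ˢ (univ : Set (RestrictedBundle B m))) :=
    isOpen_Ioo.prod isOpen_univ
  have hO' : IsOpen (Ioo (-ε) ε ×ˢ (univ : Set ℝ)) := isOpen_Ioo.prod isOpen_univ
  -- Pulling `Θ_r` back along this two-parameter family reduces everything to a form on the plane: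
  -- `∂_t` goes to the velocity of `σ s ∘ ψ`, and at `s = 0` the vector `∂_s` goes to `Z`.
  let Φ : ℝ × ℝ → RestrictedBundle B m := fun z => σ z.1 (ψ z.2)
  have hΦ : ∀ z ∈ Ioo (-ε) ε ×ˢ (univ : Set ℝ),
      ContMDiffAt 𝓘(ℝ, ℝ × ℝ) 𝓘(ℝ, RestrictedModel n m) ∞ Φ z := by
    intro z hz
    have h1 : ContMDiffAt (𝓘(ℝ, ℝ).prod 𝓘(ℝ, RestrictedModel n m)) 𝓘(ℝ, RestrictedModel n m) ∞
        (fun x : ℝ × RestrictedBundle B m => σ x.1 x.2) (z.1, ψ z.2) :=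
      hσ.smooth.contMDiffAt (hO.mem_nhds ⟨hz.1, trivial⟩)
    have h2 : ContMDiffAt 𝓘(ℝ, ℝ × ℝ) (𝓘(ℝ, ℝ).prod 𝓘(ℝ, RestrictedModel n m)) ∞
        (fun z : ℝ × ℝ => (z.1, ψ z.2)) z :=
      (contDiff_fst.contMDiff.contMDiffAt).prodMk
        ((hψ.1.comp contDiff_snd.contMDiff).contMDiffAt)
    exact h1.comp z h2
  have hΦd : ∀ z ∈ Ioo (-ε) ε ×ˢ (univ : Set ℝ),
      MDifferentiableAt 𝓘(ℝ, ℝ × ℝ) 𝓘(ℝ, RestrictedModel n m) Φ z :=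
    fun z hz => (hΦ z hz).mdifferentiableAt (by simp)
  let F : ℝ × ℝ → ℝ × ℝ →L[ℝ] ℝ := pullbackForm (unifiedOneForm L) Φ
  have hex : ∀ z, ∃ e Θ, IsExpression (unifiedOneForm L) e Θ ∧ Φ z ∈ e.source := by
    intro z
    obtain ⟨c, hc⟩ := exists_adaptedChart (Φ z).jet.base
    exact ⟨_, _, isExpression_unifiedOneForm hL (Φ z) c, hc⟩
  have hF : ContDiffOn ℝ ∞ F (Ioo (-ε) ε ×ˢ univ) := by
    intro z hz
    obtain ⟨e, Θ, he, hs⟩ := hex z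
    exact (he.contDiffAt_pullbackForm (hΦ z hz) hs).contDiffWithinAt
  have ht : ∀ s ∈ Ioo (-ε) ε, ∀ t, (show RestrictedModel n m from velocity (σ s ∘ ψ) t) =
      mfderiv 𝓘(ℝ, ℝ × ℝ) 𝓘(ℝ, RestrictedModel n m) Φ (s, t) ((0, 1) : ℝ × ℝ) :=
    fun s hs t => mfderiv_comp_curve (γ := fun t => (s, t)) (hΦd (s, t) ⟨hs, trivial⟩)
      ((hasDerivAt_const t s).prodMk (hasDerivAt_id t))
  have hs : ∀ t, (show RestrictedModel n m from Z ((σ 0 ∘ ψ) t)) =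
      mfderiv 𝓘(ℝ, ℝ × ℝ) 𝓘(ℝ, RestrictedModel n m) Φ (0, t) ((1, 0) : ℝ × ℝ) := by
    intro t
    have h1 := (hσ.integral (ψ t) 0 h0).hasMFDerivAt (Ioo_mem_nhds h0.1 h0.2)
    have h2 := mfderiv_comp_curve (Φ := Φ) (γ := fun s => (s, t)) (hΦd (0, t) ⟨h0, trivial⟩)
      ((hasDerivAt_id (0 : ℝ)).prodMk (hasDerivAt_const (0 : ℝ) t))
    refine Eq.trans ?_ h2
    refine Eq.trans ?_ (congrArg (fun A : ℝ →L[ℝ] RestrictedModel n m => A 1) h1.mfderiv.symm)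
    exact (one_smul ℝ (show RestrictedModel n m from Z ((σ 0 ∘ ψ) t))).symm
  have hσ0 : σ 0 ∘ ψ = ψ := funext fun t => hσ.zero _
  have hFt : ∀ s ∈ Ioo (-ε) ε, ∀ t, F (s, t) (0, 1) = pullbackOneForm L (σ s ∘ ψ) t :=
    fun s hs' t => congrArg (show RestrictedModel n m →L[ℝ] ℝ from
      unifiedOneForm L (Φ (s, t))) (ht s hs' t).symm
  have hFs : ∀ t, F (0, t) (1, 0) = unifiedOneForm L (ψ t) (Z (ψ t)) := by
    intro t
    have h1 : F (0, t) (1, 0) = unifiedOneForm L ((σ 0 ∘ ψ) t) (Z ((σ 0 ∘ ψ) t)) :=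
      congrArg (show RestrictedModel n m →L[ℝ] ℝ from unifiedOneForm L (Φ (0, t))) (hs t).symm
    rwa [hσ0] at h1
  have hflat : ∀ t, flatExteriorDerivative F (0, t) (1, 0) (0, 1) =
      -unifiedTwoForm L (ψ t) (Z (ψ t)) (velocity ψ t) := by
    intro t
    obtain ⟨e, Θ, he, hes⟩ := hex (0, t)
    have h1 := he.flatExteriorDerivative_pullbackForm_eq (hΦ (0, t) ⟨h0, trivial⟩) hes
      (1, 0) (0, 1)
    have h2 : exteriorDerivative (unifiedOneForm L) ((σ 0 ∘ ψ) t) (Z ((σ 0 ∘ ψ) t))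
        (velocity (σ 0 ∘ ψ) t) = flatExteriorDerivative F (0, t) (1, 0) (0, 1) := by
      refine Eq.trans ?_ h1.symm
      exact congrArg₂ (fun a b : RestrictedModel n m =>
        exteriorDerivative (unifiedOneForm L) (Φ (0, t)) a b) (hs t) (ht 0 h0 t)
    rw [hσ0] at h2
    rw [← h2, unifiedTwoForm, neg_neg]
  have hKc : IsClosed K := isClosed_closure
  -- For `|t| ≥ T` the curve stays outside the closed set `K` at all times near `t`, so there the
  -- flow fixes it as a germ and the integrand, which involves a velocity, does not change.
  have key := hasDerivAt_integral_form hσ.pos hT hF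
    (fun s hs' t htT => by
      rw [hFt s hs', hFt 0 h0]
      refine pullbackOneForm_congr ?_
      filter_upwards [hψ.1.continuous.continuousAt.eventually
        (hKc.isOpen_compl.mem_nhds (hTK t htT))] with t' ht'
      exact (hσ.eq_self hZ (hKZ _ ht') hs').trans (hσ.zero _).symm)
    (fun t htT => by rw [hFs, hKZ _ (hTK t htT), map_zero])
    (by
      refine hint.congr (Eventually.of_forall fun t => ?_)
      simp only [hFt 0 h0, hσ0])
  refine ⟨T, hT, fun t htT => hKZ _ (hTK t htT), ?_, ?_⟩
  · have h1 : ContinuousOn (fderiv ℝ F) (Ioo (-ε) ε ×ˢ univ) :=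
      hF.continuousOn_fderiv_of_isOpen hO' (by simp)
    have h2 : Continuous fun t : ℝ => fderiv ℝ F (0, t) :=
      continuousOn_univ.1 (h1.comp (by fun_prop) fun t _ => ⟨h0, trivial⟩)
    have h3 : Continuous fun t => flatExteriorDerivative F (0, t) (1, 0) (0, 1) :=
      ((h2.clm_apply continuous_const).clm_apply continuous_const).sub
        ((h2.clm_apply continuous_const).clm_apply continuous_const)
    refine h3.neg.congr fun t => ?_
    exact (congrArg Neg.neg (hflat t)).trans (neg_neg _)
  · simp only [hflat] at key
    refine key.congr_of_eventuallyEq ?_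
    filter_upwards [Ioo_mem_nhds h0.1 h0.2] with s hs'
    exact integral_congr_ae (Eventually.of_forall fun t => (hFt s hs' t).symm)

theorem isVariationalSolution_of_forall_eq_zero
    (hL : ContMDiff 𝓘(ℝ, JetModel n (m + 1)) 𝓘(ℝ, ℝ) ∞ L) (hψ : IsGlobalSection ψ)
    (hint : Integrable (pullbackOneForm L ψ)) (hhol : IsHolonomic ψ)
    (h : ∀ Y : VectorFieldOn B m, IsSmoothField Y →
      ∀ t, unifiedTwoForm L (ψ t) (Y (ψ t)) (velocity ψ t) = 0) : IsVariationalSolution L ψ := by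
  refine ⟨hhol, fun Z hZ _ hK ε σ hσ => ?_⟩
  obtain ⟨T, -, -, -, hd⟩ := exists_hasDerivAt_functionalLH hL hψ hint hZ hK hσ
  simpa [h Z hZ] using hd

end Variation

end SkinnerRusk

namespace SkinnerRusk

/-! ### Bump functions invariant under a rotation, and explicit flows -/

section Rotation

/-- The rotation of angle `θ` generated by an operator `A` with `A ^ 3 = -A`. -/
noncomputable def rotation {H : Type*} [NormedAddCommGroup H] [NormedSpace ℝ H] (A : H →L[ℝ] H)
    (θ : ℝ) (y : H) : H :=
  y + Real.sin θ • A y + (1 - Real.cos θ) • A (A y)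

open scoped InnerProductSpace in
-- `A` generates the rotations of a plane in the kernel of `τ` that contains `v`. The centre lies
-- beside `x₀` in that plane, so that the rotation moves `x₀` in the direction `v`. The bump depends
-- only on the distance to the centre and on `τ`, both preserved by the rotation. The operator, the
-- centre and `a` come before `η`, because in the application `η` depends on them.
theorem exists_rotation_bump_of_inner {E : Type*} [NormedAddCommGroup E] [InnerProductSpace ℝ E]
    [FiniteDimensional ℝ E] (hE : 3 ≤ Module.finrank ℝ E) (τ : E →L[ℝ] ℝ) {v : E} (hv : v ≠ 0)
    (hτ : τ v = 0) {U : Set E} (hU : IsOpen U) {x₀ : E} (hx : x₀ ∈ U) :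
    ∃ (A : E →L[ℝ] E) (c : E) (a : ℝ), 0 < a ∧ A (x₀ - c) = a • v ∧
      (∀ y, A (A (A y)) = -A y) ∧ (∀ y, τ (A y) = 0) ∧ ∀ η > 0, ∃ (ρ : E → ℝ) (K : Set E),
        ContDiff ℝ ∞ ρ ∧ IsCompact K ∧ K ⊆ U ∧ (∀ x ∉ K, ρ x = 0) ∧ (∀ x, 0 ≤ ρ x) ∧ 0 < ρ x₀ ∧
        (∀ x, ρ x ≠ 0 → |τ x - τ x₀| < η) ∧ ∀ θ x, ρ (c + rotation A θ (x - c)) = ρ x := by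
  -- Two linear conditions have a nonzero common solution in dimension at least three.
  obtain ⟨e₁, he₁, hve, hτe⟩ : ∃ e : E, ‖e‖ = 1 ∧ ⟪v, e⟫_ℝ = 0 ∧ τ e = 0 := by
    let f : E →ₗ[ℝ] ℝ × ℝ := ((innerSL ℝ v).prod τ : E →L[ℝ] ℝ × ℝ)
    have hf : f.ker ≠ ⊥ := LinearMap.ker_ne_bot_of_finrank_lt (by
      rw [Module.finrank_prod, Module.finrank_self]; omega)
    obtain ⟨x, hx, hx0⟩ := f.ker.ne_bot_iff.1 hf
    have h1 : ⟪v, x⟫_ℝ = 0 := congrArg Prod.fst (LinearMap.mem_ker.1 hx)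
    have h2 : τ x = 0 := congrArg Prod.snd (LinearMap.mem_ker.1 hx)
    refine ⟨‖x‖⁻¹ • x, ?_, ?_, ?_⟩
    · rw [norm_smul, norm_inv, norm_norm, inv_mul_cancel₀ (norm_ne_zero_iff.2 hx0)]
    · rw [inner_smul_right, h1, mul_zero]
    · rw [map_smul, h2, smul_zero]
  have hv' : ‖v‖ ≠ 0 := norm_ne_zero_iff.2 hv
  set e₂ : E := ‖v‖⁻¹ • v with he₂def
  have h11 : ⟪e₁, e₁⟫_ℝ = 1 := by rw [real_inner_self_eq_norm_sq, he₁, one_pow]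
  have h22 : ⟪e₂, e₂⟫_ℝ = 1 := by
    rw [real_inner_self_eq_norm_sq, he₂def, norm_smul, norm_inv, norm_norm, inv_mul_cancel₀ hv',
      one_pow]
  have h21 : ⟪e₂, e₁⟫_ℝ = 0 := by rw [he₂def, real_inner_smul_left, hve, mul_zero]
  have h12 : ⟪e₁, e₂⟫_ℝ = 0 := by rw [real_inner_comm, h21]
  have hτe₂ : τ e₂ = 0 := by rw [he₂def, map_smul, hτ, smul_zero]
  -- The quarter turn `e₁ ↦ e₂ ↦ -e₁`, zero on the orthogonal complement of the plane.
  let A : E →L[ℝ] E := (innerSL ℝ e₁).smulRight e₂ - (innerSL ℝ e₂).smulRight e₁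
  have hA : ∀ y, A y = ⟪e₁, y⟫_ℝ • e₂ - ⟪e₂, y⟫_ℝ • e₁ := fun y => rfl
  have hAA : ∀ y, A (A y) = -(⟪e₁, y⟫_ℝ • e₁ + ⟪e₂, y⟫_ℝ • e₂) := by
    intro y
    rw [hA (A y), hA y]
    simp only [inner_sub_right, inner_smul_right, h11, h22, h12, h21]
    module
  have hrot : ∀ θ y, ‖rotation A θ y‖ = ‖y‖ := by
    intro θ y
    have h : ⟪rotation A θ y, rotation A θ y⟫_ℝ = ⟪y, y⟫_ℝ := by
      rw [rotation, hAA, hA]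
      simp only [inner_add_left, inner_add_right, inner_sub_left, inner_sub_right, inner_neg_left,
        inner_neg_right, real_inner_smul_left, inner_smul_right, h11, h22, h12, h21,
        real_inner_comm y e₁, real_inner_comm y e₂]
      linear_combination (⟪y, e₁⟫_ℝ ^ 2 + ⟪y, e₂⟫_ℝ ^ 2) * Real.sin_sq_add_cos_sq θ
    rw [real_inner_self_eq_norm_sq, real_inner_self_eq_norm_sq] at h
    exact (sq_eq_sq₀ (norm_nonneg _) (norm_nonneg _)).1 h
  have hτA : ∀ y, τ (A y) = 0 := fun y => by
    rw [hA, map_sub, map_smul _ _ e₂, map_smul _ _ e₁, hτe, hτe₂, smul_zero, smul_zero, sub_zero]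
  obtain ⟨δ, hδ, hball⟩ : ∃ δ > 0, Metric.closedBall x₀ (4 * δ) ⊆ U := by
    obtain ⟨r, hr, h⟩ := Metric.nhds_basis_closedBall.mem_iff.1 (hU.mem_nhds hx)
    exact ⟨r / 4, by positivity, by convert h using 2; ring⟩
  refine ⟨A, x₀ - δ • e₁, δ * ‖v‖⁻¹, by positivity, ?_, ?_, hτA, fun η hη => ?_⟩
  · rw [sub_sub_cancel, hA, inner_smul_right, inner_smul_right, h11, h21, he₂def]
    module
  · intro y
    rw [hAA (A y), hA y]
    simp only [inner_sub_right, inner_smul_right, h11, h22, h12, h21]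
    module
  generalize hc : x₀ - δ • e₁ = c
  -- The cutoff acts on the squared distance to `c`, a smooth function. It vanishes beyond distance
  -- `3δ` and is positive at `x₀`, at distance `δ`; the ball of radius `3δ` around `c` lies in the
  -- one of radius `4δ` around `x₀`.
  let f : ContDiffBump (0 : ℝ) := ⟨4 * δ ^ 2, 9 * δ ^ 2, by positivity, by nlinarith⟩
  let g : ContDiffBump (τ x₀) := ⟨η / 2, η, by positivity, by linarith⟩
  have hcx : dist c x₀ = δ := by
    rw [← hc, dist_eq_norm, sub_sub_cancel_left, norm_neg, norm_smul, he₁, mul_one, Real.norm_eq_abs,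
      abs_of_pos hδ]
  refine ⟨fun x => f (‖x - c‖ ^ 2) * g (τ x), Metric.closedBall c (3 * δ), ?_,
    isCompact_closedBall _ _, ?_, ?_, fun x => mul_nonneg f.nonneg g.nonneg, ?_, ?_, ?_⟩
  · exact (f.contDiff.comp ((contDiff_norm_sq ℝ).comp (contDiff_id.sub contDiff_const))).mul
      (g.contDiff.comp τ.contDiff)
  · refine Subset.trans (Metric.closedBall_subset_closedBall' ?_) hball
    linarith
  · intro x hx
    have hx' : 3 * δ < ‖x - c‖ := by simpa [dist_eq_norm] using hx
    have : f (‖x - c‖ ^ 2) = 0 := by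
      refine f.zero_of_le_dist ?_
      rw [dist_zero_right, Real.norm_eq_abs, abs_of_nonneg (sq_nonneg _)]
      change 9 * δ ^ 2 ≤ _
      nlinarith
    simp only [this, zero_mul]
  · refine mul_pos (f.pos_of_mem_ball ?_) (g.pos_of_mem_ball (Metric.mem_ball_self hη))
    rw [← dist_eq_norm, dist_comm, hcx, Metric.mem_ball, dist_zero_right, Real.norm_eq_abs,
      abs_of_nonneg (sq_nonneg _)]
    change δ ^ 2 < 9 * δ ^ 2
    nlinarith
  · intro x hx
    by_contra h
    refine hx ?_
    have : g (τ x) = 0 := g.zero_of_le_dist (not_lt.1 h)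
    simp only [this, mul_zero]
  · intro θ x
    have h3 : τ (c + rotation A θ (x - c)) = τ x := by
      rw [rotation, map_add, map_add, map_add, map_smul, map_smul, hτA, hτA, map_sub, smul_zero,
        smul_zero, add_zero, add_zero, add_sub_cancel]
    simp only [add_sub_cancel_left, hrot, h3]

/-- The norm of the model space need not be Euclidean. Everything in the conclusion is linear or
topological, so it can be transported from a Euclidean space of the same dimension. -/
theorem exists_rotation_bump {H : Type*} [NormedAddCommGroup H] [NormedSpace ℝ H]
    [FiniteDimensional ℝ H] (hH : 3 ≤ Module.finrank ℝ H) (τ : H →L[ℝ] ℝ) {v : H} (hv : v ≠ 0)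
    (hτ : τ v = 0) {U : Set H} (hU : IsOpen U) {x₀ : H} (hx : x₀ ∈ U) :
    ∃ (A : H →L[ℝ] H) (c : H) (a : ℝ), 0 < a ∧ A (x₀ - c) = a • v ∧
      (∀ y, A (A (A y)) = -A y) ∧ (∀ y, τ (A y) = 0) ∧ ∀ η > 0, ∃ (ρ : H → ℝ) (K : Set H),
        ContDiff ℝ ∞ ρ ∧ IsCompact K ∧ K ⊆ U ∧ (∀ x ∉ K, ρ x = 0) ∧ (∀ x, 0 ≤ ρ x) ∧ 0 < ρ x₀ ∧
        (∀ x, ρ x ≠ 0 → |τ x - τ x₀| < η) ∧ ∀ θ x, ρ (c + rotation A θ (x - c)) = ρ x := by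
  let l := toEuclidean (E := H)
  obtain ⟨A, c, a, ha, hA, hA3, hτA, h⟩ := exists_rotation_bump_of_inner
    (by rwa [finrank_euclideanSpace_fin]) (τ.comp (l.symm : _ →L[ℝ] H)) (v := l v)
    (l.map_ne_zero_iff.2 hv) (by simpa using hτ) (hU.preimage l.symm.continuous) (x₀ := l x₀)
    (by simpa using hx)
  refine ⟨(l.symm : _ →L[ℝ] H).comp (A.comp (l : H →L[ℝ] _)), l.symm c, a, ha, ?_, ?_, ?_,
    fun η hη => ?_⟩
  · have h1 : A (l (x₀ - l.symm c)) = a • l v := by rw [map_sub, l.apply_symm_apply, hA]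
    refine (congrArg l.symm h1).trans ?_
    rw [map_smul, l.symm_apply_apply]
  · intro y; simp [hA3]
  · intro y; simpa using hτA (l y)
  · obtain ⟨ρ, K, hρ, hK, hKU, hρK, hρ0, hρx, hρτ, hrot⟩ := h η hη
    refine ⟨ρ ∘ l, l.symm '' K, hρ.comp l.contDiff, hK.image l.symm.continuous, ?_, ?_,
      fun x => hρ0 _, hρx, ?_, ?_⟩
    · exact image_subset_iff.2 hKU
    · exact fun x hx => hρK _ fun h' => hx ⟨_, h', l.symm_apply_apply x⟩
    · exact fun x hx => by simpa using hρτ _ hx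
    · intro θ x
      simpa [rotation] using hrot θ (l x)

variable {H : Type*} [NormedAddCommGroup H] [NormedSpace ℝ H]

/-- The flow of the vector field `x ↦ ρ x • A (x - c)`, when `ρ` is invariant under the rotations
around `c` generated by `A`. -/
noncomputable def rotationFlow (A : H →L[ℝ] H) (c : H) (ρ : H → ℝ) (s : ℝ) (x : H) : H :=
  c + rotation A (s * ρ x) (x - c)

variable {A : H →L[ℝ] H} {c : H} {ρ : H → ℝ}

theorem rotationFlow_zero (x : H) : rotationFlow A c ρ 0 x = x := by
  simp [rotationFlow, rotation]

theorem rotationFlow_eq_self {x : H} (hx : ρ x = 0) (s : ℝ) : rotationFlow A c ρ s x = x := by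
  simp [rotationFlow, rotation, hx]

theorem contDiff_rotationFlow (hρ : ContDiff ℝ ∞ ρ) :
    ContDiff ℝ ∞ fun z : ℝ × H => rotationFlow A c ρ z.1 z.2 := by
  unfold rotationFlow rotation
  have h1 : ContDiff ℝ ∞ fun z : ℝ × H => z.1 * ρ z.2 := contDiff_fst.mul (hρ.comp contDiff_snd)
  have h2 : ContDiff ℝ ∞ fun z : ℝ × H => z.2 - c := contDiff_snd.sub contDiff_const
  exact contDiff_const.add ((h2.add ((Real.contDiff_sin.comp h1).smul (A.contDiff.comp h2))).add
    ((contDiff_const.sub (Real.contDiff_cos.comp h1)).smul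
      (A.contDiff.comp (A.contDiff.comp h2))))

/-- `ρ` is constant on the orbits, so each point turns at the constant angular speed `ρ x`; and `A ^
3 = -A` makes the derivative of the rotation in the angle equal to `A` applied to it. -/
theorem hasDerivAt_rotationFlow (hA : ∀ y, A (A (A y)) = -A y)
    (hρ : ∀ θ x, ρ (c + rotation A θ (x - c)) = ρ x) (s : ℝ) (x : H) :
    HasDerivAt (fun s => rotationFlow A c ρ s x)
      (ρ (rotationFlow A c ρ s x) • A (rotationFlow A c ρ s x - c)) s := by
  have h0 : HasDerivAt (fun s => s * ρ x) (ρ x) s := by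
    simpa using (hasDerivAt_id s).mul_const (ρ x)
  have h1 := (h0.sin.smul_const (A (x - c))).const_add (x - c)
  have h2 := ((h0.cos.const_sub 1).smul_const (A (A (x - c))))
  have h3 := (h1.add h2).const_add c
  refine h3.congr_deriv ?_
  rw [rotationFlow, hρ, add_sub_cancel_left, rotation, map_add, map_add, map_smul, map_smul, hA]
  module

end Rotation

end SkinnerRusk

namespace SkinnerRusk

/-! ### Extension of compactly supported fields and flows from a chart to the manifold -/

section Extension

variable {H M : Type*} [NormedAddCommGroup H] [TopologicalSpace M] {e : OpenPartialHomeomorph M H}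

open Classical in
/-- The maps with expressions `Ψ s` in the chart `e`, extended by the identity. -/
noncomputable def extendedFlow (e : OpenPartialHomeomorph M H) (Ψ : ℝ → H → H) (s : ℝ) (w : M) :
    M :=
  if w ∈ e.source then e.symm (Ψ s (e w)) else w

theorem extendedFlow_of_mem {Ψ : ℝ → H → H} {w : M} (hw : w ∈ e.source) (s : ℝ) :
    extendedFlow e Ψ s w = e.symm (Ψ s (e w)) := if_pos hw

theorem extendedFlow_eq_self {Ψ : ℝ → H → H} {K : Set H} (hΨK : ∀ s, ∀ x ∉ K, Ψ s x = x) {w : M}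
    (hw : w ∉ e.symm '' K) (s : ℝ) : extendedFlow e Ψ s w = w := by
  by_cases h : w ∈ e.source
  · rw [extendedFlow_of_mem h, hΨK s _ fun hK => hw ⟨_, hK, e.left_inv h⟩, e.left_inv h]
  · exact if_neg h

variable [NormedSpace ℝ H] [ChartedSpace H M]

open Classical in
/-- The vector field with expression `F` in the chart `e`, extended by zero. -/
noncomputable def extendedField (e : OpenPartialHomeomorph M H) (F : H → H) (w : M) :
    TangentSpace 𝓘(ℝ, H) w :=
  if w ∈ e.source then chartField e F w else 0

theorem extendedField_of_mem {F : H → H} {w : M} (hw : w ∈ e.source) :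
    extendedField e F w = chartField e F w := if_pos hw

variable [IsManifold 𝓘(ℝ, H) ∞ M]

theorem extendedField_eq_zero (he : e ∈ atlas H M) {F : H → H} {K : Set H}
    (hFK : ∀ x ∉ K, F x = 0) {w : M} (hw : w ∉ e.symm '' K) : extendedField e F w = 0 := by
  by_cases h : w ∈ e.source
  · rw [extendedField_of_mem h]
    refine (eq_chartField he F h ?_).symm
    rw [hFK _ fun hK => hw ⟨_, hK, e.left_inv h⟩]
    exact map_zero _
  · exact if_neg h

/-- The flow keeps the target of the chart, so a curve starting in the chart stays there and can be
checked in coordinates; outside it is constant and the field is zero. -/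
theorem isMIntegralCurve_extendedFlow (he : e ∈ atlas H M) {F : H → H} {Ψ : ℝ → H → H}
    (hΨe : ∀ s, ∀ x ∈ e.target, Ψ s x ∈ e.target)
    (hd : ∀ s x, HasDerivAt (fun s => Ψ s x) (F (Ψ s x)) s) (w : M) :
    IsMIntegralCurve (fun s => extendedFlow e Ψ s w) (extendedField e F) := by
  by_cases hw : w ∈ e.source
  · have h1 : ∀ s, extendedFlow e Ψ s w = e.symm (Ψ s (e w)) := extendedFlow_of_mem hw
    have h2 : ∀ s, Ψ s (e w) ∈ e.target := fun s => hΨe s _ (e.map_source hw)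
    have h3 : ∀ s, extendedFlow e Ψ s w ∈ e.source := fun s => by
      rw [h1]; exact e.map_target (h2 s)
    have h4 : ∀ s, e (extendedFlow e Ψ s w) = Ψ s (e w) := fun s => by
      rw [h1, e.right_inv (h2 s)]
    intro s
    refine hasMFDerivAt_of_hasDerivAt_chart_comp he ?_ (h3 s) ?_
    · simp only [h1]
      exact ContinuousAt.comp (f := fun s => Ψ s (e w)) (e.continuousAt_symm (h2 s))
        (hd s _).continuousAt
    · rw [extendedField_of_mem (h3 s), mfderiv_chartField he F (h3 s), h4]
      exact (hd s (e w)).congr_of_eventuallyEq (Eventually.of_forall h4)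
  · have h1 : (fun s => extendedFlow e Ψ s w) = fun _ => w := funext fun s => if_neg hw
    rw [h1]
    intro s
    refine (hasMFDerivAt_const w s).congr_mfderiv (ContinuousLinearMap.ext_ring ?_)
    rw [extendedField, if_neg hw]
    exact (smul_zero (1 : ℝ)).symm

variable [T2Space M]

/-- The image of `K` in `M` is compact, hence closed as `M` is Hausdorff, so the field vanishes near
every point outside the chart. -/
theorem contMDiff_extendedField [CompleteSpace H] (he : e ∈ atlas H M) {F : H → H} {K : Set H}
    (hF : ContDiff ℝ ∞ F) (hK : IsCompact K) (hKe : K ⊆ e.target) (hFK : ∀ x ∉ K, F x = 0) :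
    ContMDiff 𝓘(ℝ, H) 𝓘(ℝ, H).tangent ∞
      (fun w => (⟨w, extendedField e F w⟩ : TangentBundle 𝓘(ℝ, H) M)) := by
  have hKc : IsClosed (e.symm '' K) :=
    (hK.image_of_continuousOn (e.continuousOn_symm.mono hKe)).isClosed
  intro w
  by_cases hw : w ∈ e.source
  · refine (contMDiffAt_chartField he hw hF.contDiffAt).congr_of_eventuallyEq ?_
    filter_upwards [e.open_source.mem_nhds hw] with w' hw'
    rw [extendedField_of_mem hw']
  · have hwK : w ∉ e.symm '' K := by
      rintro ⟨x, hx, rfl⟩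
      exact hw (e.map_target (hKe hx))
    refine (Bundle.contMDiff_zeroSection ℝ (TangentSpace 𝓘(ℝ, H) (M := M))).contMDiffAt
      |>.congr_of_eventuallyEq ?_
    filter_upwards [hKc.isOpen_compl.mem_nhds hwK] with w' hw'
    rw [extendedField_eq_zero he hFK hw']
    rfl

theorem contMDiff_extendedFlow (he : e ∈ atlas H M) {Ψ : ℝ → H → H} {K : Set H}
    (hΨ : ContDiff ℝ ∞ fun z : ℝ × H => Ψ z.1 z.2) (hΨe : ∀ s, ∀ x ∈ e.target, Ψ s x ∈ e.target)
    (hK : IsCompact K) (hKe : K ⊆ e.target) (hΨK : ∀ s, ∀ x ∉ K, Ψ s x = x) :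
    ContMDiff (𝓘(ℝ, ℝ).prod 𝓘(ℝ, H)) 𝓘(ℝ, H) ∞
      (fun z : ℝ × M => extendedFlow e Ψ z.1 z.2) := by
  have hKc : IsClosed (e.symm '' K) :=
    (hK.image_of_continuousOn (e.continuousOn_symm.mono hKe)).isClosed
  intro z
  by_cases hw : z.2 ∈ e.source
  · have h1 : ContMDiffAt (𝓘(ℝ, ℝ).prod 𝓘(ℝ, H)) 𝓘(ℝ, ℝ × H) ∞
        (fun z : ℝ × M => (z.1, e z.2)) z :=
      contMDiffAt_fst.prodMk_space ((contMDiffAt_chart he hw).comp z contMDiffAt_snd)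
    have h2 := (contMDiffAt_chart_symm he (hΨe z.1 _ (e.map_source hw))).comp z
      (hΨ.contMDiff.contMDiffAt.comp z h1)
    refine h2.congr_of_eventuallyEq ?_
    filter_upwards [continuous_snd.continuousAt.eventually (e.open_source.mem_nhds hw)] with z' hz'
    exact extendedFlow_of_mem hz' _
  · have hwK : z.2 ∉ e.symm '' K := by
      rintro ⟨x, hx, hxz⟩
      exact hw (hxz ▸ e.map_target (hKe hx))
    refine contMDiffAt_snd.congr_of_eventuallyEq ?_
    filter_upwards [continuous_snd.continuousAt.eventually (hKc.isOpen_compl.mem_nhds hwK)]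
      with z' hz'
    exact extendedFlow_eq_self hΨK hz' _

end Extension

end SkinnerRusk

/-! ### The fundamental lemma of the calculus of variations on `W_r` -/

namespace SkinnerRusk

variable {n : ℕ} {B : ConfigurationBundle.{u, v} n} {m : ℕ}

theorem continuousAt_flatExteriorDerivative {H : Type*} [NormedAddCommGroup H] [NormedSpace ℝ H]
    {Θ : H → H →L[ℝ] ℝ} {x a b : ℝ → H} {t : ℝ} (hΘ : ContDiffAt ℝ ∞ Θ (x t))
    (hx : ContinuousAt x t) (ha : ContinuousAt a t) (hb : ContinuousAt b t) :
    ContinuousAt (fun t => flatExteriorDerivative Θ (x t) (a t) (b t)) t := by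
  have h1 : ContinuousAt (fun t => fderiv ℝ Θ (x t)) t :=
    ContinuousAt.comp (f := x) (hΘ.fderiv_right (m := 0) (by simp)).continuousAt hx
  exact ((h1.clm_apply ha).clm_apply hb).sub ((h1.clm_apply hb).clm_apply ha)

/-- The time and the two or more `ℝⁿ`-valued coordinates `q_0, …, q_{2m+1}` already give three
dimensions. -/
theorem three_le_finrank_restrictedModel (hn : 0 < n) (m : ℕ) :
    3 ≤ Module.finrank ℝ (RestrictedModel n m) := by
  have h1 : Module.finrank ℝ (JetModel n (2 * m + 1)) = 1 + (2 * m + 1 + 1) * n := by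
    simp [Module.finrank_prod, Module.finrank_pi_fintype]
  rw [Module.finrank_prod, h1]
  nlinarith [Nat.zero_le (Module.finrank ℝ (MomentumModel n m)), Nat.zero_le (m * n)]

/-- For `n = 0` the time is the only coordinate, and vertical vectors vanish. -/
theorem RestrictedModel.pos_of_ne_zero {V : RestrictedModel n m} (hV : V ≠ 0) (h : V.1.1 = 0) :
    0 < n := by
  refine Nat.pos_of_ne_zero fun hn => hV ?_
  subst hn
  exact Prod.ext (Prod.ext h (Subsingleton.elim _ _))
    (ContinuousLinearMap.ext fun x => by rw [Subsingleton.elim x 0, map_zero, map_zero])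

section Variation

variable {L : Jet B (m + 1) → ℝ} {ψ : ℝ → RestrictedBundle B m}

theorem coordDeriv_extendedField (w₀ : RestrictedBundle B m) {c : AdaptedChart B}
    (F : RestrictedModel n m → RestrictedModel n m) {w : RestrictedBundle B m}
    (hw : w.jet.base ∈ c.chart.source) :
    RestrictedBundle.coordDeriv c w (extendedField (RestrictedBundle.chart w₀ c) F w) =
      F (RestrictedBundle.coord c w) := by
  rw [extendedField_of_mem (e := RestrictedBundle.chart w₀ c) hw]
  exact mfderiv_chartField (RestrictedBundle.chart_mem_atlas w₀ c) F hw

/-- If the value were positive, a rotation field through `v`, cut off near `ψ t₀`, would make the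
integrand `Ω_r(Z, ψ')` nonnegative everywhere and positive at `t₀`, while criticality forces its
integral to vanish. -/
theorem not_pos_of_isVariationalSolution
    (hL : ContMDiff 𝓘(ℝ, JetModel n (m + 1)) 𝓘(ℝ, ℝ) ∞ L) (hψ : IsGlobalSection ψ)
    (hint : Integrable (pullbackOneForm L ψ)) (h : IsVariationalSolution L ψ) {t₀ : ℝ}
    {v : TangentSpace 𝓘(ℝ, RestrictedModel n m) (ψ t₀)} (hv : timeForm (ψ t₀) v = 0) :
    ¬0 < unifiedTwoForm L (ψ t₀) v (velocity ψ t₀) := by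
  intro hpos
  obtain ⟨c, hc⟩ := exists_adaptedChart (ψ t₀).jet.base
  have hψd : ∀ t, MDifferentiableAt 𝓘(ℝ, ℝ) 𝓘(ℝ, RestrictedModel n m) ψ t :=
    fun t => hψ.1.contMDiffAt.mdifferentiableAt (by simp)
  set ℓ := coordLagrangian L (ψ t₀).jet c
  set x : ℝ → RestrictedModel n m := fun t => RestrictedBundle.coord c (ψ t) with hxdef
  set V : RestrictedModel n m := RestrictedBundle.coordDeriv c (ψ t₀) v with hVdef
  set e := RestrictedBundle.chart (ψ t₀) c with hedef
  have he : e ∈ atlas _ _ := RestrictedBundle.chart_mem_atlas (ψ t₀) c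
  have hx' : ∀ t, ψ t ∈ e.source →
      RestrictedBundle.coordDeriv c (ψ t) (velocity ψ t) = fderiv ℝ x t 1 := fun t ht => by
    rw [fderiv_apply_one_eq_deriv]
    exact (hasDerivAt_coord_comp (hψd t) ht).deriv.symm
  have hΩ : ∀ t, ψ t ∈ e.source → ∀ u, unifiedTwoForm L (ψ t) u (velocity ψ t) =
      -flatExteriorDerivative (coordOneForm ℓ) (x t) (RestrictedBundle.coordDeriv c (ψ t) u)
        (fderiv ℝ x t 1) := fun t ht u => by
    rw [← hx' t ht]
    exact unifiedTwoForm_apply hL (ψ t₀) ht u _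
  have hV1 : V.1.1 = 0 := by rw [← hv, RestrictedBundle.timeForm_apply hc]
  rw [hΩ t₀ hc] at hpos
  have hV : V ≠ 0 := by
    intro hV
    rw [← hVdef, hV] at hpos
    simp [flatExteriorDerivative] at hpos
  let τ : RestrictedModel n m →L[ℝ] ℝ :=
    (ContinuousLinearMap.fst ℝ _ _).comp (ContinuousLinearMap.fst ℝ _ _)
  obtain ⟨A, c₀, a, ha, hA, hA3, hτA, hbump⟩ := exists_rotation_bump
    (three_le_finrank_restrictedModel (RestrictedModel.pos_of_ne_zero hV hV1) m) τ hV hV1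
    e.open_target (x₀ := x t₀) (e.map_source hc)
  -- The integrand without its bump factor. At `t₀` the rotation field equals `a • V` with `a > 0`,
  -- so `g` is positive there and, by continuity, on an interval of radius `η`.
  let g : ℝ → ℝ := fun t =>
    -flatExteriorDerivative (coordOneForm ℓ) (x t) (A (x t - c₀)) (fderiv ℝ x t 1)
  have hg0 : 0 < g t₀ := by
    have h1 : g t₀ = a * -flatExteriorDerivative (coordOneForm ℓ) (x t₀) V (fderiv ℝ x t₀ 1) := by
      simp only [g, hA, flatExteriorDerivative, map_smul, _root_.smul_apply,
        smul_eq_mul]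
      ring
    rw [h1]
    exact mul_pos ha hpos
  have hgc : ContinuousAt g t₀ := by
    have h1 : ContDiffAt ℝ ∞ x t₀ := ((RestrictedBundle.contMDiffAt_coord hc).comp t₀
      hψ.1.contMDiffAt).contDiffAt
    have h2 : ContinuousAt (fun t => fderiv ℝ x t 1) t₀ :=
      ((h1.fderiv_right (m := 0) (by simp)).continuousAt).clm_apply continuousAt_const
    have h3 : ContDiffAt ℝ ∞ (coordOneForm ℓ) (x t₀) :=
      (isExpression_unifiedOneForm hL (ψ t₀) c).smooth.contDiffAt
        (e.open_target.mem_nhds (e.map_source hc))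
    have h5 : ContinuousAt (fun t => A (x t - c₀)) t₀ :=
      A.continuous.continuousAt.comp (h1.continuousAt.sub continuousAt_const)
    exact (continuousAt_flatExteriorDerivative h3 h1.continuousAt h5 h2).neg
  obtain ⟨η, hη, hgη⟩ := Metric.eventually_nhds_iff.1 (hgc.eventually (lt_mem_nhds hg0))
  obtain ⟨ρ, K, hρ, hK, hKe, hρK, hρ0, hρx, hρτ, hρrot⟩ := hbump η hη
  let F : RestrictedModel n m → RestrictedModel n m := fun y => ρ y • A (y - c₀)
  let Ψ := rotationFlow A c₀ ρ
  let Z : VectorFieldOn B m := extendedField e F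
  let σ : ℝ → RestrictedBundle B m → RestrictedBundle B m := extendedFlow e Ψ
  have hF : ContDiff ℝ ∞ F := hρ.smul (A.contDiff.comp (contDiff_id.sub contDiff_const))
  have hFK : ∀ y ∉ K, F y = 0 := fun y hy => by simp only [F, hρK y hy, zero_smul]
  have hΨK : ∀ s, ∀ y ∉ K, Ψ s y = y := fun s y hy => rotationFlow_eq_self (hρK y hy) s
  -- A point is either fixed or keeps a nonzero value of `ρ`, and then it remains in `K`.
  have hΨe : ∀ s, ∀ y ∈ e.target, Ψ s y ∈ e.target := by
    intro s y hy
    by_cases hyρ : ρ y = 0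
    · rwa [show Ψ s y = y from rotationFlow_eq_self hyρ s]
    · refine hKe ?_
      by_contra hn
      exact hyρ ((hρrot _ _).symm.trans (hρK _ hn))
  have hZ : IsSmoothField Z := contMDiff_extendedField he hF hK hKe hFK
  have hZc : ∀ w, w ∈ e.source → RestrictedBundle.coordDeriv c w (Z w) =
      F (RestrictedBundle.coord c w) := fun w hw => coordDeriv_extendedField (ψ t₀) F hw
  have hZ0 : ∀ w, w ∉ e.source → Z w = 0 := fun w hw => if_neg hw
  have hZt : ∀ w, timeForm w (Z w) = 0 := by
    intro w
    by_cases hw : w ∈ e.source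
    · rw [RestrictedBundle.timeForm_apply hw, hZc w hw]
      change τ (ρ _ • A _) = 0
      rw [map_smul, hτA, smul_zero]
    · rw [hZ0 w hw, map_zero]
  have hK' : IsCompact (e.symm '' K) := hK.image_of_continuousOn (e.continuousOn_symm.mono hKe)
  have hZK : IsCompact (closure {w | Z w ≠ 0}) := by
    refine hK'.of_isClosed_subset isClosed_closure (closure_minimal (fun w hw => ?_) hK'.isClosed)
    by_contra hn
    exact hw (extendedField_eq_zero he hFK hn)
  have hσ : IsLocalFlow Z 1 σ :=
    { pos := one_pos
      smooth := (contMDiff_extendedFlow he (contDiff_rotationFlow hρ) hΨe hK hKe hΨK).contMDiffOn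
      zero := fun w => by
        by_cases hw : w ∈ e.source
        · exact (extendedFlow_of_mem hw 0).trans
            ((congrArg e.symm (rotationFlow_zero (e w))).trans (e.left_inv hw))
        · exact if_neg hw
      integral := fun w => (isMIntegralCurve_extendedFlow he hΨe
        (hasDerivAt_rotationFlow hA3 hρrot) w).isMIntegralCurveOn _ }
  obtain ⟨T, hT, hZT, hcont, hder⟩ := exists_hasDerivAt_functionalLH hL hψ hint hZ hZK hσ
  have h0 := hder.unique (h.2 Z hZ hZt hZK 1 σ hσ)
  have hzero : ∀ t, Z (ψ t) = 0 → unifiedTwoForm L (ψ t) (Z (ψ t)) (velocity ψ t) = 0 := by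
    intro t ht
    rw [ht, unifiedTwoForm_eq_linear]
    exact (congrArg (fun B : RestrictedModel n m →L[ℝ] ℝ => B (velocity ψ t))
      (map_zero (unifiedTwoFormLinear L (ψ t)))).trans rfl
  have hval : ∀ t, ψ t ∈ e.source →
      unifiedTwoForm L (ψ t) (Z (ψ t)) (velocity ψ t) = ρ (x t) * g t := by
    intro t ht
    rw [hΩ t ht, hZc _ ht]
    simp only [F, g, flatExteriorDerivative, map_smul, _root_.smul_apply, smul_eq_mul]
    ring
  -- The curve may return to the chart at distant times. There the cutoff in the time coordinate
  -- makes `ρ` vanish, because `ψ` is a section; so `ρ ≠ 0` only where `g` is positive.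
  have hnonneg : ∀ t, 0 ≤ unifiedTwoForm L (ψ t) (Z (ψ t)) (velocity ψ t) := by
    intro t
    by_cases ht : ψ t ∈ e.source
    · rw [hval t ht]
      by_cases hρt : ρ (x t) = 0
      · rw [hρt, zero_mul]
      · refine mul_nonneg (hρ0 _) (hgη ?_).le
        have := hρτ _ hρt
        change |(ψ t).time - (ψ t₀).time| < η at this
        rwa [hψ.2, hψ.2] at this
    · exact (hzero t (hZ0 _ ht)).ge
  have hpos' : 0 < unifiedTwoForm L (ψ t₀) (Z (ψ t₀)) (velocity ψ t₀) := by
    rw [hval t₀ hc]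
    exact mul_pos hρx hg0
  have hsupp : Function.support (fun t => unifiedTwoForm L (ψ t) (Z (ψ t)) (velocity ψ t)) ⊆
      Ioc (-T) T := by
    intro t ht
    by_contra hn
    refine ht (hzero t (hZT t ?_))
    by_contra hlt
    obtain ⟨h1, h2⟩ := abs_lt.1 (not_le.1 hlt)
    exact hn ⟨h1, h2.le⟩
  rw [intervalIntegral.integral_neg, neg_eq_zero,
    intervalIntegral.integral_eq_integral_of_support_subset hsupp] at h0
  have := hcont.integral_pos_of_hasCompactSupport_nonneg_nonzero (μ := volume)
    (HasCompactSupport.of_support_subset_isCompact isCompact_Icc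
      (hsupp.trans Ioc_subset_Icc_self)) hnonneg hpos'.ne'
  exact this.ne' h0

/-- The Euler–Lagrange equations of the variational problem. -/
theorem unifiedTwoForm_velocity_eq_zero_of_isVariationalSolution
    (hL : ContMDiff 𝓘(ℝ, JetModel n (m + 1)) 𝓘(ℝ, ℝ) ∞ L) (hψ : IsGlobalSection ψ)
    (hint : Integrable (pullbackOneForm L ψ)) (h : IsVariationalSolution L ψ) (t : ℝ)
    (v : TangentSpace 𝓘(ℝ, RestrictedModel n m) (ψ t)) :
    unifiedTwoForm L (ψ t) v (velocity ψ t) = 0 := by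
  have hψd : MDifferentiableAt 𝓘(ℝ, ℝ) 𝓘(ℝ, RestrictedModel n m) ψ t :=
    hψ.1.contMDiffAt.mdifferentiableAt (by simp)
  have h1 := (isHolonomicVector_velocity hψd (Eventually.of_forall h.1)).1
  have h2 : unifiedTwoForm L (ψ t) (velocity ψ t) (velocity ψ t) = 0 :=
    self_eq_neg.1 (unifiedTwoForm_swap L (ψ t) _ _)
  let b := unifiedTwoFormLinear L (ψ t)
  let u : RestrictedModel n m := velocity ψ t
  let z : RestrictedModel n m := v
  let r : ℝ := timeForm (ψ t) v
  have h3 : b u u = 0 := by rw [← h2, unifiedTwoForm_eq_linear]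
  -- Subtracting `dt(v) ψ'` makes the vector vertical without changing its pairing with `ψ'`. The
  -- factor `k` covers both signs: `k = b z u` gives a square.
  have h4 : ∀ k : ℝ, ¬0 < k * b z u := by
    intro k hk
    have hv : timeForm (ψ t) (k • (v - r • velocity ψ t)) = 0 := by
      rw [map_smul, map_sub, map_smul, h1]
      simp [r]
    refine not_pos_of_isVariationalSolution hL hψ hint h hv ?_
    rw [unifiedTwoForm_smul, unifiedTwoForm_eq_linear]
    have h5 : b (z - r • u) u = b z u := by
      rw [map_sub, map_smul, _root_.sub_apply, _root_.smul_apply, h3,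
        smul_zero, sub_zero]
    exact hk.trans_eq (congrArg (k * ·) h5.symm)
  have h6 := h4 (b z u)
  rw [unifiedTwoForm_eq_linear]
  by_contra hne
  exact h6 (mul_self_pos.2 hne)

end Variation

end SkinnerRusk

/-- Lebesgue integrability of the integrand is the absolute convergence of `LH(ψ)`. In the step from
(1) to (2) the pairing vanishes on all tangent vectors, not only on vertical ones, by the reduction
along `ψ'`. -/
theorem mainTheorem1 {n m : ℕ} (B : ConfigurationBundle.{u, v} n)
    (L : Jet B (m + 1) → ℝ) (hL : ContMDiff 𝓘(ℝ, JetModel n (m + 1)) 𝓘(ℝ, ℝ) ∞ L)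
    (ψ : ℝ → RestrictedBundle B m) (hψ : IsGlobalSection ψ) :
    (MeasureTheory.Integrable (pullbackOneForm L ψ) →
      (IsVariationalSolution L ψ ↔
        IsHolonomic ψ ∧ ∀ Y : VectorFieldOn B m, IsSmoothField Y →
          ∀ t, unifiedTwoForm L (ψ t) (Y (ψ t)) (velocity ψ t) = 0)) ∧
    List.TFAE [
      IsHolonomic ψ ∧ ∀ Y : VectorFieldOn B m, IsSmoothField Y →
        ∀ t, unifiedTwoForm L (ψ t) (Y (ψ t)) (velocity ψ t) = 0,
      IsHolonomic ψ ∧ ∀ t, ∀ v, unifiedTwoForm L (ψ t) (velocity ψ t) v = 0,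
      ∃ X : VectorFieldOn B m, IsSmoothField X ∧ IsTransverse X ∧ IsSemispray X ∧
        IsMIntegralCurve ψ X ∧ ∀ t, ∀ v, unifiedTwoForm L (ψ t) (X (ψ t)) v = 0,
      ∃ X : VectorFieldOn B m, IsSmoothField X ∧ (∀ w, timeForm w (X w) = 1) ∧ IsSemispray X ∧
        IsMIntegralCurve ψ X ∧ (∀ t, ψ t ∈ compatibilitySet L) ∧
        ∀ w ∈ compatibilitySet L, ∀ v, unifiedTwoForm L w (X w) v = 0] := by
  refine ⟨fun hint => ⟨fun h => ⟨h.1, fun Y _ t =>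
    unifiedTwoForm_velocity_eq_zero_of_isVariationalSolution hL hψ hint h t (Y (ψ t))⟩,
    fun h => isVariationalSolution_of_forall_eq_zero hL hψ hint h.1 h.2⟩,
    tfae_solutions hL hψ⟩
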